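/- **Setting.** Let $n\ge 1$, $d\ge 0$, and let $r=(m,V)$ with $m\in\mathbb R^d$, $V\in\mathbb R^{d\times d}$ be identified with a vector of $\mathbb R^{d+d^2}$ (Euclidean norm). For $i=1,\dots,n$ let $f\mapsto p(y_i\mid f)$ be a twice differentiable likelihood function on $\mathbb R$, and let $q(f_i\mid r)=\mathcal N(a_{i,1}^\top m+b_{i,1},\,a_{i,2}^\top V a_{i,2}+b_{i,2})$ with fixed vectors $a_{i,1},a_{i,2}$ and scalars $b_{i,1}\in\mathbb R$, $b_{i,2}\ge 0$. Put $g_i(r,\epsilon)=\sqrt{a_{i,2}^\top Va_{i,2}+b_{i,2}}\,\epsilon+a_{i,1}^\top m+b_{i,1}$, $\phi_i(r,\epsilon)=p(y_i\mid g_i(r,\epsilon))$, and let $\phi_i',\phi_i''$ be the first and second derivatives of $p(y_i\mid f)$ in $f$ evaluated at $f=g_i(r,\epsilon)$. Write $\mathbb E\phi_i(r)=\mathbb E_{\epsilon\sim\mathcal N(0,1)}\phi_i(r,\epsilon)=\mathbb E_{q(f_i|r)}p(y_i|f_i)$, and similarly $\mathbb E\phi_i'(r)$, $\mathbb E\phi_i''(r)$.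 With a Gaussian prior $\mathcal N(m_0,S_0)$, $S_0$ positive definite, and $\beta\ge 0$, the objective is $$h(r)=-\frac1n\sum_{i=1}^n\log\mathbb E\phi_i(r)+\frac{\beta}{n}\,d_{KL}\big(\mathcal N(m,V)\,\|\,\mathcal N(m_0,S_0)\big).$$ Assume there are finite constants with $0\le\phi_i\le B$, $b'\le\phi_i'\le B'$, $b''\le\phi_i''\le B''$ for all $i,r,\epsilon$. **Algorithm (smooth-bMC).** Let $\gamma_t>0$ with $\sum_t\gamma_t=\infty$, $\sum_t\gamma_t^2<\infty$, let $\zeta>0$, and let $\nu_t=\gamma_t\zeta$. Start from an $\mathcal F_0$-measurable, square-integrable $r_0$ (e.g. a constant), where $(\mathcal F_t)$ is the history filtration. At step $t$ choose an $\mathcal F_t$-measurable sample size $L=L_t\ge1$; for every $i$ draw i.i.d. $\epsilon^{(\ell)}=\epsilon^{(\ell)}_{t,i}\sim\mathcal N(0,1)$, independent of $\mathcal F_t$ and known at time $t+1$ (draws for different $i$ may be shared, independent or otherwise dependent), and set $r_{t+1}=r_t+\gamma_t d_t$ with $$d_t=\frac1n\sum_i(d_{i,m},d_{i,V})-\nabla\Big(\frac\beta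 n d_{KL}\Big)(r_t),$$ $$d_{i,m}=\frac{\frac1L\sum_\ell\phi_i'(r_t,\epsilon^{(\ell)})}{\frac1L\sum_\ell\phi_i(r_t,\epsilon^{(\ell)})+\nu_t}\,a_{i,1},\qquad d_{i,V}=\frac{\frac1L\sum_\ell\phi_i''(r_t,\epsilon^{(\ell)})}{\frac1L\sum_\ell\phi_i(r_t,\epsilon^{(\ell)})+\nu_t}\,\frac{a_{i,2}a_{i,2}^\top}{2}.$$ **Corollary.** Suppose that, almost surely, for all $t$ and $i$: $\mathbb E_{q(f_i|r_t)}p(y_i|f_i)\ge\zeta$; $V_t$ is symmetric with all eigenvalues at least a fixed $v>0$; and, with $\delta_t=\gamma_t^4$, $$L_t>\frac{\log(6n/\delta_t)}{2\gamma_t^2}\max\Big\{\frac{B^2}{|\mathbb E\phi_i(r_t)|^2},\frac{(B'-b')^2}{P^2},\frac{(B''-b'')^2}{Q^2}\Big\},$$ where $P=|\mathbb E\phi_i'(r_t)|$ if this is nonzero and $P=1$ otherwise, and $Q=|\mathbb E\phi_i''(r_t)|$ if this is nonzero and $Q=1$ otherwise. Let $s_t=-\nabla h(r_t)$ and $w_t=d_t-s_t$.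 Then smooth-bMC satisfies the conditions of the modified stochastic gradient proposition: there are a constant $C$ and a function $f:\mathbb R^{d+d^2}\to\mathbb R$ such that, on the set of all $r=(m,V)$ with $V$ symmetric, $V\succeq vI$ and $\mathbb E\phi_i(r)\ge\zeta$ for all $i$ (which a.s. contains every $r_t$), $f=h+C$, $h$ is differentiable and $\nabla f=\nabla h$, and such that * (a) $f\ge 0$ on $\mathbb R^{d+d^2}$; * (b) $f$ is $C^1$ on $\mathbb R^{d+d^2}$ with globally Lipschitz gradient; * (c) for some $c_1,c_2>0$ and all $t$, a.s. $c_1\|\nabla f(r_t)\|^2\le-\nabla f(r_t)^\top\mathbb E[s_t|\mathcal F_t]$ and $\mathbb E[\|s_t\|^2|\mathcal F_t]\le c_2\|\nabla f(r_t)\|^2$; * (d) for some $p,q>0$ and all $t$, a.s. $\mathbb E[\|w_t\|^2|\mathcal F_t]\le\big(\gamma_t(q+p\|\nabla f(r_t)\|)\big)^2$; where $r_t$ is $\mathcal F_t$-measurable, $s_t,w_t$ are square-integrable, $r_{t+1}=r_t+\gamma_t(s_t+w_t)$, $\gamma_t\ge0$, $\sum\gamma_t=\infty$ and $\sum\gamma_t^2<\infty$.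 Hence smooth-bMC converges with probability 1: almost surely $h(r_t)$ converges to a finite limit, $\nabla h(r_t)\to0$, and every limit point of $(r_t)$ is a stationary point of $h$. -/

import Mathlib

open MeasureTheory ProbabilityTheory Filter Topology
open scoped Matrix NNReal

noncomputable section

namespace SmoothBMC

/-! ### The model and its objective -/

/-- The parameter space of `r = (m, V)`, with `m ∈ ℝ^d` and the `d × d` matrix `V` vectorised,
carrying the Euclidean norm of `ℝ^(d + d²)`. -/
abbrev Param (d : ℕ) : Type := EuclideanSpace ℝ (Fin d ⊕ Fin d × Fin d)

/-- The mean `m` of `r = (m, V)`. -/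
def mean {d : ℕ} (r : Param d) : EuclideanSpace ℝ (Fin d) :=
  WithLp.toLp 2 fun j => r (Sum.inl j)

/-- The covariance matrix `V` of `r = (m, V)`. -/
def cov {d : ℕ} (r : Param d) : Matrix (Fin d) (Fin d) ℝ :=
  Matrix.of fun j k => r (Sum.inr (j, k))

/-- The vector `(u, W)` of the parameter space. -/
def pack {d : ℕ} (u : Fin d → ℝ) (W : Matrix (Fin d) (Fin d) ℝ) : Param d :=
  WithLp.toLp 2 (Sum.elim u fun jk => W jk.1 jk.2)

/-- The Kullback-Leibler divergence of `N(m, V)` from `N(m₀, S)` in closed form, for positive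
definite `V` and `S` (see `klDiv_multivariateGaussian` below). -/
def gaussianKL {d : ℕ} (m : EuclideanSpace ℝ (Fin d)) (V : Matrix (Fin d) (Fin d) ℝ)
    (m₀ : EuclideanSpace ℝ (Fin d)) (S : Matrix (Fin d) (Fin d) ℝ) : ℝ :=
  1 / 2 * ((S⁻¹ * V).trace + (m.ofLp - m₀.ofLp) ⬝ᵥ S⁻¹ *ᵥ (m.ofLp - m₀.ofLp) - (d : ℝ)
    + Real.log S.det - Real.log V.det)

/-- The density of the standard Gaussian measure on `ℝ^d`. -/
theorem stdGaussian_eq_withDensity (d : ℕ) :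
    stdGaussian (EuclideanSpace ℝ (Fin d)) = volume.withDensity fun x =>
      ENNReal.ofReal (((2 * Real.pi) ^ ((d : ℝ) / 2))⁻¹ * Real.exp (-(1 / 2) * ‖x‖ ^ 2)) := by
  have hhalf : (0 : ℝ) < ((1 / 2 : ℂ)).re := by norm_num
  have hint : Integrable (fun x : EuclideanSpace ℝ (Fin d) => Real.exp (-(1 / 2) * ‖x‖ ^ 2)) := by
    have h := (GaussianFourier.integrable_cexp_neg_mul_sq_norm_add hhalf 0
      (0 : EuclideanSpace ℝ (Fin d))).norm
    refine h.congr (ae_of_all _ fun x => ?_)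
    simp only [Complex.norm_exp]
    rw [zero_mul, add_zero, ← Complex.ofReal_pow]
    congr 1
    simp [-Complex.ofReal_pow]
  have hκ : (0 : ℝ) < ((2 * Real.pi) ^ ((d : ℝ) / 2))⁻¹ := by positivity
  have hint' := hint.const_mul (((2 * Real.pi) ^ ((d : ℝ) / 2))⁻¹)
  have hfin : IsFiniteMeasure ((volume : Measure (EuclideanSpace ℝ (Fin d))).withDensity fun x =>
      ENNReal.ofReal (((2 * Real.pi) ^ ((d : ℝ) / 2))⁻¹ * Real.exp (-(1 / 2) * ‖x‖ ^ 2))) :=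
    isFiniteMeasure_withDensity_ofReal hint'.2
  apply Measure.ext_of_charFun
  ext t
  rw [charFun_stdGaussian, charFun_apply,
    integral_withDensity_eq_integral_toReal_smul (by fun_prop) (by simp)]
  have h := GaussianFourier.integral_cexp_neg_mul_sq_norm_add hhalf Complex.I t
  have : ∀ x : EuclideanSpace ℝ (Fin d), (ENNReal.ofReal (((2 * Real.pi) ^ ((d : ℝ) / 2))⁻¹ *
      Real.exp (-(1 / 2) * ‖x‖ ^ 2))).toReal • Complex.exp ((inner ℝ x t : ℝ) * Complex.I) =
      ((((2 * Real.pi) ^ ((d : ℝ) / 2))⁻¹ : ℝ) : ℂ) *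
        Complex.exp (-(1 / 2 : ℂ) * ‖x‖ ^ 2 + Complex.I * (inner ℝ t x : ℝ)) := by
    intro x
    rw [ENNReal.toReal_ofReal (by positivity), Complex.exp_add, real_inner_comm t x]
    simp only [Complex.real_smul, Complex.ofReal_mul, Complex.ofReal_exp]
    push_cast
    ring_nf
  simp_rw [this]
  rw [integral_const_mul, h, Complex.I_sq]
  have hc : ((Real.pi : ℂ) / (1 / 2)) ^ ((Module.finrank ℝ (EuclideanSpace ℝ (Fin d)) : ℂ) / 2) =
      (((2 * Real.pi) ^ ((d : ℝ) / 2) : ℝ) : ℂ) := by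
    rw [Complex.ofReal_cpow (by positivity)]
    push_cast
    simp
    ring_nf
  rw [hc, ← mul_assoc, ← Complex.ofReal_mul, inv_mul_cancel₀ (by positivity)]
  simp
  ring_nf

/-- The density of a non-degenerate Gaussian measure on `ℝ^d`. -/
theorem multivariateGaussian_eq_withDensity {d : ℕ} (m : EuclideanSpace ℝ (Fin d))
    {V : Matrix (Fin d) (Fin d) ℝ} (hV : V.PosDef) :
    multivariateGaussian m V = volume.withDensity fun x =>
      ENNReal.ofReal (((2 * Real.pi) ^ ((d : ℝ) / 2))⁻¹ * Real.exp (-(1 / 2) * Real.log V.det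
        - 1 / 2 * ((x - m).ofLp ⬝ᵥ V⁻¹ *ᵥ (x - m).ofLp))) := by
  open scoped MatrixOrder in
  set A : Matrix (Fin d) (Fin d) ℝ := CFC.sqrt V with hA
  have hAA : A * A = V := CFC.sqrt_mul_sqrt_self _ hV.posSemidef.nonneg
  have hAsymm : Aᵀ = A := by
    have : A.PosSemidef := by
      rw [← Matrix.nonneg_iff_posSemidef]; exact CFC.sqrt_nonneg V
    exact (by simpa using this.1 : A.IsSymm)
  have hdet : A.det * A.det = V.det := by rw [← Matrix.det_mul, hAA]
  have hdetpos : 0 < V.det := hV.det_pos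
  have hA0 : A.det ≠ 0 := by
    intro h; rw [h] at hdet; simp at hdet; linarith
  have habs : |A.det| = Real.exp (1 / 2 * Real.log V.det) := by
    rw [← hdet, ← abs_mul_abs_self, Real.log_mul (by simpa) (by simpa)]
    rw [show 1 / 2 * (Real.log |A.det| + Real.log |A.det|) = Real.log |A.det| by ring,
      Real.exp_log (abs_pos.2 hA0)]
  have hAu : IsUnit A.det := isUnit_iff_ne_zero.2 hA0
  have hquad : ∀ x : EuclideanSpace ℝ (Fin d),
      (A *ᵥ x.ofLp) ⬝ᵥ V⁻¹ *ᵥ (A *ᵥ x.ofLp) = ‖x‖ ^ 2 := by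
    intro x
    rw [Matrix.mulVec_mulVec, ← hAA, Matrix.mul_inv_rev, Matrix.mul_assoc,
      Matrix.nonsing_inv_mul _ hAu, Matrix.mul_one, Matrix.dotProduct_mulVec,
      ← Matrix.mulVec_transpose, Matrix.transpose_nonsing_inv, hAsymm, Matrix.mulVec_mulVec,
      Matrix.nonsing_inv_mul _ hAu, Matrix.one_mulVec, EuclideanSpace.real_norm_sq_eq]
    simp [dotProduct, sq]
  set T : EuclideanSpace ℝ (Fin d) → EuclideanSpace ℝ (Fin d) :=
    fun x => m + Matrix.toEuclideanCLM (𝕜 := ℝ) A x with hT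
  have hTm : Measurable T := by fun_prop
  have hTinj : Function.Injective T := by
    intro x y hxy
    have h1 : Matrix.toEuclideanCLM (𝕜 := ℝ) A x = Matrix.toEuclideanCLM (𝕜 := ℝ) A y :=
      add_left_cancel hxy
    have h2 : A *ᵥ x.ofLp = A *ᵥ y.ofLp := by
      simpa using congrArg WithLp.ofLp h1
    have h3 := congrArg (fun z => A⁻¹ *ᵥ z) h2
    simp only [Matrix.mulVec_mulVec, Matrix.nonsing_inv_mul _ hAu, Matrix.one_mulVec] at h3
    exact WithLp.ofLp_injective 2 h3
  have hTsurj : Function.Surjective T := by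
    intro y
    refine ⟨WithLp.toLp 2 (A⁻¹ *ᵥ (y - m).ofLp), ?_⟩
    simp only [hT, Matrix.toEuclideanCLM_toLp, Matrix.mulVec_mulVec,
      Matrix.mul_nonsing_inv _ hAu, Matrix.one_mulVec]
    simp
  have hcdet : (Matrix.toEuclideanCLM (𝕜 := ℝ) A).det = A.det := by
    change LinearMap.det (Matrix.toEuclideanLin A) = _
    exact LinearMap.det_toLin (PiLp.basisFun 2 ℝ (Fin d)) A
  rw [multivariateGaussian, stdGaussian_eq_withDensity]
  ext s hs
  rw [Measure.map_apply (by fun_prop) hs, withDensity_apply _ (hTm hs), withDensity_apply _ hs]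
  have himg : T '' (T ⁻¹' s) = s := Set.image_preimage_eq s hTsurj
  conv_rhs => rw [← himg]
  rw [lintegral_image_eq_lintegral_abs_det_fderiv_mul volume (hTm hs)
    (fun x _ => (((Matrix.toEuclideanCLM (𝕜 := ℝ) A).hasFDerivAt (x := x)).const_add
      m).hasFDerivWithinAt) hTinj.injOn]
  refine lintegral_congr fun x => ?_
  rw [hcdet, ← ENNReal.ofReal_mul (abs_nonneg _)]
  congr 1
  rw [habs]
  have : (T x - m).ofLp = A *ᵥ x.ofLp := by simp [hT]
  rw [this, hquad, mul_left_comm, ← Real.exp_add]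
  congr 2
  ring

/-- The expectation of a quadratic form under a Gaussian measure. -/
theorem integral_quadratic_multivariateGaussian {d : ℕ} (m c : EuclideanSpace ℝ (Fin d))
    {V : Matrix (Fin d) (Fin d) ℝ} (hV : V.PosSemidef) (Q : Matrix (Fin d) (Fin d) ℝ) :
    Integrable (fun x => (x - c).ofLp ⬝ᵥ Q *ᵥ (x - c).ofLp) (multivariateGaussian m V) ∧
    ∫ x, (x - c).ofLp ⬝ᵥ Q *ᵥ (x - c).ofLp ∂multivariateGaussian m V =
      (Q * V).trace + (m.ofLp - c.ofLp) ⬝ᵥ Q *ᵥ (m.ofLp - c.ofLp) := by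
  set μ := multivariateGaussian m V with hμ
  have hL2 : ∀ j, MemLp (fun x : EuclideanSpace ℝ (Fin d) => x j) 2 μ := by
    intro j
    have := (EuclideanSpace.proj (𝕜 := ℝ) j).comp_memLp' (IsGaussian.memLp_two_id (μ := μ))
    exact this
  have hL2c : ∀ j, MemLp (fun x : EuclideanSpace ℝ (Fin d) => x j - c j) 2 μ :=
    fun j => (hL2 j).sub (memLp_const _)
  have hmean : ∀ j, ∫ x, x j ∂μ = m j := by
    intro j
    have h := (EuclideanSpace.proj (𝕜 := ℝ) j).integral_comp_comm
      (IsGaussian.integrable_fun_id (μ := μ))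
    rw [hμ, integral_id_multivariateGaussian] at h
    exact h
  have hi : ∀ j k, Integrable (fun x : EuclideanSpace ℝ (Fin d) => (x j - c j) * (x k - c k)) μ :=
    fun j k => (hL2c j).integrable_mul (hL2c k)
  have hE : ∀ j k, ∫ x, (x j - c j) * (x k - c k) ∂μ = V j k + (m j - c j) * (m k - c k) := by
    intro j k
    have h := covariance_eval_multivariateGaussian (μ := m) hV j k
    rw [covariance] at h
    have hj := (hL2 j).integrable one_le_two
    have hk := (hL2 k).integrable one_le_two
    rw [← hμ, hmean, hmean] at h
    rw [← h]
    have e : ∀ x : EuclideanSpace ℝ (Fin d), (x j - c j) * (x k - c k) =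
        (x j - m j) * (x k - m k) + ((m k - c k) * (x j - m j) + (m j - c j) * (x k - m k)
          + (m j - c j) * (m k - c k)) := by intro x; ring
    have i1 : Integrable (fun x : EuclideanSpace ℝ (Fin d) => (x j - m j) * (x k - m k)) μ :=
      ((hL2 j).sub (memLp_const _)).integrable_mul ((hL2 k).sub (memLp_const _))
    have ij : Integrable (fun x : EuclideanSpace ℝ (Fin d) => (m k - c k) * (x j - m j)) μ :=
      (hj.sub (integrable_const (m j))).const_mul (m k - c k)
    have ik : Integrable (fun x : EuclideanSpace ℝ (Fin d) => (m j - c j) * (x k - m k)) μ :=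
      (hk.sub (integrable_const (m k))).const_mul (m j - c j)
    have ijk : Integrable (fun x : EuclideanSpace ℝ (Fin d) =>
        (m k - c k) * (x j - m j) + (m j - c j) * (x k - m k)) μ := ij.add ik
    have i0 : Integrable (fun _ : EuclideanSpace ℝ (Fin d) => (m j - c j) * (m k - c k)) μ :=
      integrable_const _
    have i2 : Integrable (fun x : EuclideanSpace ℝ (Fin d) => (m k - c k) * (x j - m j)
        + (m j - c j) * (x k - m k) + (m j - c j) * (m k - c k)) μ := ijk.add i0
    rw [integral_congr_ae (ae_of_all μ e)]
    rw [integral_add i1 i2, integral_add ijk i0, integral_add ij ik, integral_const_mul,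
      integral_const_mul]
    have e1 : ∀ j, ∫ x, (x j - m j) ∂μ = 0 := by
      intro j
      rw [integral_sub ((hL2 j).integrable one_le_two) (integrable_const _), hmean]
      simp
    rw [e1, e1]
    simp
  have hexp : ∀ x : EuclideanSpace ℝ (Fin d), (x - c).ofLp ⬝ᵥ Q *ᵥ (x - c).ofLp =
      ∑ j, ∑ k, Q j k * ((x j - c j) * (x k - c k)) := by
    intro x
    simp only [dotProduct, Matrix.mulVec, Finset.mul_sum]
    refine Finset.sum_congr rfl fun j _ => Finset.sum_congr rfl fun k _ => ?_
    simp
    ring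
  simp_rw [hexp]
  have hi' : ∀ j k, Integrable (fun x : EuclideanSpace ℝ (Fin d) =>
      Q j k * ((x j - c j) * (x k - c k))) μ := fun j k => (hi j k).const_mul _
  refine ⟨integrable_finsetSum _ fun j _ => integrable_finsetSum _ fun k _ => hi' j k, ?_⟩
  rw [integral_finsetSum _ fun j _ => integrable_finsetSum _ fun k _ => hi' j k]
  simp_rw [integral_finsetSum _ fun k _ => hi' _ k, integral_const_mul, hE]
  have hVs : ∀ j k, V j k = V k j := fun j k => by
    have := hV.1.apply k j
    simpa using this
  simp only [Matrix.trace, Matrix.diag, Matrix.mul_apply, dotProduct, Matrix.mulVec,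
    Finset.mul_sum, ← Finset.sum_add_distrib]
  refine Finset.sum_congr rfl fun j _ => Finset.sum_congr rfl fun k _ => ?_
  rw [hVs j k]
  simp
  ring

/-- `gaussianKL` is the Kullback-Leibler divergence of Gaussian measures. -/
theorem klDiv_multivariateGaussian {d : ℕ} (m m₀ : EuclideanSpace ℝ (Fin d))
    {V S : Matrix (Fin d) (Fin d) ℝ} (hV : V.PosDef) (hS : S.PosDef) :
    InformationTheory.klDiv (multivariateGaussian m V) (multivariateGaussian m₀ S) =
      ENNReal.ofReal (gaussianKL m V m₀ S) := by
  set μ := multivariateGaussian m V with hμ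
  set ν := multivariateGaussian m₀ S with hν
  set ℓ : EuclideanSpace ℝ (Fin d) → ℝ := fun x =>
    (1 / 2 * (Real.log S.det - Real.log V.det)
      + 1 / 2 * ((x - m₀).ofLp ⬝ᵥ S⁻¹ *ᵥ (x - m₀).ofLp))
      - 1 / 2 * ((x - m).ofLp ⬝ᵥ V⁻¹ *ᵥ (x - m).ofLp) with hℓ
  have hquad : ∀ (c : EuclideanSpace ℝ (Fin d)) (Q : Matrix (Fin d) (Fin d) ℝ),
      Measurable fun x : EuclideanSpace ℝ (Fin d) => (x - c).ofLp ⬝ᵥ Q *ᵥ (x - c).ofLp := by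
    intro c Q
    simp only [dotProduct, Matrix.mulVec]
    fun_prop
  have hℓm : Measurable ℓ := by
    have := hquad m V⁻¹
    have := hquad m₀ S⁻¹
    fun_prop
  have hdens : μ = ν.withDensity fun x => ENNReal.ofReal (Real.exp (ℓ x)) := by
    rw [hμ, hν, multivariateGaussian_eq_withDensity m hV,
      multivariateGaussian_eq_withDensity m₀ hS, ← withDensity_mul]
    · congr 1
      ext x
      rw [Pi.mul_apply, ← ENNReal.ofReal_mul (by positivity), mul_assoc, ← Real.exp_add]
      congr 3
      simp only [hℓ]
      ring
    · have := hquad m₀ S⁻¹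
      fun_prop
    · fun_prop
  have hac : μ ≪ ν := by rw [hdens]; exact withDensity_absolutelyContinuous _ _
  have hllr : llr μ ν =ᵐ[μ] ℓ := by
    refine hac.ae_le ?_
    have h := Measure.rnDeriv_withDensity ν (f := fun x => ENNReal.ofReal (Real.exp (ℓ x)))
      (by fun_prop)
    rw [← hdens] at h
    filter_upwards [h] with x hx
    rw [llr, hx, ENNReal.toReal_ofReal (Real.exp_pos _).le, Real.log_exp]
  obtain ⟨i₁, e₁⟩ := integral_quadratic_multivariateGaussian m m₀ hV.posSemidef S⁻¹
  obtain ⟨i₂, e₂⟩ := integral_quadratic_multivariateGaussian m m hV.posSemidef V⁻¹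
  have hi : Integrable (llr μ ν) μ :=
    ((((integrable_const _).add (i₁.const_mul _)).sub (i₂.const_mul _)).congr hllr.symm :)
  have hval : ∫ x, llr μ ν x ∂μ = gaussianKL m V m₀ S := by
    rw [integral_congr_ae hllr]
    have j₁ := i₁.const_mul (1 / 2)
    have j₂ := i₂.const_mul (1 / 2)
    have j₀ : Integrable (fun _ : EuclideanSpace ℝ (Fin d) =>
        1 / 2 * (Real.log S.det - Real.log V.det)) μ := integrable_const _
    have j₃ : Integrable (fun x : EuclideanSpace ℝ (Fin d) =>
        1 / 2 * (Real.log S.det - Real.log V.det)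
          + 1 / 2 * ((x - m₀).ofLp ⬝ᵥ S⁻¹ *ᵥ (x - m₀).ofLp)) μ := j₀.add j₁
    simp only [hℓ]
    rw [integral_sub j₃ j₂, integral_add j₀ j₁, integral_const_mul,
      integral_const_mul, integral_const_mul, e₁, e₂, Matrix.nonsing_inv_mul _ (isUnit_iff_ne_zero.2 hV.det_pos.ne')]
    simp [gaussianKL]
    ring
  rw [← ENNReal.ofReal_toReal (InformationTheory.klDiv_ne_top hac hi),
    InformationTheory.toReal_klDiv_of_measure_eq hac (by simp), hval]

/-- The data of the learning problem with `n` examples: `lik i f` is the likelihood `p(y_i | f)`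
of the observation `y_i`; the predictive distribution is
`q(f_i | r) = N(a₁ᵢᵀ m + b₁ᵢ, a₂ᵢᵀ V a₂ᵢ + b₂ᵢ)`; the prior is `N(m₀, S₀)` and `β` is the
regularization parameter. -/
structure Model (n d : ℕ) where
  lik : Fin n → ℝ → ℝ
  a₁ : Fin n → Fin d → ℝ
  a₂ : Fin n → Fin d → ℝ
  b₁ : Fin n → ℝ
  b₂ : Fin n → ℝ
  m₀ : EuclideanSpace ℝ (Fin d)
  S₀ : Matrix (Fin d) (Fin d) ℝ
  β : ℝ

namespace Model

variable {n d : ℕ} (M : Model n d)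

/-- The mean of `q(f_i | r)`. -/
def latentMean (i : Fin n) (r : Param d) : ℝ := M.a₁ i ⬝ᵥ (mean r).ofLp + M.b₁ i

/-- The variance of `q(f_i | r)`. -/
def latentVar (i : Fin n) (r : Param d) : ℝ := M.a₂ i ⬝ᵥ cov r *ᵥ M.a₂ i + M.b₂ i

/-- The reparameterization `g_i(r, ε)`. -/
def g (i : Fin n) (r : Param d) (ε : ℝ) : ℝ := √(M.latentVar i r) * ε + M.latentMean i r

/-- `φ_i(r, ε) = p(y_i | f_i = g_i(r, ε))`. -/
def φ (i : Fin n) (r : Param d) (ε : ℝ) : ℝ := M.lik i (M.g i r ε)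

/-- `φ_i'(r, ε) = ∂/∂f_i p(y_i | f_i = g_i(r, ε))`. -/
def φ' (i : Fin n) (r : Param d) (ε : ℝ) : ℝ := deriv (M.lik i) (M.g i r ε)

/-- `φ_i''(r, ε) = ∂²/∂f_i² p(y_i | f_i = g_i(r, ε))`. -/
def φ'' (i : Fin n) (r : Param d) (ε : ℝ) : ℝ := deriv (deriv (M.lik i)) (M.g i r ε)

/-- `E_{N(ε|0,1)} φ_i(r, ε)`, that is, `E_{q(f_i|r)} p(y_i | f_i)`. -/
def Eφ (i : Fin n) (r : Param d) : ℝ := ∫ ε, M.φ i r ε ∂gaussianReal 0 1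

/-- `Eφ` is the expectation of the likelihood under `q(f_i | r)`. -/
theorem Eφ_eq_integral (i : Fin n) (r : Param d) (hv : 0 ≤ M.latentVar i r)
    (hm : Measurable (M.lik i)) :
    M.Eφ i r =
      ∫ f, M.lik i f ∂gaussianReal (M.latentMean i r) (M.latentVar i r).toNNReal := by
  have h : (gaussianReal 0 1).map (fun ε => √(M.latentVar i r) * ε + M.latentMean i r) =
      gaussianReal (M.latentMean i r) (M.latentVar i r).toNNReal := by
    have e : (fun ε => √(M.latentVar i r) * ε + M.latentMean i r) =
        (fun x => x + M.latentMean i r) ∘ fun ε => √(M.latentVar i r) * ε := rfl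
    rw [e, ← Measure.map_map (by fun_prop) (by fun_prop), gaussianReal_map_const_mul,
      gaussianReal_map_add_const]
    congr 1
    · simp
    · ext
      simp [Real.sq_sqrt hv, Real.coe_toNNReal _ hv]
  rw [← h, integral_map (by fun_prop) hm.aestronglyMeasurable]
  rfl

/-- `E_{N(ε|0,1)} φ_i'(r, ε)`. -/
def Eφ' (i : Fin n) (r : Param d) : ℝ := ∫ ε, M.φ' i r ε ∂gaussianReal 0 1

/-- `E_{N(ε|0,1)} φ_i''(r, ε)`. -/
def Eφ'' (i : Fin n) (r : Param d) : ℝ := ∫ ε, M.φ'' i r ε ∂gaussianReal 0 1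

/-- The regularizer `(β / n) KL(N(m, V) ‖ N(m₀, S₀))`. -/
def regularizer (r : Param d) : ℝ := M.β / n * gaussianKL (mean r) (cov r) M.m₀ M.S₀

/-- The log-loss objective, scaled by the number of examples:
`h(r) = -(1/n) ∑ᵢ log E_{q(f_i|r)} p(y_i | f_i) + (β / n) KL(N(m, V) ‖ N(m₀, S₀))`. -/
def objective (r : Param d) : ℝ :=
  1 / (n : ℝ) * ∑ i, -Real.log (M.Eφ i r) + M.regularizer r

/-- `φ`, `φ'` and `φ''` are bounded:
`0 ≤ φ_i ≤ B`, `b' ≤ φ_i' ≤ B'` and `b'' ≤ φ_i'' ≤ B''` for all `i`, `r` and `ε`. -/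
def DerivBounds (B b' B' b'' B'' : ℝ) : Prop :=
  ∀ i r ε, (0 ≤ M.φ i r ε ∧ M.φ i r ε ≤ B) ∧ (b' ≤ M.φ' i r ε ∧ M.φ' i r ε ≤ B') ∧
    (b'' ≤ M.φ'' i r ε ∧ M.φ'' i r ε ≤ B'')

/-- The factor `max {B² / |Eφ_i|², (B' - b')² / P², (B'' - b'')² / Q²}` of the sample size, where
`P = |Eφ_i'|` and `Q = |Eφ_i''|`, replaced by `1` when they vanish. -/
def sampleFactor (B b' B' b'' B'' : ℝ) (i : Fin n) (r : Param d) : ℝ :=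
  let P : ℝ := if M.Eφ' i r ≠ 0 then |M.Eφ' i r| else 1
  let Q : ℝ := if M.Eφ'' i r ≠ 0 then |M.Eφ'' i r| else 1
  max (B ^ 2 / |M.Eφ i r| ^ 2) (max ((B' - b') ^ 2 / P ^ 2) ((B'' - b'') ^ 2 / Q ^ 2))

/-! ### The smoothed biased Monte Carlo algorithm -/

/-- The Monte Carlo average `(1/L) ∑_{ℓ < L} ψ(ε_ℓ)`. -/
def avg (L : ℕ) (e : ℕ → ℝ) (ψ : ℝ → ℝ) : ℝ := 1 / (L : ℝ) * ∑ l ∈ Finset.range L, ψ (e l)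

/-- The smoothed estimate `(d_{i,m}, d_{i,V})` of the negative gradient of
`r ↦ -log E_{q(f_i|r)} p(y_i | f_i)` from `L` draws, with smoothing `ν`. -/
def lossDirection (ν : ℝ) (L : ℕ) (e : ℕ → ℝ) (i : Fin n) (r : Param d) : Param d :=
  pack ((avg L e (M.φ' i r) / (avg L e (M.φ i r) + ν)) • M.a₁ i)
    ((avg L e (M.φ'' i r) / (avg L e (M.φ i r) + ν)) •
      ((1 / 2 : ℝ) • Matrix.vecMulVec (M.a₂ i) (M.a₂ i)))

/-- The step direction: the estimates of the loss terms are combined with the exact gradient of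
the regularizer; `e i` are the draws for the `i`-th example. -/
def direction (ν : ℝ) (L : ℕ) (e : Fin n → ℕ → ℝ) (r : Param d) : Param d :=
  (1 / (n : ℝ)) • ∑ i, M.lossDirection ν L (e i) i r - gradient M.regularizer r

/-- `r` is a run of smooth-bMC with step sizes `γ t`, smoothing `ν t`, sample sizes `L t` and draws
`ε t i l` (step `t`, example `i`, `l`-th draw), where `ℱ t` is the history up to step `t`. For each
example the draws are independent standard normal variables, independent of the history; nothing
is asked about the joint law of the draws of different examples (they may be shared, or
independent). The sample size may depend on the history. -/
structure IsSmoothBMC {Ω : Type*} [MeasurableSpace Ω] (P : Measure Ω) (ℱ : Filtration ℕ ‹_›)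
    (γ ν : ℕ → ℝ) (L : ℕ → Ω → ℕ) (ε : ℕ → Fin n → ℕ → Ω → ℝ) (r : ℕ → Ω → Param d) :
    Prop where
  init_measurable : Measurable[ℱ 0] (r 0)
  init_memLp : MemLp (r 0) 2 P
  sampleSize_measurable : ∀ t, Measurable[ℱ t] (L t)
  sampleSize_pos : ∀ t ω, 0 < L t ω
  draw_measurable : ∀ t i l, Measurable[ℱ (t + 1)] (ε t i l)
  draw_law : ∀ t i l, P.map (ε t i l) = gaussianReal 0 1
  draw_indep : ∀ t i, iIndepFun (fun l => ε t i l) P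
  draw_indep_history : ∀ t i,
    Indep (MeasurableSpace.comap (fun ω l => ε t i l ω) inferInstance) (ℱ t) P
  update : ∀ t ω, r (t + 1) ω =
    r t ω + γ t • M.direction (ν t) (L t ω) (fun i l => ε t i l ω) (r t ω)

/-- The parameters at which the `N(m, V)` are uniformly non-degenerate (`V` is symmetric with all
eigenvalues at least `v`) and `E_{q(f_i|r)} p(y_i | f_i) ≥ ζ` for every `i`. -/
def domain (ζ v : ℝ) : Set (Param d) :=
  {r | (cov r - v • (1 : Matrix (Fin d) (Fin d) ℝ)).PosSemidef ∧ ∀ i, ζ ≤ M.Eφ i r}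

end Model

/-! ### The modified stochastic gradient proposition -/

/-- The hypotheses of the modified stochastic gradient proposition, for the function `f` and the
algorithm `r_{t+1} = r_t + γ_t (s_t + w_t)` with history `ℱ`. -/
structure StochasticGradientConditions {E : Type*} [NormedAddCommGroup E] [InnerProductSpace ℝ E]
    [CompleteSpace E] [MeasurableSpace E] {Ω : Type*} [MeasurableSpace Ω] (P : Measure Ω)
    (ℱ : Filtration ℕ ‹_›) (γ : ℕ → ℝ) (f : E → ℝ) (r s w : ℕ → Ω → E) : Prop where
  adapted : ∀ t, Measurable[ℱ t] (r t)
  memLp_s : ∀ t, MemLp (s t) 2 P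
  memLp_w : ∀ t, MemLp (w t) 2 P
  update : ∀ t ω, r (t + 1) ω = r t ω + γ t • (s t ω + w t ω)
  step_nonneg : ∀ t, 0 ≤ γ t
  step_sum : Tendsto (fun T => ∑ t ∈ Finset.range T, γ t) atTop atTop
  step_sq_sum : Summable fun t => γ t ^ 2
  nonneg : ∀ x, 0 ≤ f x
  contDiff : ContDiff ℝ 1 f
  lipschitz : ∃ K : ℝ≥0, LipschitzWith K (gradient f)
  descent : ∃ c₁ c₂ : ℝ, 0 < c₁ ∧ 0 < c₂ ∧ ∀ t,
    (∀ᵐ ω ∂P, c₁ * ‖gradient f (r t ω)‖ ^ 2 ≤ -inner ℝ (gradient f (r t ω)) ((P[s t|ℱ t]) ω)) ∧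
    (∀ᵐ ω ∂P, (P[fun ω' => ‖s t ω'‖ ^ 2|ℱ t]) ω ≤ c₂ * ‖gradient f (r t ω)‖ ^ 2)
  error : ∃ p q : ℝ, 0 < p ∧ 0 < q ∧ ∀ t,
    ∀ᵐ ω ∂P, (P[fun ω' => ‖w t ω'‖ ^ 2|ℱ t]) ω ≤ (γ t * (q + p * ‖gradient f (r t ω)‖)) ^ 2

end SmoothBMC

end

/-! On the domain each `𝔼φᵢ` is a Gaussian expectation, bounded below by `ζ`, of a function with
bounded first and second derivatives. Its derivative in `V` involves only `𝔼φᵢ''`, by Stein's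
identity, so that its gradient is Lipschitz although the standard deviation `√·` is singular at `0`.
Continuing the square root, `-log`, and `-log det` (through its eigenvalues) beyond the domain,
one sees that the objective agrees there, up to a constant, with a nonnegative function `f` on the
whole space with Lipschitz gradient.

The sample size keeps the conditional mean square of the noise of order `γ_t²`. The variance of the
averages contributes this much. The smoothing `ν_t = γ_t ζ` biases the ratios by a relative `γ_t` at
most, and bounds the denominators below on the event that an average of the `φᵢ` falls below half
its mean, whose probability is `O(γ_t⁴)` by Hoeffding's inequality. Hence almost surely the noise is
square summable along the trajectory, and such a gradient descent on `f` has convergent values and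
vanishing gradients.
-/

open MeasureTheory ProbabilityTheory Filter Topology
open scoped Matrix NNReal

noncomputable section

namespace SmoothBMC

/-! ### Functions with Lipschitz gradient -/

section Lipschitz

variable {X F : Type*}

theorem exists_lipschitzWith_of_norm_sub_le [SeminormedAddCommGroup X]
    [SeminormedAddCommGroup F] {g : X → F} {K : ℝ} (h : ∀ x y, ‖g x - g y‖ ≤ K * ‖x - y‖) :
    ∃ K : ℝ≥0, LipschitzWith K g :=
  ⟨_, LipschitzWith.of_dist_le' fun x y => by simpa only [dist_eq_norm] using h x y⟩

theorem exists_lipschitzWith_smul [SeminormedAddCommGroup X] [SeminormedAddCommGroup F]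
    [NormedSpace ℝ F] {f : X → ℝ} {g : X → F} {A B : ℝ} (hf : ∃ K : ℝ≥0, LipschitzWith K f)
    (hg : ∃ K : ℝ≥0, LipschitzWith K g) (hA : ∀ x, |f x| ≤ A) (hB : ∀ x, ‖g x‖ ≤ B) :
    ∃ K : ℝ≥0, LipschitzWith K fun x => f x • g x := by
  obtain ⟨K, hK⟩ := hf
  obtain ⟨J, hJ⟩ := hg
  refine exists_lipschitzWith_of_norm_sub_le (K := A * J + K * B) fun x y => ?_
  have hA0 : 0 ≤ A := (abs_nonneg _).trans (hA x)
  calc ‖f x • g x - f y • g y‖ = ‖f x • (g x - g y) + (f x - f y) • g y‖ := by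
        rw [smul_sub, sub_smul, sub_add_sub_cancel]
    _ ≤ |f x| * ‖g x - g y‖ + |f x - f y| * ‖g y‖ := by
        simpa only [norm_smul, Real.norm_eq_abs] using
          norm_add_le (f x • (g x - g y)) ((f x - f y) • g y)
    _ ≤ A * (J * ‖x - y‖) + K * ‖x - y‖ * B := by
        gcongr
        exacts [hA x, hJ.norm_sub_le x y, hK.norm_sub_le x y, hB y]
    _ = (A * J + K * B) * ‖x - y‖ := by ring

variable [PseudoEMetricSpace X] [SeminormedAddCommGroup F]

theorem exists_lipschitzWith_sum {ι : Type*} (s : Finset ι) {g : ι → X → F}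
    (hg : ∀ i ∈ s, ∃ K : ℝ≥0, LipschitzWith K (g i)) :
    ∃ K : ℝ≥0, LipschitzWith K fun x => ∑ i ∈ s, g i x := by
  classical
  induction s using Finset.induction_on with
  | empty => exact ⟨0, by simpa using LipschitzWith.const (0 : F)⟩
  | insert a s ha ih =>
    obtain ⟨K, hK⟩ := ih fun i hi => hg i (Finset.mem_insert_of_mem hi)
    obtain ⟨J, hJ⟩ := hg a (Finset.mem_insert_self a s)
    exact ⟨J + K, by simpa [Finset.sum_insert ha] using hJ.add hK⟩

theorem exists_lipschitzWith_const_smul [NormedSpace ℝ F] (c : ℝ) {g : X → F}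
    (hg : ∃ K : ℝ≥0, LipschitzWith K g) : ∃ K : ℝ≥0, LipschitzWith K fun x => c • g x :=
  hg.imp' _ fun _ hK => (lipschitzWith_smul c).comp hK

end Lipschitz

section Gradient

variable {E : Type*} [NormedAddCommGroup E] [InnerProductSpace ℝ E] [CompleteSpace E]

theorem hasGradientAt_add {f g : E → ℝ} {u w x : E} (hf : HasGradientAt f u x)
    (hg : HasGradientAt g w x) : HasGradientAt (fun y => f y + g y) (u + w) x := by
  rw [hasGradientAt_iff_hasFDerivAt] at *
  simpa only [map_add] using hf.fun_add hg

theorem hasGradientAt_const_mul {f : E → ℝ} {u x : E} (c : ℝ) (hf : HasGradientAt f u x) :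
    HasGradientAt (fun y => c * f y) (c • u) x := by
  rw [hasGradientAt_iff_hasFDerivAt] at *
  simpa only [map_smul] using hf.const_mul c

theorem hasGradientAt_sum {ι : Type*} (s : Finset ι) {f : ι → E → ℝ} {u : ι → E} {x : E}
    (hf : ∀ i ∈ s, HasGradientAt (f i) (u i) x) :
    HasGradientAt (fun y => ∑ i ∈ s, f i y) (∑ i ∈ s, u i) x := by
  simp only [hasGradientAt_iff_hasFDerivAt, map_sum] at *
  exact HasFDerivAt.fun_sum hf

theorem hasGradientAt_comp {φ : ℝ → ℝ} {f : E → ℝ} {c : ℝ} {u x : E} (hφ : HasDerivAt φ c (f x))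
    (hf : HasGradientAt f u x) : HasGradientAt (fun y => φ (f y)) (c • u) x := by
  rw [hasGradientAt_iff_hasFDerivAt] at *
  simpa only [map_smul, Function.comp_def] using hφ.comp_hasFDerivAt x hf

theorem hasGradientAt_inner_add_const (u : E) (c : ℝ) (x : E) :
    HasGradientAt (fun y => inner ℝ u y + c) u x :=
  hasGradientAt_iff_hasFDerivAt.2 ((InnerProductSpace.toDual ℝ E u).hasFDerivAt.add_const c)

theorem measurable_gradient [MeasurableSpace E] [BorelSpace E] (f : E → ℝ) :
    Measurable (gradient f) :=
  (InnerProductSpace.toDual ℝ E).symm.continuous.measurable.comp (measurable_fderiv ℝ f)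

/-- `f` is differentiable with the Lipschitz gradient `G`; the Lipschitz constant is left
existential because only its existence matters. -/
structure HasLipschitzGradient (f : E → ℝ) (G : E → E) : Prop where
  hasGradientAt : ∀ x, HasGradientAt f (G x) x
  lipschitz : ∃ K : ℝ≥0, LipschitzWith K G

namespace HasLipschitzGradient

variable {f g : E → ℝ} {F G : E → E}

theorem add (hf : HasLipschitzGradient f F) (hg : HasLipschitzGradient g G) :
    HasLipschitzGradient (fun x => f x + g x) fun x => F x + G x where
  hasGradientAt x := hasGradientAt_add (hf.hasGradientAt x) (hg.hasGradientAt x)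
  lipschitz := by
    obtain ⟨⟨K, hK⟩, J, hJ⟩ := And.intro hf.lipschitz hg.lipschitz
    exact ⟨K + J, hK.add hJ⟩

theorem const (c : ℝ) : HasLipschitzGradient (fun _ : E => c) fun _ => 0 :=
  ⟨fun x => hasGradientAt_const x c, 0, LipschitzWith.const 0⟩

theorem sub_const (hf : HasLipschitzGradient f F) (c : ℝ) :
    HasLipschitzGradient (fun x => f x - c) F :=
  ⟨fun x => hasGradientAt_iff_hasFDerivAt.2 ((hf.hasGradientAt x).hasFDerivAt.sub_const c),
    hf.lipschitz⟩

theorem const_mul (c : ℝ) (hf : HasLipschitzGradient f F) :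
    HasLipschitzGradient (fun x => c * f x) fun x => c • F x :=
  ⟨fun x => hasGradientAt_const_mul c (hf.hasGradientAt x),
    exists_lipschitzWith_const_smul c hf.lipschitz⟩

theorem sum {ι : Type*} (s : Finset ι) {f : ι → E → ℝ} {F : ι → E → E}
    (hf : ∀ i ∈ s, HasLipschitzGradient (f i) (F i)) :
    HasLipschitzGradient (fun x => ∑ i ∈ s, f i x) fun x => ∑ i ∈ s, F i x :=
  ⟨fun x => hasGradientAt_sum s fun i hi => (hf i hi).hasGradientAt x,
    exists_lipschitzWith_sum s fun i hi => (hf i hi).lipschitz⟩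

theorem of_subgradient {K : ℝ} (hsub : ∀ x y, f x + inner ℝ (F x) (y - x) ≤ f y)
    (hF : ∀ x y, ‖F x - F y‖ ≤ K * ‖x - y‖) : HasLipschitzGradient f F := by
  refine ⟨fun x => ?_, exists_lipschitzWith_of_norm_sub_le hF⟩
  rw [hasGradientAt_iff_isLittleO]
  have remainder_le : ∀ y, ‖f y - f x - inner ℝ (F x) (y - x)‖ ≤ K * ‖‖y - x‖ ^ 2‖ := fun y => by
    have lower := hsub x y
    have upper := hsub y x
    have cauchy_schwarz : inner ℝ (F y - F x) (y - x) ≤ K * ‖y - x‖ * ‖y - x‖ :=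
      (real_inner_le_norm _ _).trans (mul_le_mul_of_nonneg_right (hF y x) (norm_nonneg _))
    rw [← neg_sub y x, inner_neg_right] at upper
    rw [inner_sub_left] at cauchy_schwarz
    rw [Real.norm_of_nonneg (by linarith), Real.norm_of_nonneg (by positivity)]
    linarith
  have remainder_isBigO := Asymptotics.IsBigO.of_bound (l := 𝓝 x) K (.of_forall remainder_le)
  exact remainder_isBigO.trans_isLittleO (Asymptotics.isLittleO_pow_sub_sub x one_lt_two)

theorem continuous_gradient (hf : HasLipschitzGradient f F) : Continuous F :=
  hf.lipschitz.choose_spec.continuous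

theorem contDiff (hf : HasLipschitzGradient f F) : ContDiff ℝ 1 f := by
  refine contDiff_one_iff_fderiv.2 ⟨fun x => (hf.hasGradientAt x).differentiableAt, ?_⟩
  rw [funext fun x => (hf.hasGradientAt x).hasFDerivAt.fderiv]
  exact (InnerProductSpace.toDual ℝ E).continuous.comp hf.continuous_gradient

theorem gradient_eq (hf : HasLipschitzGradient f F) : gradient f = F :=
  _root_.gradient_eq hf.hasGradientAt

theorem lipschitz_of_bounded (hf : HasLipschitzGradient f F) {A : ℝ} (hA : ∀ x, ‖F x‖ ≤ A) :
    ∃ K : ℝ≥0, LipschitzWith K f := by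
  refine ⟨A.toNNReal, lipschitzWith_of_nnnorm_fderiv_le (𝕜 := ℝ)
    (fun x => (hf.hasGradientAt x).differentiableAt) fun x => ?_⟩
  rw [(hf.hasGradientAt x).hasFDerivAt.fderiv, ← NNReal.coe_le_coe, coe_nnnorm,
    LinearIsometryEquiv.norm_map]
  exact (hA x).trans (Real.le_coe_toNNReal A)

theorem comp {φ φ' : ℝ → ℝ} {A B : ℝ} (hφ : ∀ x, HasDerivAt φ (φ' x) x)
    (hφ' : ∃ K : ℝ≥0, LipschitzWith K φ') (hB : ∀ x, |φ' x| ≤ B)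
    (hf : HasLipschitzGradient f F) (hA : ∀ x, ‖F x‖ ≤ A) :
    HasLipschitzGradient (fun x => φ (f x)) fun x => φ' (f x) • F x := by
  refine ⟨fun x => hasGradientAt_comp (hφ _) (hf.hasGradientAt x), ?_⟩
  obtain ⟨K, hK⟩ := hf.lipschitz_of_bounded hA
  obtain ⟨J, hJ⟩ := hφ'
  exact exists_lipschitzWith_smul ⟨_, hJ.comp hK⟩ hf.lipschitz (fun x => hB _) hA

end HasLipschitzGradient

/-- `Φ` extends `f` from `s` to the whole space with Lipschitz gradient `D`, agreeing with `f` to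
first order on `s`. As `s` need not be open, agreement of the gradients does not follow from
agreement of the values. -/
structure IsLipschitzGradientExtension (f : E → ℝ) (s : Set E) (Φ : E → ℝ) (D : E → E) : Prop where
  hasLipschitzGradient : HasLipschitzGradient Φ D
  eqOn : Set.EqOn Φ f s
  hasGradientAt : ∀ x ∈ s, HasGradientAt f (D x) x

theorem HasLipschitzGradient.isLipschitzGradientExtension {f : E → ℝ} {F : E → E}
    (hf : HasLipschitzGradient f F) (s : Set E) : IsLipschitzGradientExtension f s f F :=
  ⟨hf, Set.eqOn_refl f s, fun x _ => hf.hasGradientAt x⟩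

namespace IsLipschitzGradientExtension

variable {f g Φ Γ : E → ℝ} {D G : E → E} {s t : Set E}

theorem mono (h : IsLipschitzGradientExtension f s Φ D) (hts : t ⊆ s) :
    IsLipschitzGradientExtension f t Φ D :=
  ⟨h.hasLipschitzGradient, h.eqOn.mono hts, fun x hx => h.hasGradientAt x (hts hx)⟩

theorem add (hf : IsLipschitzGradientExtension f s Φ D)
    (hg : IsLipschitzGradientExtension g s Γ G) :
    IsLipschitzGradientExtension (fun x => f x + g x) s (fun x => Φ x + Γ x)
      fun x => D x + G x where
  hasLipschitzGradient := hf.hasLipschitzGradient.add hg.hasLipschitzGradient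
  eqOn _ hx := congrArg₂ (· + ·) (hf.eqOn hx) (hg.eqOn hx)
  hasGradientAt x hx := hasGradientAt_add (hf.hasGradientAt x hx) (hg.hasGradientAt x hx)

theorem const_mul (c : ℝ) (hf : IsLipschitzGradientExtension f s Φ D) :
    IsLipschitzGradientExtension (fun x => c * f x) s (fun x => c * Φ x) fun x => c • D x where
  hasLipschitzGradient := hf.hasLipschitzGradient.const_mul c
  eqOn _ hx := congrArg (c * ·) (hf.eqOn hx)
  hasGradientAt x hx := hasGradientAt_const_mul c (hf.hasGradientAt x hx)

theorem sum {ι : Type*} (u : Finset ι) {f Φ : ι → E → ℝ} {D : ι → E → E}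
    (hf : ∀ i ∈ u, IsLipschitzGradientExtension (f i) s (Φ i) (D i)) :
    IsLipschitzGradientExtension (fun x => ∑ i ∈ u, f i x) s (fun x => ∑ i ∈ u, Φ i x)
      fun x => ∑ i ∈ u, D i x where
  hasLipschitzGradient := .sum u fun i hi => (hf i hi).hasLipschitzGradient
  eqOn _ hx := Finset.sum_congr rfl fun i hi => (hf i hi).eqOn hx
  hasGradientAt x hx := hasGradientAt_sum u fun i hi => (hf i hi).hasGradientAt x hx

theorem comp {φ ψ ψ' : ℝ → ℝ} {S : Set ℝ} {A B : ℝ} (hψ : ∀ x, HasDerivAt ψ (ψ' x) x)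
    (hψ' : ∃ K : ℝ≥0, LipschitzWith K ψ') (hB : ∀ x, |ψ' x| ≤ B) (hψφ : Set.EqOn ψ φ S)
    (hφ : ∀ x ∈ S, HasDerivAt φ (ψ' x) x) (hf : IsLipschitzGradientExtension f s Φ D)
    (hA : ∀ x, ‖D x‖ ≤ A) (hS : Set.MapsTo f s S) :
    IsLipschitzGradientExtension (fun x => φ (f x)) s (fun x => ψ (Φ x))
      fun x => ψ' (Φ x) • D x where
  hasLipschitzGradient := .comp hψ hψ' hB hf.hasLipschitzGradient hA
  eqOn _ hx := (congrArg ψ (hf.eqOn hx)).trans (hψφ (hS hx))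
  hasGradientAt x hx :=
    hasGradientAt_comp (hf.eqOn hx ▸ hφ (f x) (hS hx)) (hf.hasGradientAt x hx)

end IsLipschitzGradientExtension

theorem le_add_inner_add_mul_norm_sq {f : E → ℝ} {F : E → E} (hf : ∀ x, HasGradientAt f (F x) x)
    {K : ℝ≥0} (hK : LipschitzWith K F) (x y : E) :
    f y ≤ f x + inner ℝ (F x) (y - x) + K * ‖y - x‖ ^ 2 := by
  have gradient_close : ∀ z ∈ segment ℝ x y, ‖InnerProductSpace.toDual ℝ E (F z) -
      InnerProductSpace.toDual ℝ E (F x)‖ ≤ K * ‖y - x‖ := fun z hz => by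
    rw [← map_sub, LinearIsometryEquiv.norm_map]
    exact (hK.norm_sub_le z x).trans
      (mul_le_mul_of_nonneg_left (norm_sub_le_of_mem_segment hz) K.2)
  have h := (convex_segment (𝕜 := ℝ) x y).norm_image_sub_le_of_norm_hasFDerivWithin_le'
    (fun z _ => (hf z).hasFDerivAt.hasFDerivWithinAt) gradient_close
    (left_mem_segment ℝ x y) (right_mem_segment ℝ x y)
  rw [InnerProductSpace.toDual_apply_apply] at h
  linarith [le_of_abs_le h]

end Gradient

/-! ### Extension of functions on a half-line -/

theorem add_mul_sub_le_of_monotone_deriv {f f' : ℝ → ℝ} (hf : ∀ x, HasDerivAt f (f' x) x)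
    (hf' : Monotone f') (x y : ℝ) : f x + f' x * (y - x) ≤ f y := by
  have hconv : ConvexOn ℝ Set.univ f :=
    Monotone.convexOn_univ_of_deriv (fun x => (hf x).differentiableAt)
      (by rwa [funext fun x => (hf x).deriv])
  rcases lt_trichotomy x y with hxy | rfl | hyx
  · have := hconv.le_slope_of_hasDerivAt trivial trivial hxy (hf x)
    rw [slope_def_field, le_div_iff₀ (sub_pos.2 hxy)] at this
    linarith
  · simp
  · have := hconv.slope_le_of_hasDerivAt trivial trivial hyx (hf x)
    rw [slope_def_field, div_le_iff₀ (sub_pos.2 hyx)] at this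
    linarith

theorem exists_lipschitzOnWith_of_abs_deriv_le {s : Set ℝ} (hs : Convex ℝ s) {f f' : ℝ → ℝ}
    {A : ℝ} (hf : ∀ x ∈ s, HasDerivAt f (f' x) x) (hA : ∀ x ∈ s, |f' x| ≤ A) :
    ∃ K : ℝ≥0, LipschitzOnWith K f s :=
  ⟨A.toNNReal, hs.lipschitzOnWith_of_nnnorm_hasDerivWithin_le
    (fun x hx => (hf x hx).hasDerivWithinAt) fun x hx => by
      rw [← NNReal.coe_le_coe, coe_nnnorm, Real.norm_eq_abs]
      exact (hA x hx).trans (Real.le_coe_toNNReal A)⟩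

/-- The function `φ` on `[a, ∞)`, continued to the left of `a` by the quadratic polynomial with
value `φ a`, slope `c` and second derivative `κ` at `a`. -/
def quadraticExtension (a c κ : ℝ) (φ : ℝ → ℝ) (x : ℝ) : ℝ :=
  if a ≤ x then φ x else φ a + c * (x - a) + κ / 2 * (x - a) ^ 2

section QuadraticExtension

variable {a κ : ℝ} {φ φ' : ℝ → ℝ}

theorem quadraticExtension_of_le {x : ℝ} (c κ : ℝ) (φ : ℝ → ℝ) (h : a ≤ x) :
    quadraticExtension a c κ φ x = φ x := if_pos h

theorem quadraticExtension_of_ge {x : ℝ} (c κ : ℝ) (φ : ℝ → ℝ) (h : x ≤ a) :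
    quadraticExtension a c κ φ x = φ a + c * (x - a) + κ / 2 * (x - a) ^ 2 := by
  rcases h.lt_or_eq with h | rfl
  · exact if_neg h.not_ge
  · simp [quadraticExtension]

theorem hasDerivAt_quadraticExtension (κ : ℝ) (hφ : ∀ x, a ≤ x → HasDerivAt φ (φ' x) x) (x : ℝ) :
    HasDerivAt (quadraticExtension a (φ' a) κ φ) (φ' (max x a) + κ * min (x - a) 0) x := by
  have right : ∀ y, a ≤ y →
      HasDerivWithinAt (quadraticExtension a (φ' a) κ φ) (φ' y) (Set.Ici a) y := fun y hy =>
    (hφ y hy).hasDerivWithinAt.congr (fun z hz => quadraticExtension_of_le _ _ _ hz)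
      (quadraticExtension_of_le _ _ _ hy)
  have left : ∀ y, y ≤ a → HasDerivWithinAt (quadraticExtension a (φ' a) κ φ)
      (φ' a + κ * (y - a)) (Set.Iic a) y := fun y hy => by
    have hd := (hasDerivAt_id y).sub_const a
    have hpoly := ((hd.const_mul (φ' a)).const_add (φ a)).add ((hd.pow 2).const_mul (κ / 2))
    refine (hpoly.congr_deriv ?_).hasDerivWithinAt.congr
      (fun z hz => quadraticExtension_of_ge _ _ _ hz) (quadraticExtension_of_ge _ _ _ hy)
    simp only [id_eq]
    ring
  rcases lt_trichotomy x a with h | rfl | h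
  · rw [max_eq_right h.le, min_eq_left (sub_nonpos.2 h.le)]
    exact (left x h.le).hasDerivAt (Iic_mem_nhds h)
  · have := (left x le_rfl).union (by simpa using right x le_rfl)
    simpa [Set.Iic_union_Ici] using this
  · rw [max_eq_left h.le, min_eq_right (sub_nonneg.2 h.le), mul_zero, add_zero]
    exact (right x h.le).hasDerivAt (Ici_mem_nhds h)

theorem exists_lipschitzWith_quadraticExtension_deriv (κ : ℝ)
    (hφ' : ∃ K : ℝ≥0, LipschitzOnWith K φ' (Set.Ici a)) :
    ∃ K : ℝ≥0, LipschitzWith K fun x => φ' (max x a) + κ * min (x - a) 0 := by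
  obtain ⟨K, hK⟩ := hφ'
  have hmax : LipschitzWith 1 fun x : ℝ => max x a := LipschitzWith.id.max_const a
  have hmin : LipschitzWith 1 fun x : ℝ => min (x - a) 0 := by
    simpa using (LipschitzWith.id.sub (LipschitzWith.const a)).min_const 0
  have hcomp := hK.comp hmax.lipschitzOnWith (s := Set.univ) fun x _ => le_max_right x a
  obtain ⟨J, hJ⟩ := exists_lipschitzWith_const_smul κ ⟨1, hmin⟩
  exact ⟨_, (lipschitzOnWith_univ.1 hcomp).add hJ⟩

theorem monotone_quadraticExtension_deriv (hκ : 0 ≤ κ) (hφ' : MonotoneOn φ' (Set.Ici a)) :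
    Monotone fun x => φ' (max x a) + κ * min (x - a) 0 := fun x y hxy =>
  add_le_add (hφ' (le_max_right x a) (le_max_right y a) (max_le_max_right a hxy)) (by gcongr)

end QuadraticExtension

/-- The function `-log` on `[a, ∞)`, continued by a quadratic polynomial of second derivative `κ`.
The linear continuation `κ = 0` has a bounded derivative, a positive `κ` gives coercivity. -/
def negLogExtension (a κ : ℝ) : ℝ → ℝ := quadraticExtension a (-a⁻¹) κ fun x => -Real.log x

section NegLogExtension

variable {a : ℝ}

theorem negLogExtension_of_le {x : ℝ} (κ : ℝ) (h : a ≤ x) :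
    negLogExtension a κ x = -Real.log x :=
  quadraticExtension_of_le _ _ _ h

theorem hasDerivAt_negLogExtension (ha : 0 < a) (κ x : ℝ) :
    HasDerivAt (negLogExtension a κ) (-(max x a)⁻¹ + κ * min (x - a) 0) x :=
  hasDerivAt_quadraticExtension (φ' := fun x => -x⁻¹) κ
    (fun _ hx => (Real.hasDerivAt_log (ha.trans_le hx).ne').neg) x

theorem exists_lipschitzWith_negLogExtension_deriv (ha : 0 < a) (κ : ℝ) :
    ∃ K : ℝ≥0, LipschitzWith K fun x => -(max x a)⁻¹ + κ * min (x - a) 0 := by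
  refine exists_lipschitzWith_quadraticExtension_deriv (φ' := fun x => -x⁻¹) κ
    (exists_lipschitzOnWith_of_abs_deriv_le (A := (a ^ 2)⁻¹) (convex_Ici a)
      (fun x hx => (hasDerivAt_inv (ha.trans_le hx).ne').neg) fun x hx => ?_)
  have hx : a ≤ x := hx
  rw [neg_neg, abs_of_nonneg (by positivity)]
  gcongr

theorem abs_negLogExtension_zero_deriv_le (ha : 0 < a) (x : ℝ) :
    |-(max x a)⁻¹ + 0 * min (x - a) 0| ≤ a⁻¹ := by
  have := le_max_right x a
  rw [zero_mul, add_zero, abs_neg, abs_of_nonneg (inv_nonneg.2 (ha.le.trans this))]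
  gcongr

theorem antitone_negLogExtension {κ : ℝ} (ha : 0 < a) (hκ : 0 ≤ κ) :
    Antitone (negLogExtension a κ) := by
  refine antitone_of_deriv_nonpos
    (fun x => (hasDerivAt_negLogExtension ha κ x).differentiableAt) fun x => ?_
  rw [(hasDerivAt_negLogExtension ha κ x).deriv]
  have hinv : 0 ≤ (max x a)⁻¹ := inv_nonneg.2 (ha.le.trans (le_max_right x a))
  have hmin := mul_nonpos_of_nonneg_of_nonpos hκ (min_le_right (x - a) 0)
  linarith

theorem negLogExtension_tangent_le {κ : ℝ} (ha : 0 < a) (hκ : 0 ≤ κ) (x y : ℝ) :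
    negLogExtension a κ x + (-(max x a)⁻¹ + κ * min (x - a) 0) * (y - x) ≤
      negLogExtension a κ y :=
  add_mul_sub_le_of_monotone_deriv (hasDerivAt_negLogExtension ha κ)
    (monotone_quadraticExtension_deriv (φ' := fun x => -x⁻¹) hκ fun _ hx _ _ hxy =>
      neg_le_neg (inv_anti₀ (ha.trans_le hx) hxy)) x y

/-- Coercivity: the slope `-s` is attained, and the tangent there is a lower bound. -/
theorem exists_le_mul_add_negLogExtension {κ s : ℝ} (ha : 0 < a) (hκ : 0 < κ) (hs : 0 < s) :
    ∃ c, ∀ x, c ≤ s * x + negLogExtension a κ x := by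
  obtain ⟨z, hz⟩ : ∃ z, -(max z a)⁻¹ + κ * min (z - a) 0 = -s := by
    rcases le_total s a⁻¹ with h | h
    · have h' : a ≤ s⁻¹ := by rwa [le_inv_comm₀ ha hs]
      exact ⟨s⁻¹, by simp [h']⟩
    · have h' : -((s - a⁻¹) / κ) ≤ 0 := neg_nonpos.2 (by have := sub_nonneg.2 h; positivity)
      refine ⟨a + -((s - a⁻¹) / κ), ?_⟩
      rw [add_sub_cancel_left, max_eq_right (by linarith), min_eq_left h']
      field_simp
      ring
  refine ⟨s * z + negLogExtension a κ z, fun x => ?_⟩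
  have := negLogExtension_tangent_le ha hκ.le z x
  rw [hz] at this
  linarith

end NegLogExtension

/-- The square root on `[a, ∞)`, continued by its tangent. -/
def sqrtExtension (a : ℝ) : ℝ → ℝ := quadraticExtension a (1 / (2 * √a)) 0 Real.sqrt

section SqrtExtension

variable {a : ℝ}

theorem sqrtExtension_of_le {x : ℝ} (h : a ≤ x) : sqrtExtension a x = √x :=
  quadraticExtension_of_le _ _ _ h

theorem hasDerivAt_sqrtExtension (ha : 0 < a) (x : ℝ) :
    HasDerivAt (sqrtExtension a) (1 / (2 * √(max x a))) x := by
  have h := hasDerivAt_quadraticExtension (φ := Real.sqrt) (φ' := fun x => 1 / (2 * √x)) 0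
    (fun _ hx => Real.hasDerivAt_sqrt (ha.trans_le hx).ne') x
  rwa [zero_mul, add_zero] at h

theorem exists_lipschitzWith_sqrtExtension_deriv (ha : 0 < a) :
    ∃ K : ℝ≥0, LipschitzWith K fun x => 1 / (2 * √(max x a)) := by
  have hLip : ∃ K : ℝ≥0, LipschitzOnWith K (fun x => 1 / (2 * √x)) (Set.Ici a) := by
    refine exists_lipschitzOnWith_of_abs_deriv_le (f' := fun x => -(1 / √x) / (2 * √x) ^ 2)
      (A := 1 / √a / (2 * √a) ^ 2) (convex_Ici a) (fun x hx => ?_) fun x hx => ?_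
    · have hx0 : 0 < x := ha.trans_le hx
      have h := ((Real.hasDerivAt_sqrt hx0.ne').const_mul 2).inv (by positivity)
      simp only [one_div]
      exact h.congr_deriv (by field_simp)
    · have hxa : √a ≤ √x := Real.sqrt_le_sqrt hx
      have : 0 < √a := Real.sqrt_pos.2 ha
      rw [neg_div, abs_neg, abs_of_nonneg (by positivity)]
      gcongr
  simpa only [zero_mul, add_zero] using exists_lipschitzWith_quadraticExtension_deriv 0 hLip

theorem abs_sqrtExtension_deriv_le (ha : 0 < a) (x : ℝ) :
    |1 / (2 * √(max x a))| ≤ 1 / (2 * √a) := by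
  have : 0 < √a := Real.sqrt_pos.2 ha
  have hx : √a ≤ √(max x a) := Real.sqrt_le_sqrt (le_max_right x a)
  rw [abs_of_nonneg (by positivity)]
  gcongr

end SqrtExtension


/-! ### Expectations of smooth functions of a random affine form -/

theorem exists_lipschitzWith_integral {α X F : Type*} [MeasurableSpace α] {μ : Measure α}
    [SeminormedAddCommGroup X] [NormedAddCommGroup F] [NormedSpace ℝ F] {k : X → α → F}
    (hk : ∀ x, Integrable (k x) μ) {c : α → ℝ} (hc : Integrable c μ)
    (h : ∀ x y a, ‖k x a - k y a‖ ≤ c a * ‖x - y‖) :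
    ∃ K : ℝ≥0, LipschitzWith K fun x => ∫ a, k x a ∂μ := by
  refine exists_lipschitzWith_of_norm_sub_le (K := ∫ a, c a ∂μ) fun x y => ?_
  rw [← integral_sub (hk x) (hk y), ← integral_mul_const]
  exact norm_integral_le_of_norm_le (hc.mul_const _) (ae_of_all _ (h x y))

theorem integrable_of_abs_le {α : Type*} [MeasurableSpace α] {μ : Measure α} [IsFiniteMeasure μ]
    {f : α → ℝ} (hf : Measurable f) {A : ℝ} (hA : ∀ x, |f x| ≤ A) : Integrable f μ :=
  Integrable.of_bound hf.aestronglyMeasurable A (ae_of_all _ hA)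

theorem abs_integral_le_of_abs_le {α : Type*} [MeasurableSpace α] {μ : Measure α}
    [IsProbabilityMeasure μ] {f : α → ℝ} {A : ℝ} (h : ∀ x, |f x| ≤ A) : |∫ x, f x ∂μ| ≤ A := by
  simpa using norm_integral_le_of_norm_le_const (μ := μ) (f := f) (ae_of_all _ h)

theorem integral_le_of_nonneg_of_le {α : Type*} [MeasurableSpace α] {μ : Measure α}
    [IsProbabilityMeasure μ] {f : α → ℝ} {A : ℝ} (h₀ : ∀ x, 0 ≤ f x) (h : ∀ x, f x ≤ A) :
    ∫ x, f x ∂μ ≤ A := by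
  simpa using integral_mono_of_nonneg (μ := μ) (ae_of_all _ h₀) (integrable_const A) (ae_of_all _ h)

theorem abs_sub_le_of_abs_deriv_le {w : ℝ → ℝ} {A : ℝ} (hw : Differentiable ℝ w)
    (h : ∀ x, |deriv w x| ≤ A) (x y : ℝ) : |w x - w y| ≤ A * |x - y| :=
  Convex.norm_image_sub_le_of_norm_deriv_le (fun z _ => hw z) (fun z _ => h z) convex_univ
    trivial trivial

section FirstMoment

variable {μ : Measure ℝ}

theorem integrable_mul_id_of_abs_le (hμ : Integrable (fun x => x) μ) {f : ℝ → ℝ}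
    (hf : Measurable f) {A : ℝ} (hA : ∀ x, |f x| ≤ A) : Integrable (fun x => f x * x) μ :=
  hμ.bdd_mul hf.aestronglyMeasurable (ae_of_all _ hA)

theorem abs_integral_mul_id_le (hμ : Integrable (fun x => x) μ) {f : ℝ → ℝ} {A : ℝ}
    (h : ∀ x, |f x| ≤ A) : |∫ x, f x * x ∂μ| ≤ A * ∫ x, |x| ∂μ := by
  rw [← integral_const_mul, ← Real.norm_eq_abs]
  refine norm_integral_le_of_norm_le (hμ.abs.const_mul A) (ae_of_all _ fun x => ?_)
  rw [norm_mul]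
  exact mul_le_mul_of_nonneg_right (h x) (norm_nonneg x)

variable {u : ℝ → ℝ} {A₀ A₁ : ℝ}

theorem integrable_deriv_affine [IsFiniteMeasure μ] (h₁ : ∀ x, |deriv u x| ≤ A₁) (σ m : ℝ) :
    Integrable (fun ε => deriv u (σ * ε + m)) μ :=
  have := measurable_deriv u
  integrable_of_abs_le (by fun_prop) fun _ => h₁ _

theorem integrable_deriv_affine_mul_id (hμ : Integrable (fun x => x) μ)
    (h₁ : ∀ x, |deriv u x| ≤ A₁) (σ m : ℝ) :
    Integrable (fun ε => deriv u (σ * ε + m) * ε) μ :=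
  have := measurable_deriv u
  integrable_mul_id_of_abs_le (f := fun ε => deriv u (σ * ε + m)) hμ (by fun_prop) fun _ => h₁ _

theorem hasFDerivAt_comp_affine (hu : Differentiable ℝ u) (ε : ℝ) (p : ℝ × ℝ) :
    HasFDerivAt (fun q : ℝ × ℝ => u (q.2 * ε + q.1))
      (deriv u (p.2 * ε + p.1) • ContinuousLinearMap.fst ℝ ℝ ℝ +
        (deriv u (p.2 * ε + p.1) * ε) • ContinuousLinearMap.snd ℝ ℝ ℝ) p := by
  have affine : HasFDerivAt (fun q : ℝ × ℝ => q.2 * ε + q.1)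
      (ε • ContinuousLinearMap.snd ℝ ℝ ℝ + ContinuousLinearMap.fst ℝ ℝ ℝ) p :=
    (hasFDerivAt_snd.mul_const ε).add hasFDerivAt_fst
  convert! (hu (p.2 * ε + p.1)).hasDerivAt.comp_hasFDerivAt p affine using 1
  rw [smul_add, smul_smul, add_comm]

theorem norm_smul_fst_add_smul_snd_le (c ε : ℝ) :
    ‖c • ContinuousLinearMap.fst ℝ ℝ ℝ + (c * ε) • ContinuousLinearMap.snd ℝ ℝ ℝ‖ ≤
      |c| * (1 + |ε|) := by
  have hfst := ContinuousLinearMap.norm_fst_le ℝ ℝ ℝ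
  have hsnd := ContinuousLinearMap.norm_snd_le ℝ ℝ ℝ
  refine (norm_add_le _ _).trans ?_
  rw [norm_smul, norm_smul, Real.norm_eq_abs, Real.norm_eq_abs, abs_mul]
  calc _ ≤ |c| * 1 + |c| * |ε| * 1 := by gcongr
    _ = |c| * (1 + |ε|) := by ring

theorem hasFDerivAt_integral_affine [IsFiniteMeasure μ] (hμ : Integrable (fun x => x) μ)
    (hu : Differentiable ℝ u) (h₀ : ∀ x, |u x| ≤ A₀) (h₁ : ∀ x, |deriv u x| ≤ A₁) (p : ℝ × ℝ) :
    HasFDerivAt (fun p : ℝ × ℝ => ∫ ε, u (p.2 * ε + p.1) ∂μ)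
      ((∫ ε, deriv u (p.2 * ε + p.1) ∂μ) • ContinuousLinearMap.fst ℝ ℝ ℝ +
        (∫ ε, deriv u (p.2 * ε + p.1) * ε ∂μ) • ContinuousLinearMap.snd ℝ ℝ ℝ) p := by
  have := hu.continuous.measurable
  have i₁ := integrable_deriv_affine (μ := μ) h₁ p.2 p.1
  have i₂ := integrable_deriv_affine_mul_id hμ h₁ p.2 p.1
  have h := hasFDerivAt_integral_of_dominated_of_fderiv_le (𝕜 := ℝ)
    (F := fun (p : ℝ × ℝ) ε => u (p.2 * ε + p.1)) (x₀ := p)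
    (bound := fun ε => A₁ * (1 + |ε|)) univ_mem
    (.of_forall fun q => (by fun_prop : Measurable fun ε => u (q.2 * ε + q.1)).aestronglyMeasurable)
    (integrable_of_abs_le (by fun_prop) fun _ => h₀ _)
    ((i₁.aestronglyMeasurable.smul_const _).add (i₂.aestronglyMeasurable.smul_const _))
    (ae_of_all _ fun ε _ _ => (norm_smul_fst_add_smul_snd_le _ ε).trans
      (mul_le_mul_of_nonneg_right (h₁ _) (by positivity)))
    (((integrable_const 1).add hμ.abs).const_mul A₁)
    (ae_of_all _ fun ε q _ => hasFDerivAt_comp_affine hu ε q)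
  convert! h using 1
  rw [integral_add (i₁.smul_const _) (i₂.smul_const _), integral_smul_const, integral_smul_const]

variable {E : Type*} [NormedAddCommGroup E] [InnerProductSpace ℝ E] [CompleteSpace E]

theorem hasGradientAt_integral_affine [IsFiniteMeasure μ] (hμ : Integrable (fun x => x) μ)
    (hu : Differentiable ℝ u) (h₀ : ∀ x, |u x| ≤ A₀) (h₁ : ∀ x, |deriv u x| ≤ A₁)
    {m σ : E → ℝ} {a b x : E} (hm : HasGradientAt m a x) (hσ : HasGradientAt σ b x) :
    HasGradientAt (fun y => ∫ ε, u (σ y * ε + m y) ∂μ)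
      ((∫ ε, deriv u (σ x * ε + m x) ∂μ) • a + (∫ ε, deriv u (σ x * ε + m x) * ε ∂μ) • b) x := by
  rw [hasGradientAt_iff_hasFDerivAt] at *
  have h := (hasFDerivAt_integral_affine hμ hu h₀ h₁ (m x, σ x)).comp x (hm.prodMk hσ)
  rw [map_add, map_smulₛₗ, map_smulₛₗ]
  convert! h using 1

theorem norm_gradient_integral_affine_le {F : Type*} [SeminormedAddCommGroup F] [NormedSpace ℝ F]
    [IsProbabilityMeasure μ] (hμ : Integrable (fun x => x) μ) (h₁ : ∀ x, |deriv u x| ≤ A₁) (s c : ℝ)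
    {a b : F} {A B : ℝ} (hA : ‖a‖ ≤ A) (hB : ‖b‖ ≤ B) :
    ‖(∫ ε, deriv u (s * ε + c) ∂μ) • a + (∫ ε, deriv u (s * ε + c) * ε ∂μ) • b‖ ≤
      A₁ * A + A₁ * (∫ x, |x| ∂μ) * B := by
  have hA₁ : 0 ≤ A₁ := (abs_nonneg _).trans (h₁ 0)
  have : 0 ≤ ∫ x, |x| ∂μ := integral_nonneg fun x => abs_nonneg x
  refine (norm_add_le _ _).trans ?_
  rw [norm_smul, norm_smul]
  exact add_le_add
    (mul_le_mul (abs_integral_le_of_abs_le fun _ => h₁ _) hA (norm_nonneg _) hA₁)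
    (mul_le_mul (abs_integral_mul_id_le hμ fun _ => h₁ _) hB (norm_nonneg _) (by positivity))

end FirstMoment

section SecondMoment

variable {E : Type*} [NormedAddCommGroup E] [InnerProductSpace ℝ E] [CompleteSpace E]
  {μ : Measure ℝ} [IsProbabilityMeasure μ] {u : ℝ → ℝ} {A₀ A₁ A₂ : ℝ}

theorem exists_abs_deriv_affine_sub_le {X : Type*} [SeminormedAddCommGroup X] {u : ℝ → ℝ} {A₂ : ℝ}
    (hu' : Differentiable ℝ (deriv u))
    (h₂ : ∀ x, |deriv (deriv u) x| ≤ A₂) {m σ : X → ℝ}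
    (hm : ∃ K : ℝ≥0, LipschitzWith K m) (hσ : ∃ K : ℝ≥0, LipschitzWith K σ) :
    ∃ K J : ℝ, ∀ x y ε, |deriv u (σ x * ε + m x) - deriv u (σ y * ε + m y)| ≤
      (K + J * |ε|) * ‖x - y‖ := by
  obtain ⟨K, hK⟩ := hm
  obtain ⟨J, hJ⟩ := hσ
  have hA₂ : 0 ≤ A₂ := (abs_nonneg _).trans (h₂ 0)
  refine ⟨A₂ * K, A₂ * J, fun x y ε => ?_⟩
  calc |deriv u (σ x * ε + m x) - deriv u (σ y * ε + m y)|
      ≤ A₂ * |σ x * ε + m x - (σ y * ε + m y)| := abs_sub_le_of_abs_deriv_le hu' h₂ _ _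
    _ = A₂ * |(σ x - σ y) * ε + (m x - m y)| := by ring_nf
    _ ≤ A₂ * (|σ x - σ y| * |ε| + |m x - m y|) := by
        rw [← abs_mul]
        gcongr
        exact abs_add_le _ _
    _ ≤ A₂ * (J * ‖x - y‖ * |ε| + K * ‖x - y‖) := by
        gcongr
        exacts [hJ.norm_sub_le x y, hK.norm_sub_le x y]
    _ = (A₂ * K + A₂ * J * |ε|) * ‖x - y‖ := by ring

theorem HasLipschitzGradient.integral_affine (hμ : MemLp id 2 μ) (hu : Differentiable ℝ u)
    (hu' : Differentiable ℝ (deriv u)) (h₀ : ∀ x, |u x| ≤ A₀) (h₁ : ∀ x, |deriv u x| ≤ A₁)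
    (h₂ : ∀ x, |deriv (deriv u) x| ≤ A₂) {m σ : E → ℝ} {a b : E → E}
    (hm : HasLipschitzGradient m a) (hσ : HasLipschitzGradient σ b) {A B : ℝ}
    (hA : ∀ x, ‖a x‖ ≤ A) (hB : ∀ x, ‖b x‖ ≤ B) :
    HasLipschitzGradient (fun y => ∫ ε, u (σ y * ε + m y) ∂μ) fun x =>
      (∫ ε, deriv u (σ x * ε + m x) ∂μ) • a x + (∫ ε, deriv u (σ x * ε + m x) * ε ∂μ) • b x := by
  have hid : Integrable (fun x : ℝ => x) μ := hμ.integrable one_le_two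
  have hsq : Integrable (fun x : ℝ => x ^ 2) μ := hμ.integrable_sq
  refine ⟨fun x => hasGradientAt_integral_affine hid hu h₀ h₁ (hm.hasGradientAt x)
    (hσ.hasGradientAt x), ?_⟩
  obtain ⟨K, J, hKJ⟩ := exists_abs_deriv_affine_sub_le hu' h₂ (hm.lipschitz_of_bounded hA)
    (hσ.lipschitz_of_bounded hB)
  have lipschitz_zeroth : ∃ K : ℝ≥0, LipschitzWith K fun x => ∫ ε, deriv u (σ x * ε + m x) ∂μ :=
    exists_lipschitzWith_integral (fun x => integrable_deriv_affine h₁ _ _)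
      ((integrable_const K).add (hid.abs.const_mul J)) hKJ
  have lipschitz_first : ∃ K : ℝ≥0, LipschitzWith K fun x =>
      ∫ ε, deriv u (σ x * ε + m x) * ε ∂μ :=
    exists_lipschitzWith_integral (fun x => integrable_deriv_affine_mul_id hid h₁ _ _)
      ((hid.abs.const_mul K).add (hsq.const_mul J)) fun x y ε => by
        rw [← sub_mul, norm_mul]
        refine (mul_le_mul_of_nonneg_right (hKJ x y ε) (norm_nonneg ε)).trans_eq ?_
        rw [Pi.add_apply, ← sq_abs ε, Real.norm_eq_abs]
        ring
  obtain ⟨N₁, hN₁⟩ := exists_lipschitzWith_smul lipschitz_zeroth hm.lipschitz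
    (fun x => abs_integral_le_of_abs_le fun _ => h₁ _) hA
  obtain ⟨N₂, hN₂⟩ := exists_lipschitzWith_smul lipschitz_first hσ.lipschitz
    (fun x => abs_integral_mul_id_le hid fun _ => h₁ _) hB
  exact ⟨_, hN₁.add hN₂⟩

theorem IsLipschitzGradientExtension.integral_affine (hμ : MemLp id 2 μ) (hu : Differentiable ℝ u)
    (hu' : Differentiable ℝ (deriv u)) (h₀ : ∀ x, |u x| ≤ A₀) (h₁ : ∀ x, |deriv u x| ≤ A₁)
    (h₂ : ∀ x, |deriv (deriv u) x| ≤ A₂) {m σ m' σ' : E → ℝ} {a b : E → E} {s : Set E}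
    (hm : IsLipschitzGradientExtension m s m' a) (hσ : IsLipschitzGradientExtension σ s σ' b)
    {A B : ℝ} (hA : ∀ x, ‖a x‖ ≤ A) (hB : ∀ x, ‖b x‖ ≤ B) :
    IsLipschitzGradientExtension (fun y => ∫ ε, u (σ y * ε + m y) ∂μ) s
      (fun y => ∫ ε, u (σ' y * ε + m' y) ∂μ) fun x =>
      (∫ ε, deriv u (σ' x * ε + m' x) ∂μ) • a x +
        (∫ ε, deriv u (σ' x * ε + m' x) * ε ∂μ) • b x where
  hasLipschitzGradient := .integral_affine hμ hu hu' h₀ h₁ h₂ hm.hasLipschitzGradient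
    hσ.hasLipschitzGradient hA hB
  eqOn x hx := by simp only [hm.eqOn hx, hσ.eqOn hx]
  hasGradientAt x hx := by
    simp only [hm.eqOn hx, hσ.eqOn hx]
    exact hasGradientAt_integral_affine (hμ.integrable one_le_two) hu h₀ h₁
      (hm.hasGradientAt x hx) (hσ.hasGradientAt x hx)

end SecondMoment

section Stein

theorem integrable_id_gaussianReal (m : ℝ) (v : ℝ≥0) : Integrable (fun x => x) (gaussianReal m v) :=
  (memLp_id_gaussianReal 1).integrable le_rfl

theorem integrable_stdGaussianReal_iff {f : ℝ → ℝ} :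
    Integrable f (gaussianReal 0 1) ↔ Integrable fun x => gaussianPDFReal 0 1 x * f x := by
  rw [gaussianReal_of_var_ne_zero _ one_ne_zero,
    integrable_withDensity_iff_integrable_smul₀' (by fun_prop)
      (ae_of_all _ fun _ => gaussianPDF_lt_top)]
  simp [toReal_gaussianPDF]

theorem hasDerivAt_stdGaussianPDFReal (x : ℝ) :
    HasDerivAt (gaussianPDFReal 0 1) (-(gaussianPDFReal 0 1 x * x)) x := by
  have pdf_eq : gaussianPDFReal 0 1 = fun y : ℝ =>
      (√(2 * Real.pi))⁻¹ * Real.exp (-y ^ 2 / 2) := by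
    simp [gaussianPDFReal_def]
  rw [pdf_eq]
  have h := (((hasDerivAt_pow 2 x).neg.div_const 2).exp).const_mul (√(2 * Real.pi))⁻¹
  exact h.congr_deriv (by simp; ring)

/-- Stein's identity, integrating by parts against the Gaussian density. -/
theorem integral_mul_id_stdGaussianReal {w w' : ℝ → ℝ} (hw : ∀ x, HasDerivAt w (w' x) x)
    (hw' : Measurable w') {A A' : ℝ} (hA : ∀ x, |w x| ≤ A) (hA' : ∀ x, |w' x| ≤ A') :
    ∫ x, w x * x ∂gaussianReal 0 1 = ∫ x, w' x ∂gaussianReal 0 1 := by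
  have hwm : Measurable w := (continuous_iff_continuousAt.2 fun x => (hw x).continuousAt).measurable
  have i_mul_id := integrable_stdGaussianReal_iff.1
    (integrable_mul_id_of_abs_le (integrable_id_gaussianReal 0 1) hwm hA)
  have i_deriv := integrable_stdGaussianReal_iff.1 (integrable_of_abs_le hw' hA')
  have i_self := integrable_stdGaussianReal_iff.1 (integrable_of_abs_le hwm hA)
  have by_parts := integral_mul_deriv_eq_deriv_mul_of_integrable (fun x _ => hw x)
    (fun x _ => hasDerivAt_stdGaussianPDFReal x)
    (i_mul_id.neg.congr (ae_of_all _ fun x => by simp; ring))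
    (i_deriv.congr (ae_of_all _ fun x => by simp; ring))
    (i_self.congr (ae_of_all _ fun x => by simp; ring))
  rw [integral_gaussianReal_eq_integral_smul one_ne_zero,
    integral_gaussianReal_eq_integral_smul one_ne_zero]
  calc ∫ x, gaussianPDFReal 0 1 x • (w x * x)
      = -∫ x, w x * -(gaussianPDFReal 0 1 x * x) := by
        rw [← integral_neg]
        exact integral_congr_ae (ae_of_all _ fun x => by simp; ring)
    _ = ∫ x, w' x * gaussianPDFReal 0 1 x := by rw [by_parts, neg_neg]
    _ = _ := integral_congr_ae (ae_of_all _ fun x => by simp; ring)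

theorem integral_deriv_affine_mul_id_stdGaussianReal {u : ℝ → ℝ} {A₁ A₂ : ℝ}
    (hu' : Differentiable ℝ (deriv u)) (h₁ : ∀ x, |deriv u x| ≤ A₁)
    (h₂ : ∀ x, |deriv (deriv u) x| ≤ A₂) (s c : ℝ) :
    ∫ ε, deriv u (s * ε + c) * ε ∂gaussianReal 0 1 =
      s * ∫ ε, deriv (deriv u) (s * ε + c) ∂gaussianReal 0 1 := by
  have := measurable_deriv (deriv u)
  rw [← integral_const_mul]
  refine integral_mul_id_stdGaussianReal (w := fun ε => deriv u (s * ε + c)) (A' := |s| * A₂)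
    (fun ε => ?_) (by fun_prop) (fun ε => h₁ _) (fun ε => ?_)
  · have affine : HasDerivAt (fun ε => s * ε + c) s ε := by
      simpa using ((hasDerivAt_id ε).const_mul s).add_const c
    rw [mul_comm]
    exact (hu' (s * ε + c)).hasDerivAt.comp ε affine
  · rw [abs_mul]
    exact mul_le_mul_of_nonneg_left (h₂ _) (abs_nonneg s)

end Stein

/-! ### The parameter space -/

section Param

variable {d : ℕ}

@[simp] theorem mean_pack (u : Fin d → ℝ) (W : Matrix (Fin d) (Fin d) ℝ) :
    (mean (pack u W)).ofLp = u := rfl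

@[simp] theorem cov_pack (u : Fin d → ℝ) (W : Matrix (Fin d) (Fin d) ℝ) :
    cov (pack u W) = W := rfl

@[simp] theorem pack_mean_cov (r : Param d) : pack (mean r).ofLp (cov r) = r := by
  ext j
  rcases j with j | ⟨j, k⟩ <;> rfl

theorem pack_add (u u' : Fin d → ℝ) (W W' : Matrix (Fin d) (Fin d) ℝ) :
    pack (u + u') (W + W') = pack u W + pack u' W' := by
  ext j
  rcases j with j | ⟨j, k⟩ <;> rfl

theorem pack_sub (u u' : Fin d → ℝ) (W W' : Matrix (Fin d) (Fin d) ℝ) :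
    pack (u - u') (W - W') = pack u W - pack u' W' := by
  ext j
  rcases j with j | ⟨j, k⟩ <;> rfl

theorem pack_smul (c : ℝ) (u : Fin d → ℝ) (W : Matrix (Fin d) (Fin d) ℝ) :
    pack (c • u) (c • W) = c • pack u W := by
  ext j
  rcases j with j | ⟨j, k⟩ <;> rfl

@[simp] theorem pack_zero : pack (0 : Fin d → ℝ) 0 = 0 := by
  ext j
  rcases j with j | ⟨j, k⟩ <;> rfl

theorem pack_smul_smul (x y : ℝ) (u : Fin d → ℝ) (W : Matrix (Fin d) (Fin d) ℝ) :
    pack (x • u) (y • W) = x • pack u 0 + y • pack 0 W := by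
  rw [← pack_smul, ← pack_smul, ← pack_add]
  simp

theorem mean_sub (x y : Param d) : (mean (x - y)).ofLp = (mean x).ofLp - (mean y).ofLp := rfl

theorem cov_sub (x y : Param d) : cov (x - y) = cov x - cov y := rfl

theorem cov_add (x y : Param d) : cov (x + y) = cov x + cov y := rfl

theorem cov_smul (c : ℝ) (x : Param d) : cov (c • x) = c • cov x := rfl

theorem inner_pack (u : Fin d → ℝ) (W : Matrix (Fin d) (Fin d) ℝ) (r : Param d) :
    inner ℝ (pack u W) r = u ⬝ᵥ (mean r).ofLp + (Wᵀ * cov r).trace := by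
  rw [PiLp.inner_apply, Fintype.sum_sum_type, Fintype.sum_prod_type]
  simp only [Matrix.trace, Matrix.diag, Matrix.mul_apply, dotProduct, Matrix.transpose_apply]
  rw [Finset.sum_comm (f := fun x y => W y x * cov r y x)]
  simp [pack, mean, cov, mul_comm]

theorem norm_sq_pack (u : Fin d → ℝ) (W : Matrix (Fin d) (Fin d) ℝ) :
    ‖pack u W‖ ^ 2 = u ⬝ᵥ u + (Wᵀ * W).trace := by
  rw [← real_inner_self_eq_norm_sq, inner_pack, mean_pack, cov_pack]

theorem norm_sq_eq_mean_cov (r : Param d) :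
    ‖r‖ ^ 2 = (mean r).ofLp ⬝ᵥ (mean r).ofLp + ((cov r)ᵀ * cov r).trace := by
  conv_lhs => rw [← pack_mean_cov r]
  exact norm_sq_pack _ _

theorem continuous_cov : Continuous (cov : Param d → Matrix (Fin d) (Fin d) ℝ) :=
  continuous_matrix fun j k => by
    simp only [cov, Matrix.of_apply]
    fun_prop

/-- The parameters `(m, V)` with `V` symmetric and `V ⪰ v I`, on which the covariance part of the
objective is smooth. -/
def nondegenerate (v : ℝ) : Set (Param d) :=
  {r | (cov r - v • (1 : Matrix (Fin d) (Fin d) ℝ)).PosSemidef}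

theorem isClosed_nondegenerate (v : ℝ) : IsClosed (nondegenerate v : Set (Param d)) := by
  have := continuous_cov (d := d)
  have nondegenerate_eq : (nondegenerate v : Set (Param d)) =
      {r | (cov r - v • (1 : Matrix (Fin d) (Fin d) ℝ)).IsHermitian} ∩
      ⋂ x : Fin d → ℝ, {r | 0 ≤ x ⬝ᵥ (cov r - v • (1 : Matrix (Fin d) (Fin d) ℝ)) *ᵥ x} := by
    ext r
    simp [nondegenerate, Matrix.posSemidef_iff_dotProduct_mulVec]
  rw [nondegenerate_eq]
  exact (isClosed_eq (by fun_prop) (by fun_prop)).inter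
    (isClosed_iInter fun x => isClosed_le continuous_const (by fun_prop))

end Param

namespace Model

variable {n d : ℕ} (M : Model n d)

theorem latentMean_eq_inner (i : Fin n) (r : Param d) :
    M.latentMean i r = inner ℝ (pack (M.a₁ i) 0) r + M.b₁ i := by
  simp [latentMean, inner_pack]

theorem latentVar_eq_inner (i : Fin n) (r : Param d) :
    M.latentVar i r = inner ℝ (pack 0 (Matrix.vecMulVec (M.a₂ i) (M.a₂ i))) r + M.b₂ i := by
  rw [latentVar, inner_pack, Matrix.transpose_vecMulVec, Matrix.vecMulVec_mul,
    Matrix.trace_vecMulVec, Matrix.dotProduct_mulVec, dotProduct_comm]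
  simp

theorem hasLipschitzGradient_latentMean (i : Fin n) :
    HasLipschitzGradient (M.latentMean i) fun _ => pack (M.a₁ i) 0 := by
  rw [funext (M.latentMean_eq_inner i)]
  exact ⟨hasGradientAt_inner_add_const _ _, 0, LipschitzWith.const _⟩

theorem hasLipschitzGradient_latentVar (i : Fin n) :
    HasLipschitzGradient (M.latentVar i)
      fun _ => pack 0 (Matrix.vecMulVec (M.a₂ i) (M.a₂ i)) := by
  rw [funext (M.latentVar_eq_inner i)]
  exact ⟨hasGradientAt_inner_add_const _ _, 0, LipschitzWith.const _⟩

theorem continuous_latentMean (i : Fin n) : Continuous (M.latentMean i) :=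
  (M.hasLipschitzGradient_latentMean i).contDiff.continuous

theorem continuous_latentVar (i : Fin n) : Continuous (M.latentVar i) :=
  (M.hasLipschitzGradient_latentVar i).contDiff.continuous

theorem latentVar_ge {v : ℝ} (i : Fin n) {r : Param d} (hr : r ∈ nondegenerate v) :
    v * (M.a₂ i ⬝ᵥ M.a₂ i) + M.b₂ i ≤ M.latentVar i r := by
  have := Matrix.PosSemidef.dotProduct_mulVec_nonneg hr (M.a₂ i)
  rw [Matrix.sub_mulVec, dotProduct_sub, Matrix.smul_mulVec, Matrix.one_mulVec, dotProduct_smul]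
    at this
  simp only [star_trivial, smul_eq_mul] at this
  rw [latentVar]
  linarith

theorem exists_g_eq (i : Fin n) (h : M.a₁ i ≠ 0 ∨ M.a₂ i ≠ 0) (x : ℝ) :
    ∃ r ε, M.g i r ε = x := by
  by_cases ha₁ : M.a₁ i = 0
  · have ha₂ : M.a₂ i ⬝ᵥ M.a₂ i ≠ 0 := by simpa [ha₁] using h
    refine ⟨pack 0 (((1 - M.b₂ i) / (M.a₂ i ⬝ᵥ M.a₂ i)) • 1), x - M.b₁ i, ?_⟩
    simp [g, latentMean, latentVar, ha₁, Matrix.smul_mulVec, ha₂]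
  · have ha₁_sq : M.a₁ i ⬝ᵥ M.a₁ i ≠ 0 := by simpa using ha₁
    refine ⟨pack (((x - M.b₁ i) / (M.a₁ i ⬝ᵥ M.a₁ i)) • M.a₁ i) 0, 0, ?_⟩
    simp [g, latentMean, ha₁_sq]

variable {M}

theorem DerivBounds.lik_mem {B b' B' b'' B'' : ℝ} (hb : M.DerivBounds B b' B' b'' B'') {i : Fin n}
    (h : M.a₁ i ≠ 0 ∨ M.a₂ i ≠ 0) (x : ℝ) :
    (0 ≤ M.lik i x ∧ M.lik i x ≤ B) ∧ |deriv (M.lik i) x| ≤ max |b'| |B'| ∧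
      |deriv (deriv (M.lik i)) x| ≤ max |b''| |B''| := by
  obtain ⟨r, ε, rfl⟩ := M.exists_g_eq i h x
  obtain ⟨h, h', h''⟩ := hb i r ε
  exact ⟨h, abs_le_max_abs_abs h'.1 h'.2, abs_le_max_abs_abs h''.1 h''.2⟩

theorem Eφ_eq_of_eq_zero {i : Fin n} (h₁ : M.a₁ i = 0) (h₂ : M.a₂ i = 0) (r : Param d) :
    M.Eφ i r = M.Eφ i 0 := by
  simp only [Eφ, φ, g, latentMean, latentVar, h₁, h₂, zero_dotProduct, Matrix.mulVec_zero]

theorem exists_extension_sqrt_latentVar {v : ℝ} (hv : 0 < v) {i : Fin n} (hb₂ : 0 ≤ M.b₂ i) :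
    ∃ (σ : Param d → ℝ) (b : Param d → Param d) (A : ℝ),
      IsLipschitzGradientExtension (fun x => √(M.latentVar i x)) (nondegenerate v) σ b ∧
      (∀ x, ‖b x‖ ≤ A) ∧ ∀ x ∈ nondegenerate v, √(M.latentVar i x) • b x =
        pack 0 ((1 / 2 : ℝ) • Matrix.vecMulVec (M.a₂ i) (M.a₂ i)) := by
  rcases eq_or_ne (M.a₂ i) 0 with ha | ha
  · have const : (fun x => √(M.latentVar i x)) = fun _ => √(M.b₂ i) := by
      simp [latentVar, ha]
    rw [const]
    exact ⟨_, _, 0, (HasLipschitzGradient.const _).isLipschitzGradientExtension _, by simp,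
      by simp [ha]⟩
  have ha_sq : 0 < M.a₂ i ⬝ᵥ M.a₂ i := by simpa using Matrix.dotProduct_star_self_pos_iff.2 ha
  have hs₀ : 0 < v * (M.a₂ i ⬝ᵥ M.a₂ i) + M.b₂ i := by positivity
  refine ⟨_, _, _, .comp (φ := Real.sqrt) (hasDerivAt_sqrtExtension hs₀)
    (exists_lipschitzWith_sqrtExtension_deriv hs₀) (abs_sqrtExtension_deriv_le hs₀)
    (fun x hx => sqrtExtension_of_le hx) (fun x hx => ?_)
    ((M.hasLipschitzGradient_latentVar i).isLipschitzGradientExtension _) (fun _ => le_rfl)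
    (fun x hx => M.latentVar_ge i hx),
    fun x => (norm_smul_le _ _).trans
      (mul_le_mul_of_nonneg_right (abs_sqrtExtension_deriv_le hs₀ _) (norm_nonneg _)),
    fun x hx => ?_⟩
  · rw [max_eq_left hx]
    exact Real.hasDerivAt_sqrt (hs₀.trans_le hx).ne'
  · have hle := M.latentVar_ge i hx
    have hsqrt : √(M.latentVar i x) ≠ 0 := (Real.sqrt_pos.2 (hs₀.trans_le hle)).ne'
    rw [max_eq_left hle, smul_smul, mul_one_div, div_mul_cancel_right₀ hsqrt,
      ← one_div, ← pack_smul, smul_zero]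

theorem exists_extension_Eφ {B b' B' b'' B'' v : ℝ} (hb : M.DerivBounds B b' B' b'' B'')
    (hv : 0 < v) {i : Fin n} (hb₂ : 0 ≤ M.b₂ i) (hlik : Differentiable ℝ (M.lik i))
    (hlik' : Differentiable ℝ (deriv (M.lik i))) :
    ∃ (Φ : Param d → ℝ) (D : Param d → Param d) (A : ℝ),
      IsLipschitzGradientExtension (M.Eφ i) (nondegenerate v) Φ D ∧
      (∀ x, ‖D x‖ ≤ A) ∧ (∀ x, Φ x ≤ B) ∧
      ∀ x ∈ nondegenerate v, D x = pack (M.Eφ' i x • M.a₁ i)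
        (M.Eφ'' i x • ((1 / 2 : ℝ) • Matrix.vecMulVec (M.a₂ i) (M.a₂ i))) := by
  by_cases ha : M.a₁ i = 0 ∧ M.a₂ i = 0
  · obtain ⟨h₁, h₂⟩ := ha
    rw [funext (Eφ_eq_of_eq_zero h₁ h₂)]
    exact ⟨_, _, 0, (HasLipschitzGradient.const _).isLipschitzGradientExtension _, by simp,
      fun _ => integral_le_of_nonneg_of_le (fun ε => (hb i 0 ε).1.1) fun ε => (hb i 0 ε).1.2,
      by simp [h₁, h₂]⟩
  have hu := hb.lik_mem (i := i) (not_and_or.1 ha)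
  have h₁ := fun x => (hu x).2.1
  have h₂ := fun x => (hu x).2.2
  obtain ⟨σ, b, A, hσ, hA, hσb⟩ := exists_extension_sqrt_latentVar hv hb₂
  refine ⟨_, _, _, .integral_affine (memLp_id_gaussianReal 2) hlik hlik'
    (fun x => (abs_of_nonneg (hu x).1.1).trans_le (hu x).1.2) h₁ h₂
    ((M.hasLipschitzGradient_latentMean i).isLipschitzGradientExtension _) hσ (fun _ => le_rfl) hA,
    fun x => norm_gradient_integral_affine_le (integrable_id_gaussianReal 0 1) h₁ _ _ le_rfl (hA x),
    fun x => integral_le_of_nonneg_of_le (fun ε => (hu _).1.1) fun ε => (hu _).1.2,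
    fun x hx => ?_⟩
  rw [hσ.eqOn hx, integral_deriv_affine_mul_id_stdGaussianReal hlik' h₁ h₂, mul_comm, mul_smul,
    hσb x hx, pack_smul_smul]
  rfl

theorem continuous_Eφ {B b' B' b'' B'' : ℝ} (hb : M.DerivBounds B b' B' b'' B'') {i : Fin n}
    (hlik : Continuous (M.lik i)) : Continuous (M.Eφ i) := by
  have := M.continuous_latentMean i
  have := M.continuous_latentVar i
  refine continuous_of_dominated (bound := fun _ => B)
    (fun r => (by fun_prop : Continuous fun ε => M.lik i (√(M.latentVar i r) * ε +
      M.latentMean i r)).aestronglyMeasurable)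
    (fun r => ae_of_all _ fun ε => (abs_of_nonneg (hb i r ε).1.1).trans_le (hb i r ε).1.2)
    (integrable_const B)
    (ae_of_all _ fun ε => (by fun_prop : Continuous fun r => M.lik i (√(M.latentVar i r) * ε +
      M.latentMean i r)))

theorem isClosed_domain {B b' B' b'' B'' : ℝ} (hb : M.DerivBounds B b' B' b'' B'')
    (hlik : ∀ i, Continuous (M.lik i)) (ζ v : ℝ) : IsClosed (M.domain ζ v) := by
  have domain_eq : M.domain ζ v = nondegenerate v ∩ ⋂ i, {r | ζ ≤ M.Eφ i r} := by
    ext r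
    simp [domain, nondegenerate]
  rw [domain_eq]
  exact (isClosed_nondegenerate v).inter (isClosed_iInter fun i =>
    isClosed_le continuous_const (continuous_Eφ hb (hlik i)))

end Model

/-! ### Trace inequalities for functions of symmetric matrices -/

section Spectral

variable {ι : Type*} [Fintype ι] [DecidableEq ι] {A B : Matrix ι ι ℝ}

theorem continuousOn_real_spectrum (φ : ℝ → ℝ) (A : Matrix ι ι ℝ) :
    ContinuousOn φ (spectrum ℝ A) :=
  A.finite_real_spectrum.continuousOn φ

theorem trace_cfc (hA : A.IsHermitian) (φ : ℝ → ℝ) :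
    (cfc φ A).trace = ∑ i, φ (hA.eigenvalues i) := by
  rw [hA.cfc_eq, Matrix.IsHermitian.cfc, Unitary.conjStarAlgAut_apply, Matrix.trace_mul_cycle,
    Unitary.coe_star_mul_self, Matrix.one_mul, Matrix.trace_diagonal]
  rfl

theorem transpose_cfc (φ : ℝ → ℝ) (A : Matrix ι ι ℝ) : (cfc φ A)ᵀ = cfc φ A := by
  simpa only [Matrix.star_eq_conjTranspose, Matrix.conjTranspose_eq_transpose_of_trivial] using
    (IsSelfAdjoint.cfc (f := φ) (a := A)).star_eq

theorem cfc_mul_cfc (φ χ : ℝ → ℝ) (A : Matrix ι ι ℝ) :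
    cfc φ A * cfc χ A = cfc (fun x => φ x * χ x) A :=
  (cfc_mul φ χ A (continuousOn_real_spectrum φ A) (continuousOn_real_spectrum χ A)).symm

-- The weights are the squared inner products of the eigenvectors of `A` with those of `B`.
theorem exists_trace_cfc_mul_cfc (hA : A.IsHermitian) (hB : B.IsHermitian) :
    ∃ w : ι → ι → ℝ, (∀ i j, 0 ≤ w i j) ∧ ∀ φ χ : ℝ → ℝ, (cfc φ A * cfc χ B).trace =
      ∑ i, ∑ j, w i j * (φ (hA.eigenvalues i) * χ (hB.eigenvalues j)) := by
  set O : Matrix ι ι ℝ := star (hA.eigenvectorUnitary : Matrix ι ι ℝ) * hB.eigenvectorUnitary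
    with hO
  refine ⟨fun i j => O i j ^ 2, fun i j => sq_nonneg _, fun φ χ => ?_⟩
  have trace_eq : (cfc φ A * cfc χ B).trace = (Matrix.diagonal (φ ∘ hA.eigenvalues) *
      (O * Matrix.diagonal (χ ∘ hB.eigenvalues) * Oᵀ)).trace := by
    rw [hA.cfc_eq, hB.cfc_eq, Matrix.IsHermitian.cfc, Matrix.IsHermitian.cfc,
      Unitary.conjStarAlgAut_apply, Unitary.conjStarAlgAut_apply, Matrix.mul_assoc (_ * _),
      Matrix.mul_assoc, Matrix.trace_mul_comm, hO, Matrix.transpose_mul]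
    simp only [Matrix.star_eq_conjTranspose, Matrix.conjTranspose_eq_transpose_of_trivial,
      Matrix.transpose_transpose, RCLike.ofReal_real_eq_id, Function.id_comp, Matrix.mul_assoc]
  rw [trace_eq, Matrix.trace]
  refine Finset.sum_congr rfl fun i _ => ?_
  rw [Matrix.diag_apply, Matrix.diagonal_mul, Matrix.mul_apply, Finset.mul_sum]
  refine Finset.sum_congr rfl fun j _ => ?_
  rw [Matrix.mul_diagonal, Matrix.transpose_apply, Function.comp_apply, Function.comp_apply]
  ring

theorem exists_trace_cfc_eq (hA : A.IsHermitian) (hB : B.IsHermitian) :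
    ∃ w : ι → ι → ℝ, (∀ i j, 0 ≤ w i j) ∧
      (∀ φ, (cfc φ A).trace = ∑ i, ∑ j, w i j * φ (hA.eigenvalues i)) ∧
      (∀ χ, (cfc χ B).trace = ∑ i, ∑ j, w i j * χ (hB.eigenvalues j)) ∧
      (∀ φ, (cfc φ A * B).trace =
        ∑ i, ∑ j, w i j * (φ (hA.eigenvalues i) * hB.eigenvalues j)) ∧
      ∀ φ χ, (cfc φ A * cfc χ B).trace =
        ∑ i, ∑ j, w i j * (φ (hA.eigenvalues i) * χ (hB.eigenvalues j)) := by
  obtain ⟨w, hw, trace_mul⟩ := exists_trace_cfc_mul_cfc hA hB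
  refine ⟨w, hw, fun φ => ?_, fun χ => ?_, fun φ => ?_, trace_mul⟩
  · simpa [cfc_const_one ℝ B hB.isSelfAdjoint] using trace_mul φ fun _ => 1
  · simpa [cfc_const_one ℝ A hA.isSelfAdjoint] using trace_mul (fun _ => 1) χ
  · simpa only [cfc_id' ℝ B hB.isSelfAdjoint] using trace_mul φ fun x => x

/-- **Klein's inequality**. -/
theorem trace_cfc_add_trace_mul_sub_le (hA : A.IsHermitian) (hB : B.IsHermitian) {ψ ψ' : ℝ → ℝ}
    (hψ : ∀ x y, ψ x + ψ' x * (y - x) ≤ ψ y) :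
    (cfc ψ A).trace + (cfc ψ' A * (B - A)).trace ≤ (cfc ψ B).trace := by
  obtain ⟨w, hw, trace_A, trace_B, trace_mul_B, -⟩ := exists_trace_cfc_eq hA hB
  have mul_A : cfc ψ' A * A = cfc (fun x => ψ' x * x) A := by
    simpa only [cfc_id' ℝ A hA.isSelfAdjoint] using cfc_mul_cfc ψ' (fun x => x) A
  rw [Matrix.mul_sub, Matrix.trace_sub, mul_A, trace_mul_B, trace_A, trace_A, trace_B]
  simp only [← Finset.sum_add_distrib, ← Finset.sum_sub_distrib]
  gcongr with i _ j _
  linarith [mul_le_mul_of_nonneg_left (hψ (hA.eigenvalues i) (hB.eigenvalues j)) (hw i j)]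

theorem trace_cfc_sub_cfc_sq_le (hA : A.IsHermitian) (hB : B.IsHermitian) {φ : ℝ → ℝ} {K : ℝ≥0}
    (hφ : LipschitzWith K φ) :
    ((cfc φ A - cfc φ B) * (cfc φ A - cfc φ B)).trace ≤
      K ^ 2 * ((A - B) * (A - B)).trace := by
  obtain ⟨w, hw, trace_A, trace_B, -, trace_mul⟩ := exists_trace_cfc_eq hA hB
  have trace_sq : ∀ χ : ℝ → ℝ, ((cfc χ A - cfc χ B) * (cfc χ A - cfc χ B)).trace =
      ∑ i, ∑ j, w i j * (χ (hA.eigenvalues i) - χ (hB.eigenvalues j)) ^ 2 := by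
    intro χ
    simp only [Matrix.sub_mul, Matrix.mul_sub, Matrix.trace_sub, cfc_mul_cfc,
      Matrix.trace_mul_comm (cfc χ B) (cfc χ A), trace_A, trace_B, trace_mul,
      ← Finset.sum_sub_distrib]
    refine Finset.sum_congr rfl fun i _ => Finset.sum_congr rfl fun j _ => ?_
    ring
  have trace_sub_sq := trace_sq fun x => x
  rw [cfc_id' ℝ A hA.isSelfAdjoint, cfc_id' ℝ B hB.isSelfAdjoint] at trace_sub_sq
  rw [trace_sq, trace_sub_sq]
  simp only [Finset.mul_sum, mul_left_comm ((K : ℝ) ^ 2), ← mul_pow]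
  refine Finset.sum_le_sum fun i _ => Finset.sum_le_sum fun j _ => ?_
  refine mul_le_mul_of_nonneg_left ?_ (hw i j)
  rw [sq_le_sq, abs_mul, NNReal.abs_eq]
  simpa only [Real.dist_eq] using hφ.dist_le_mul (hA.eigenvalues i) (hB.eigenvalues j)

theorem exists_le_trace_mul_add_trace_cfc (hB : B.PosDef) {ψ : ℝ → ℝ}
    (hψ : ∀ s, 0 < s → ∃ c, ∀ x, c ≤ s * x + ψ x) :
    ∃ c, ∀ A : Matrix ι ι ℝ, A.IsHermitian → c ≤ (B * A).trace + (cfc ψ A).trace := by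
  choose! c hc using hψ
  refine ⟨(cfc c B).trace, fun A hA => ?_⟩
  obtain ⟨w, hw, trace_B, trace_A, trace_mul_A, -⟩ := exists_trace_cfc_eq hB.1 hA
  have trace_mul := trace_mul_A fun x => x
  rw [cfc_id' ℝ B hB.1.isSelfAdjoint] at trace_mul
  rw [trace_mul, trace_B, trace_A]
  simp only [← Finset.sum_add_distrib, ← mul_add]
  gcongr with i _ j _
  · exact hw i j
  · exact hc _ (hB.eigenvalues_pos i) _

theorem trace_cfc_neg_log (hA : A.PosDef) :
    (cfc (fun x => -Real.log x) A).trace = -Real.log A.det := by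
  rw [trace_cfc hA.1, Finset.sum_neg_distrib, hA.1.det_eq_prod_eigenvalues]
  simp only [RCLike.ofReal_real_eq_id, id]
  rw [Real.log_prod fun i _ => (hA.eigenvalues_pos i).ne']

theorem cfc_neg_inv (hA : A.PosDef) : cfc (fun x : ℝ => -x⁻¹) A = -A⁻¹ := by
  obtain ⟨U, rfl⟩ := hA.isUnit
  rw [cfc_neg, cfc_inv_id U hA.1.isSelfAdjoint, Matrix.coe_units_inv]

open scoped MatrixOrder in
theorem le_of_mem_spectrum {v x : ℝ} (hA : A.IsHermitian) (h : (A - v • 1).PosSemidef)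
    (hx : x ∈ spectrum ℝ A) : v ≤ x :=
  (algebraMap_le_iff_le_spectrum hA.isSelfAdjoint).1
    (by rwa [Algebra.algebraMap_eq_smul_one, Matrix.le_iff]) x hx

end Spectral

/-! ### The log-determinant -/

section LogDet

variable {d : ℕ}

/-- The symmetric part of the matrix `V` of `r = (m, V)`. -/
def symmCov (r : Param d) : Matrix (Fin d) (Fin d) ℝ := (1 / 2 : ℝ) • (cov r + (cov r)ᵀ)

theorem isHermitian_symmCov (r : Param d) : (symmCov r).IsHermitian := by
  rw [Matrix.IsHermitian, Matrix.conjTranspose_eq_transpose_of_trivial, symmCov,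
    Matrix.transpose_smul, Matrix.transpose_add, Matrix.transpose_transpose, add_comm]

theorem symmCov_eq {r : Param d} (h : (cov r)ᵀ = cov r) : symmCov r = cov r := by
  rw [symmCov, h, ← two_smul ℝ, smul_smul, one_div, inv_mul_cancel₀ two_ne_zero, one_smul]

theorem symmCov_sub (x y : Param d) : symmCov (x - y) = symmCov x - symmCov y := by
  simp only [symmCov, cov_sub, Matrix.transpose_sub, ← smul_sub]
  congr 1
  abel

theorem trace_mul_symmCov {G : Matrix (Fin d) (Fin d) ℝ} (hG : Gᵀ = G) (r : Param d) :
    (G * symmCov r).trace = (G * cov r).trace := by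
  have trace_mul_transpose : (G * (cov r)ᵀ).trace = (G * cov r).trace := by
    rw [← Matrix.trace_transpose, Matrix.transpose_mul, Matrix.transpose_transpose, hG,
      Matrix.trace_mul_comm]
  rw [symmCov, Matrix.mul_smul, Matrix.mul_add, Matrix.trace_smul, Matrix.trace_add,
    trace_mul_transpose, smul_eq_mul]
  ring

theorem trace_symmCov_sq_le (r : Param d) : (symmCov r * symmCov r).trace ≤ ‖r‖ ^ 2 := by
  have mean_nonneg : 0 ≤ (mean r).ofLp ⬝ᵥ (mean r).ofLp := by
    simpa using dotProduct_star_self_nonneg (mean r).ofLp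
  have antisymm_nonneg : 0 ≤ ((cov r - (cov r)ᵀ)ᵀ * (cov r - (cov r)ᵀ)).trace := by
    simpa using (Matrix.posSemidef_conjTranspose_mul_self (cov r - (cov r)ᵀ)).trace_nonneg
  have trace_transpose_sq : ((cov r)ᵀ * (cov r)ᵀ).trace = (cov r * cov r).trace := by
    rw [← Matrix.transpose_mul, Matrix.trace_transpose]
  have trace_comm := Matrix.trace_mul_comm (cov r) (cov r)ᵀ
  rw [norm_sq_eq_mean_cov]
  simp only [Matrix.transpose_sub, Matrix.transpose_transpose, Matrix.sub_mul, Matrix.mul_sub,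
    Matrix.trace_sub] at antisymm_nonneg
  simp only [symmCov, Matrix.smul_mul, Matrix.mul_smul, Matrix.add_mul, Matrix.mul_add,
    Matrix.trace_smul, Matrix.trace_add, smul_eq_mul]
  linarith [trace_transpose_sq]

theorem hasLipschitzGradient_trace_cfc {ψ ψ' : ℝ → ℝ}
    (hψ : ∀ x y, ψ x + ψ' x * (y - x) ≤ ψ y) (hψ' : ∃ K : ℝ≥0, LipschitzWith K ψ') :
    HasLipschitzGradient (fun r : Param d => (cfc ψ (symmCov r)).trace)
      fun r => pack 0 (cfc ψ' (symmCov r)) := by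
  obtain ⟨K, hK⟩ := hψ'
  refine HasLipschitzGradient.of_subgradient (K := K) (fun x y => ?_) fun x y => ?_
  · refine le_trans (le_of_eq ?_) (trace_cfc_add_trace_mul_sub_le (isHermitian_symmCov x)
      (isHermitian_symmCov y) hψ)
    rw [inner_pack, ← symmCov_sub, trace_mul_symmCov (transpose_cfc _ _), transpose_cfc,
      zero_dotProduct, zero_add]
  · rw [← pack_sub, sub_self]
    refine (sq_le_sq₀ (norm_nonneg _) (by positivity)).1 ?_
    rw [norm_sq_pack, mul_pow, Matrix.transpose_sub, transpose_cfc, transpose_cfc,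
      zero_dotProduct, zero_add]
    refine (trace_cfc_sub_cfc_sq_le (isHermitian_symmCov x) (isHermitian_symmCov y) hK).trans ?_
    rw [← symmCov_sub]
    exact mul_le_mul_of_nonneg_left (trace_symmCov_sq_le _) (by positivity)

theorem hasDerivAt_det_one_add_smul {ι : Type*} [Fintype ι] [DecidableEq ι] (H : Matrix ι ι ℝ) :
    HasDerivAt (fun t : ℝ => (1 + t • H).det) H.trace 0 := by
  rw [funext fun t => Matrix.det_one_add_smul t H]
  set q := (Matrix.det (1 + (Polynomial.X : Polynomial ℝ) • H.map Polynomial.C)).divX.divX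
  simpa using (((hasDerivAt_id (0 : ℝ)).const_mul H.trace).const_add 1).fun_add
    ((q.hasDerivAt 0).fun_mul (hasDerivAt_pow 2 0))

theorem differentiable_det_cov : Differentiable ℝ fun r : Param d => (cov r).det := by
  simp only [Matrix.det_apply, cov, Matrix.of_apply]
  fun_prop

theorem hasGradientAt_det_cov {x : Param d} (hx : IsUnit (cov x).det) :
    HasGradientAt (fun r : Param d => (cov r).det)
      ((cov x).det • pack 0 ((cov x)⁻¹)ᵀ) x := by
  have hdet := (differentiable_det_cov x).hasFDerivAt
  rw [hasGradientAt_iff_hasFDerivAt]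
  convert! hdet using 1
  refine ContinuousLinearMap.ext fun y => ?_
  have line_eq : (fun t : ℝ => (cov (x + t • y)).det) =
      fun t => (cov x).det * (1 + t • ((cov x)⁻¹ * cov y)).det := by
    funext t
    rw [← Matrix.det_mul, Matrix.mul_add, Matrix.mul_one, Matrix.mul_smul, ← Matrix.mul_assoc,
      Matrix.mul_nonsing_inv _ hx, Matrix.one_mul, cov_add, cov_smul]
  have deriv_eq := (hdet.hasLineDerivAt y).unique
    (line_eq ▸ (hasDerivAt_det_one_add_smul ((cov x)⁻¹ * cov y)).const_mul (cov x).det)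
  rw [deriv_eq, InnerProductSpace.toDual_apply_apply, inner_smul_left, inner_pack,
    Matrix.transpose_transpose, zero_dotProduct, zero_add]
  rfl

theorem hasGradientAt_neg_log_det_cov {x : Param d} (hx : (cov x).PosDef) :
    HasGradientAt (fun r : Param d => -Real.log (cov r).det) (pack 0 (-(cov x)⁻¹)) x := by
  have hpos := hx.det_pos
  have hgrad := hasGradientAt_comp (f := fun r : Param d => (cov r).det)
    (φ := fun y => -Real.log y) (Real.hasDerivAt_log hpos.ne').neg
    (hasGradientAt_det_cov hpos.ne'.isUnit)
  have inv_symm : (cov x)⁻¹ᵀ = (cov x)⁻¹ := by simpa using hx.inv.1.eq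
  rw [smul_smul, neg_mul, inv_mul_cancel₀ hpos.ne', inv_symm, ← pack_smul, smul_zero,
    neg_one_smul] at hgrad
  exact hgrad

theorem posDef_cov {v : ℝ} (hv : 0 < v) {r : Param d} (hr : r ∈ nondegenerate v) :
    (cov r).PosDef := by
  simpa using (Matrix.PosDef.one.smul hv).posSemidef_add hr

theorem isLipschitzGradientExtension_neg_log_det_cov {v κ : ℝ} (hv : 0 < v)
    (hκ : 0 ≤ κ) :
    IsLipschitzGradientExtension (fun r : Param d => -Real.log (cov r).det) (nondegenerate v)
      (fun r => (cfc (negLogExtension v κ) (symmCov r)).trace)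
      fun r => pack 0 (cfc (fun z => -(max z v)⁻¹ + κ * min (z - v) 0) (symmCov r)) := by
  have symmCov_eq_cov : ∀ x : Param d, x ∈ nondegenerate v → symmCov x = cov x := fun x hx =>
    symmCov_eq (by simpa using (posDef_cov hv hx).1.eq)
  have le_spectrum : ∀ x : Param d, x ∈ nondegenerate v → ∀ z ∈ spectrum ℝ (cov x), v ≤ z :=
    fun x hx _ => le_of_mem_spectrum (posDef_cov hv hx).1 hx
  refine ⟨hasLipschitzGradient_trace_cfc (negLogExtension_tangent_le hv hκ)
    (exists_lipschitzWith_negLogExtension_deriv hv κ), fun x hx => ?_, fun x hx => ?_⟩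
  · rw [symmCov_eq_cov x hx, ← trace_cfc_neg_log (posDef_cov hv hx)]
    congr 1
    exact cfc_congr fun z hz => negLogExtension_of_le κ (le_spectrum x hx z hz)
  · have cfc_deriv_eq : cfc (fun z => -(max z v)⁻¹ + κ * min (z - v) 0) (cov x) = -(cov x)⁻¹ := by
      rw [← cfc_neg_inv (posDef_cov hv hx)]
      refine cfc_congr fun z hz => ?_
      have hz := le_spectrum x hx z hz
      simp [hz]
    rw [symmCov_eq_cov x hx, cfc_deriv_eq]
    exact hasGradientAt_neg_log_det_cov (posDef_cov hv hx)

end LogDet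

/-! ### The extension of the objective -/

section Quadratic

variable {d : ℕ}

theorem hasLipschitzGradient_trace_mul_cov (G : Matrix (Fin d) (Fin d) ℝ) :
    HasLipschitzGradient (fun r : Param d => (G * cov r).trace) fun _ => pack 0 Gᵀ := by
  have trace_eq_inner : (fun r : Param d => (G * cov r).trace) =
      fun r => inner ℝ (pack 0 Gᵀ) r + 0 := by
    ext r
    rw [inner_pack, Matrix.transpose_transpose, zero_dotProduct, zero_add, add_zero]
  rw [trace_eq_inner]
  exact ⟨hasGradientAt_inner_add_const _ _, 0, LipschitzWith.const _⟩

theorem dotProduct_mulVec_add_le {ι : Type*} [Fintype ι] {Q : Matrix ι ι ℝ}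
    (hQ : Q.PosSemidef) (x y : ι → ℝ) :
    x ⬝ᵥ Q *ᵥ x + ((2 : ℝ) • Q *ᵥ x) ⬝ᵥ (y - x) ≤ y ⬝ᵥ Q *ᵥ y := by
  have mulVec_symm : x ⬝ᵥ Q *ᵥ y = (Q *ᵥ x) ⬝ᵥ y := by
    rw [Matrix.dotProduct_mulVec, ← Matrix.mulVec_transpose,
      show Qᵀ = Q by simpa using hQ.1.eq]
  have sq_nonneg := hQ.dotProduct_mulVec_nonneg (y - x)
  simp only [star_trivial, Matrix.mulVec_sub, sub_dotProduct, dotProduct_sub, smul_dotProduct,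
    smul_eq_mul] at sq_nonneg ⊢
  linarith [dotProduct_comm (Q *ᵥ x) y, dotProduct_comm (Q *ᵥ x) x]

theorem hasLipschitzGradient_quadratic (m₀ : Fin d → ℝ) {Q : Matrix (Fin d) (Fin d) ℝ}
    (hQ : Q.PosSemidef) :
    HasLipschitzGradient
      (fun r : Param d => ((mean r).ofLp - m₀) ⬝ᵥ Q *ᵥ ((mean r).ofLp - m₀))
      fun r => pack ((2 : ℝ) • Q *ᵥ ((mean r).ofLp - m₀)) 0 := by
  let T : Param d →ₗ[ℝ] Param d :=
    { toFun := fun r => pack ((2 : ℝ) • Q *ᵥ (mean r).ofLp) 0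
      map_add' := fun x y => by
        rw [← pack_add, ← smul_add, ← Matrix.mulVec_add, add_zero]
        rfl
      map_smul' := fun c x => by
        rw [RingHom.id_apply, ← pack_smul, smul_comm c, ← Matrix.mulVec_smul Q c, smul_zero]
        rfl }
  refine HasLipschitzGradient.of_subgradient (K := ‖LinearMap.toContinuousLinearMap T‖)
    (fun x y => ?_) fun x y => ?_
  · rw [inner_pack, Matrix.transpose_zero, Matrix.zero_mul, Matrix.trace_zero, add_zero, mean_sub]
    simpa only [sub_sub_sub_cancel_right] using
      dotProduct_mulVec_add_le hQ ((mean x).ofLp - m₀) ((mean y).ofLp - m₀)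
  · refine le_trans (le_of_eq ?_) ((LinearMap.toContinuousLinearMap T).le_opNorm (x - y))
    rw [LinearMap.coe_toContinuousLinearMap', map_sub]
    change _ = ‖pack ((2 : ℝ) • Q *ᵥ (mean x).ofLp) 0 - pack ((2 : ℝ) • Q *ᵥ (mean y).ofLp) 0‖
    simp only [← pack_sub, ← smul_sub, ← Matrix.mulVec_sub, sub_sub_sub_cancel_right]

end Quadratic

namespace Model

variable {n d : ℕ} {M : Model n d}

theorem exists_extension_regularizer (hβ : 0 ≤ M.β) (hS₀ : M.S₀.PosDef) {v : ℝ} (hv : 0 < v) :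
    ∃ (R : Param d → ℝ) (G : Param d → Param d) (c : ℝ),
      IsLipschitzGradientExtension M.regularizer (nondegenerate v) R G ∧ ∀ x, c ≤ R x := by
  have hS := hS₀.inv
  have hS_symm : (M.S₀⁻¹)ᵀ = M.S₀⁻¹ := by simpa using hS.1.eq
  set κ : ℝ := Real.log M.S₀.det - d
  have regularizer_eq : M.regularizer = fun r => M.β / n * (1 / 2 * ((M.S₀⁻¹ * cov r).trace +
      ((mean r).ofLp - M.m₀.ofLp) ⬝ᵥ M.S₀⁻¹ *ᵥ ((mean r).ofLp - M.m₀.ofLp) + κ +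
      -Real.log (cov r).det)) := by
    ext r
    simp only [regularizer, gaussianKL, κ]
    ring
  have smooth_part := ((hasLipschitzGradient_trace_mul_cov M.S₀⁻¹).add
    (hasLipschitzGradient_quadratic M.m₀.ofLp hS.posSemidef)).add (HasLipschitzGradient.const κ)
  have extension := (((smooth_part.isLipschitzGradientExtension _).add
    (isLipschitzGradientExtension_neg_log_det_cov hv zero_le_one)).const_mul (1 / 2)).const_mul
    (M.β / n)
  obtain ⟨c, hc⟩ := exists_le_trace_mul_add_trace_cfc hS
    fun s hs => exists_le_mul_add_negLogExtension hv one_pos hs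
  refine ⟨_, _, M.β / n * (1 / 2 * (c + κ)), regularizer_eq ▸ extension, fun x => ?_⟩
  have trace_terms := hc _ (isHermitian_symmCov x)
  rw [trace_mul_symmCov hS_symm] at trace_terms
  have quadratic_nonneg := hS.posSemidef.dotProduct_mulVec_nonneg ((mean x).ofLp - M.m₀.ofLp)
  rw [star_trivial] at quadratic_nonneg
  gcongr M.β / n * (1 / 2 * ?_)
  linarith

/-- The data term `-(1/n) ∑ log 𝔼φᵢ` of the objective. -/
def dataTerm (M : Model n d) (r : Param d) : ℝ := 1 / (n : ℝ) * ∑ i, -Real.log (M.Eφ i r)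

theorem exists_extension_dataTerm (hb₂ : ∀ i, 0 ≤ M.b₂ i)
    (hlik : ∀ i, Differentiable ℝ (M.lik i)) (hlik' : ∀ i, Differentiable ℝ (deriv (M.lik i)))
    {B b' B' b'' B'' : ℝ} (hb : M.DerivBounds B b' B' b'' B'')
    {ζ v : ℝ} (hζ : 0 < ζ) (hv : 0 < v) :
    ∃ (Λ : Param d → ℝ) (G : Param d → Param d) (c : ℝ),
      IsLipschitzGradientExtension M.dataTerm (M.domain ζ v) Λ G ∧ (∀ x, c ≤ Λ x) ∧
      ∀ x ∈ M.domain ζ v, G x = -((1 / (n : ℝ)) • ∑ i, pack ((M.Eφ' i x / M.Eφ i x) • M.a₁ i)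
        ((M.Eφ'' i x / M.Eφ i x) • ((1 / 2 : ℝ) • Matrix.vecMulVec (M.a₂ i) (M.a₂ i)))) := by
  choose Φ D A hΦ hA hB hD using
    fun i => exists_extension_Eφ hb hv (hb₂ i) (hlik i) (hlik' i)
  have domain_subset : M.domain ζ v ⊆ nondegenerate v := fun _ h => h.1
  have extension := (IsLipschitzGradientExtension.sum Finset.univ fun i _ =>
    ((hΦ i).mono domain_subset).comp (φ := fun y => -Real.log y) (S := Set.Ici ζ)
      (hasDerivAt_negLogExtension hζ 0) (exists_lipschitzWith_negLogExtension_deriv hζ 0)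
      (abs_negLogExtension_zero_deriv_le hζ) (fun _ hy => negLogExtension_of_le 0 hy)
      (fun y hy => by
        have hy : ζ ≤ y := hy
        simpa [hy] using (Real.hasDerivAt_log (hζ.trans_le hy).ne').fun_neg)
      (hA i) fun x hx => hx.2 i).const_mul (1 / (n : ℝ))
  refine ⟨_, _, 1 / (n : ℝ) * ∑ _i : Fin n, negLogExtension ζ 0 B, extension, fun x => ?_,
    fun x hx => ?_⟩
  · gcongr with i
    exact antitone_negLogExtension hζ le_rfl (hB i x)
  · rw [← smul_neg, ← Finset.sum_neg_distrib]
    congr 1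
    refine Finset.sum_congr rfl fun i _ => ?_
    rw [(hΦ i).eqOn hx.1, hD i x hx.1, max_eq_left (hx.2 i), zero_mul, add_zero, neg_smul,
      ← pack_smul, smul_smul, smul_smul _ (M.Eφ'' i x), inv_mul_eq_div, inv_mul_eq_div]

/-- The gradient of the objective with the data term differentiated under the expectations; this is
the vector that the algorithm estimates by `-M.direction`. -/
def objectiveGradient (M : Model n d) (r : Param d) : Param d :=
  gradient M.regularizer r - (1 / (n : ℝ)) • ∑ i, pack ((M.Eφ' i r / M.Eφ i r) • M.a₁ i)
    ((M.Eφ'' i r / M.Eφ i r) • ((1 / 2 : ℝ) • Matrix.vecMulVec (M.a₂ i) (M.a₂ i)))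

theorem exists_extension_objective (hβ : 0 ≤ M.β) (hS₀ : M.S₀.PosDef)
    (hb₂ : ∀ i, 0 ≤ M.b₂ i) (hlik : ∀ i, Differentiable ℝ (M.lik i))
    (hlik' : ∀ i, Differentiable ℝ (deriv (M.lik i)))
    {B b' B' b'' B'' : ℝ} (hb : M.DerivBounds B b' B' b'' B'')
    {ζ v : ℝ} (hζ : 0 < ζ) (hv : 0 < v) :
    ∃ (Φ : Param d → ℝ) (F : Param d → Param d) (c : ℝ),
      IsLipschitzGradientExtension M.objective (M.domain ζ v) Φ F ∧ (∀ x, c ≤ Φ x) ∧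
      Set.EqOn F M.objectiveGradient (M.domain ζ v) := by
  obtain ⟨Λ, GΛ, cΛ, hΛ, hcΛ, hGΛ⟩ := exists_extension_dataTerm hb₂ hlik hlik' hb hζ hv
  obtain ⟨R, GR, cR, hR, hcR⟩ := exists_extension_regularizer hβ hS₀ hv
  refine ⟨_, _, cΛ + cR, hΛ.add (hR.mono fun _ h => h.1), fun x => add_le_add (hcΛ x) (hcR x),
    fun x hx => ?_⟩
  change GΛ x + GR x = _
  rw [objectiveGradient, (hR.hasGradientAt x hx.1).gradient, hGΛ x hx, neg_add_eq_sub]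

end Model

/-! ### Gradient descent with square-summable errors -/

theorem sum_range_le_of_le_sub_add {a b e : ℕ → ℝ} (h : ∀ t, a (t + 1) ≤ a t - b t + e t) (T : ℕ) :
    ∑ t ∈ Finset.range T, b t ≤ a 0 - a T + ∑ t ∈ Finset.range T, e t := by
  induction T with
  | zero => simp
  | succ T ih =>
    rw [Finset.sum_range_succ, Finset.sum_range_succ]
    linarith [h T]

theorem summable_of_le_sub_add {a b e : ℕ → ℝ} {c : ℝ} (ha : ∀ t, c ≤ a t) (hb : ∀ t, 0 ≤ b t)
    (he₀ : ∀ t, 0 ≤ e t) (he : Summable e) (h : ∀ t, a (t + 1) ≤ a t - b t + e t) :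
    Summable b := by
  refine summable_of_sum_range_le (c := a 0 - c + ∑' t, e t) hb fun T => ?_
  linarith [ha T, sum_range_le_of_le_sub_add h T, he.sum_le_tsum (Finset.range T) fun t _ => he₀ t]

theorem tendsto_of_le_add {a e : ℕ → ℝ} {c : ℝ} (ha : ∀ t, c ≤ a t)
    (he₀ : ∀ t, 0 ≤ e t) (he : Summable e) (h : ∀ t, a (t + 1) ≤ a t + e t) :
    ∃ l, Tendsto a atTop (𝓝 l) := by
  set b : ℕ → ℝ := fun t => a t - ∑ s ∈ Finset.range t, e s with hb
  have antitone_b : Antitone b := antitone_nat_of_succ_le fun t => by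
    simp only [hb, Finset.sum_range_succ]
    linarith [h t]
  have bddBelow_b : BddBelow (Set.range b) := by
    refine ⟨c - ∑' t, e t, ?_⟩
    rintro _ ⟨t, rfl⟩
    simp only [hb]
    linarith [ha t, he.sum_le_tsum (Finset.range t) fun t _ => he₀ t]
  refine ⟨_, ((tendsto_atTop_ciInf antitone_b bddBelow_b).add
    he.hasSum.tendsto_sum_nat).congr fun t => ?_⟩
  simp [hb]

theorem eq_zero_of_tendsto_of_summable_mul {u γ : ℕ → ℝ} {l : ℝ} (hl : Tendsto u atTop (𝓝 l))
    (hu : ∀ t, 0 ≤ u t) (hγ : ∀ t, 0 ≤ γ t) (hdiv : ¬Summable γ)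
    (hsum : Summable fun t => γ t * u t) : l = 0 := by
  by_contra hne
  have hpos : 0 < l := (ge_of_tendsto' hl hu).lt_of_ne' hne
  refine hdiv (Summable.of_norm_bounded_eventually_nat (hsum.mul_left (2 / l)) ?_)
  filter_upwards [hl.eventually_const_lt (half_lt_self hpos)] with t ht
  rw [Real.norm_of_nonneg (hγ t), div_mul_eq_mul_div, le_div_iff₀ hpos]
  linarith [mul_le_mul_of_nonneg_left ht.le (hγ t)]

section Descent

variable {E : Type*} [NormedAddCommGroup E]

theorem norm_smul_neg_add_sq_le [NormedSpace ℝ E] {γ : ℝ} (hγ : 0 ≤ γ) (hγ1 : γ ≤ 1) (y w : E) :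
    ‖γ • (-y + w)‖ ^ 2 ≤ 2 * (γ ^ 2 * ‖y‖ ^ 2) + 2 * ‖w‖ ^ 2 := by
  calc ‖γ • (-y + w)‖ ^ 2 = γ ^ 2 * ‖-y + w‖ ^ 2 := by
        rw [norm_smul, mul_pow, Real.norm_of_nonneg hγ]
    _ ≤ γ ^ 2 * (‖y‖ + ‖w‖) ^ 2 := by
        gcongr
        simpa using norm_add_le (-y) w
    _ ≤ γ ^ 2 * (2 * (‖y‖ ^ 2 + ‖w‖ ^ 2)) := by gcongr; exact add_sq_le
    _ ≤ 2 * (γ ^ 2 * ‖y‖ ^ 2) + 2 * ‖w‖ ^ 2 := by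
        linarith [mul_le_of_le_one_left (sq_nonneg ‖w‖) (pow_le_one₀ (n := 2) hγ hγ1)]

theorem norm_sq_le_of_gradient_step [NormedSpace ℝ E] {F : E → E} {K : ℝ≥0}
    (hK : LipschitzWith K F) {γ : ℝ} (hγ : 0 ≤ γ) (hγ1 : γ ≤ 1) (x w : E) :
    ‖F (x + γ • (-F x + w))‖ ^ 2 ≤ ‖F x‖ ^ 2 +
      ((3 * K + 2 * K ^ 2) * (γ * ‖F x‖ ^ 2) + (K + 2 * K ^ 2) * ‖w‖ ^ 2) := by
  set s := γ • (-F x + w) with hs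
  have norm_le : ‖F (x + s)‖ ≤ ‖F x‖ + K * ‖s‖ := by
    have hdist := hK.dist_le_mul (x + s) x
    rw [dist_eq_norm, dist_eq_norm, add_sub_cancel_left] at hdist
    linarith [norm_sub_norm_le (F (x + s)) (F x)]
  have step_sq_le : ‖s‖ ^ 2 ≤ 2 * (γ * ‖F x‖ ^ 2) + 2 * ‖w‖ ^ 2 := by
    refine (norm_smul_neg_add_sq_le hγ hγ1 _ _).trans ?_
    gcongr
    exact pow_le_of_le_one hγ hγ1 two_ne_zero
  have step_le : ‖s‖ ≤ γ * (‖F x‖ + ‖w‖) := by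
    rw [hs, norm_smul, Real.norm_of_nonneg hγ]
    gcongr
    simpa using norm_add_le (-F x) w
  have cross_le : 2 * (‖F x‖ * ‖s‖) ≤ 3 * (γ * ‖F x‖ ^ 2) + ‖w‖ ^ 2 := by
    calc 2 * (‖F x‖ * ‖s‖) ≤ 2 * (‖F x‖ * (γ * (‖F x‖ + ‖w‖))) := by gcongr
      _ = 2 * (γ * ‖F x‖ ^ 2) + γ * (2 * ‖F x‖ * ‖w‖) := by ring
      _ ≤ 2 * (γ * ‖F x‖ ^ 2) + γ * (‖F x‖ ^ 2 + ‖w‖ ^ 2) := by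
          gcongr
          exact two_mul_le_add_sq _ _
      _ ≤ 3 * (γ * ‖F x‖ ^ 2) + ‖w‖ ^ 2 := by
          linarith [mul_le_of_le_one_left (sq_nonneg ‖w‖) hγ1]
  calc ‖F (x + s)‖ ^ 2 ≤ (‖F x‖ + K * ‖s‖) ^ 2 := by gcongr
    _ = ‖F x‖ ^ 2 + (K * (2 * (‖F x‖ * ‖s‖)) + K ^ 2 * ‖s‖ ^ 2) := by ring
    _ ≤ ‖F x‖ ^ 2 + (K * (3 * (γ * ‖F x‖ ^ 2) + ‖w‖ ^ 2) +
          K ^ 2 * (2 * (γ * ‖F x‖ ^ 2) + 2 * ‖w‖ ^ 2)) := by gcongr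
    _ = _ := by ring

variable [InnerProductSpace ℝ E] [CompleteSpace E]

theorem le_of_gradient_step {f : E → ℝ} {F : E → E}
    (hf : ∀ x, HasGradientAt f (F x) x) {K : ℝ≥0} (hK : LipschitzWith K F) {γ : ℝ}
    (hγ : 0 ≤ γ) (hγ1 : γ ≤ 1) (hγK : (2 * K + 1 / 2) * γ ≤ 1 / 2) (x w : E) :
    f (x + γ • (-F x + w)) ≤ f x - 1 / 2 * (γ * ‖F x‖ ^ 2) + (1 / 2 + 2 * K) * ‖w‖ ^ 2 := by
  have quadratic_bound := le_add_inner_add_mul_norm_sq hf hK x (x + γ • (-F x + w))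
  rw [add_sub_cancel_left] at quadratic_bound
  have inner_le : inner ℝ (F x) (γ • (-F x + w)) ≤
      -(γ * ‖F x‖ ^ 2) + (1 / 2 * (γ ^ 2 * ‖F x‖ ^ 2) + 1 / 2 * ‖w‖ ^ 2) := by
    rw [inner_smul_right, inner_add_right, inner_neg_right, real_inner_self_eq_norm_sq]
    have := mul_le_mul_of_nonneg_left (real_inner_le_norm (F x) w) hγ
    linarith [two_mul_le_add_sq (γ * ‖F x‖) ‖w‖, mul_pow γ ‖F x‖ 2]
  have step_sq_le := mul_le_mul_of_nonneg_left
    (norm_smul_neg_add_sq_le hγ hγ1 (F x) w) K.coe_nonneg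
  have small_step := mul_le_mul_of_nonneg_right hγK (by positivity : 0 ≤ γ * ‖F x‖ ^ 2)
  linarith

theorem tendsto_of_gradient_descent_of_small {f : E → ℝ} {F : E → E}
    (hf : ∀ x, HasGradientAt f (F x) x) {K : ℝ≥0} (hK : LipschitzWith K F) (hf₀ : ∀ x, 0 ≤ f x)
    {x w : ℕ → E} {γ : ℕ → ℝ} (hγ : ∀ t, 0 ≤ γ t) (hγ1 : ∀ t, γ t ≤ 1)
    (hγK : ∀ t, (2 * K + 1 / 2) * γ t ≤ 1 / 2) (hdiv : ¬Summable γ)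
    (hw : Summable fun t => ‖w t‖ ^ 2)
    (hx : ∀ t, x (t + 1) = x t + γ t • (-F (x t) + w t)) :
    (∃ l, Tendsto (fun t => f (x t)) atTop (𝓝 l)) ∧
      Tendsto (fun t => F (x t)) atTop (𝓝 0) := by
  have progress_nonneg : ∀ t, 0 ≤ γ t * ‖F (x t)‖ ^ 2 := fun t =>
    mul_nonneg (hγ t) (sq_nonneg _)
  have descent : ∀ t, f (x (t + 1)) ≤
      f (x t) - 1 / 2 * (γ t * ‖F (x t)‖ ^ 2) + (1 / 2 + 2 * K) * ‖w t‖ ^ 2 := fun t => by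
    rw [hx]
    exact le_of_gradient_step hf hK (hγ t) (hγ1 t) (hγK t) _ _
  have growth : ∀ t, ‖F (x (t + 1))‖ ^ 2 ≤ ‖F (x t)‖ ^ 2 +
      ((3 * K + 2 * K ^ 2) * (γ t * ‖F (x t)‖ ^ 2) + (K + 2 * K ^ 2) * ‖w t‖ ^ 2) := fun t => by
    rw [hx]
    exact norm_sq_le_of_gradient_step hK (hγ t) (hγ1 t) _ _
  have summable_progress : Summable fun t => γ t * ‖F (x t)‖ ^ 2 := by
    simpa using (summable_of_le_sub_add (fun t => hf₀ (x t))
      (fun t => mul_nonneg one_half_pos.le (progress_nonneg t)) (fun t => by positivity)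
      (hw.mul_left _) descent).mul_left 2
  refine ⟨tendsto_of_le_add (e := fun t => (1 / 2 + 2 * K) * ‖w t‖ ^ 2) (fun t => hf₀ (x t))
    (fun t => by positivity) (hw.mul_left _)
    fun t => (descent t).trans (by linarith [progress_nonneg t]), ?_⟩
  obtain ⟨l, hl⟩ := tendsto_of_le_add (fun t => sq_nonneg ‖F (x t)‖)
    (fun t => add_nonneg (mul_nonneg (by positivity) (progress_nonneg t)) (by positivity))
    ((summable_progress.mul_left _).add (hw.mul_left _)) growth
  obtain rfl := eq_zero_of_tendsto_of_summable_mul hl (fun t => sq_nonneg _) hγ hdiv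
    summable_progress
  rw [tendsto_zero_iff_norm_tendsto_zero]
  simpa using hl.sqrt

theorem tendsto_of_gradient_descent {f : E → ℝ} {F : E → E} (hf : HasLipschitzGradient f F)
    (hf₀ : ∀ x, 0 ≤ f x) {x w : ℕ → E} {γ : ℕ → ℝ} (hγ : ∀ t, 0 ≤ γ t)
    (hdiv : ¬Summable γ) (hγsq : Summable fun t => γ t ^ 2) (hw : Summable fun t => ‖w t‖ ^ 2)
    (hx : ∀ t, x (t + 1) = x t + γ t • (-F (x t) + w t)) :
    (∃ l, Tendsto (fun t => f (x t)) atTop (𝓝 l)) ∧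
      Tendsto (fun t => F (x t)) atTop (𝓝 0) := by
  obtain ⟨K, hK⟩ := hf.lipschitz
  have tendsto_step : Tendsto γ atTop (𝓝 0) := by
    simpa [Real.sqrt_sq (hγ _)] using hγsq.tendsto_atTop_zero.sqrt
  have tendsto_mul_step : Tendsto (fun t => (2 * (K : ℝ) + 1 / 2) * γ t) atTop (𝓝 0) := by
    simpa using tendsto_step.const_mul (2 * (K : ℝ) + 1 / 2)
  obtain ⟨N, hN⟩ := eventually_atTop.1 ((tendsto_step.eventually_lt_const one_pos).and
    (tendsto_mul_step.eventually_lt_const one_half_pos))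
  obtain ⟨⟨l, hl⟩, hF⟩ := tendsto_of_gradient_descent_of_small hf.hasGradientAt hK hf₀
    (x := fun t => x (t + N)) (w := fun t => w (t + N)) (γ := fun t => γ (t + N))
    (fun t => hγ _) (fun t => (hN _ (Nat.le_add_left N t)).1.le)
    (fun t => (hN _ (Nat.le_add_left N t)).2.le)
    (fun h => hdiv ((summable_nat_add_iff N).1 h))
    ((summable_nat_add_iff (f := fun t => ‖w t‖ ^ 2) N).2 hw)
    (fun t => by rw [add_right_comm, hx])
  exact ⟨⟨l, (tendsto_add_atTop_iff_nat (f := fun t => f (x t)) N).1 hl⟩,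
    (tendsto_add_atTop_iff_nat (f := fun t => F (x t)) N).1 hF⟩

end Descent

/-! ### Monte Carlo averages -/

section MonteCarlo

open Model (avg)

theorem avg_nonneg {ψ : ℝ → ℝ} (h : ∀ x, 0 ≤ ψ x) (L : ℕ) (x : ℕ → ℝ) : 0 ≤ avg L x ψ :=
  mul_nonneg (by positivity) (Finset.sum_nonneg fun l _ => h (x l))

theorem avg_mem_Icc {L : ℕ} (hL : 0 < L) {ψ : ℝ → ℝ} {a b : ℝ} (h : ∀ x, ψ x ∈ Set.Icc a b)
    (x : ℕ → ℝ) : avg L x ψ ∈ Set.Icc a b := by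
  have cast_pos : (0 : ℝ) < L := by exact_mod_cast hL
  rw [avg, one_div_mul_eq_div, Set.mem_Icc, le_div_iff₀ cast_pos, div_le_iff₀ cast_pos]
  constructor
  · simpa [mul_comm a] using Finset.card_nsmul_le_sum (Finset.range L) _ a fun l _ => (h (x l)).1
  · simpa [mul_comm b] using Finset.sum_le_card_nsmul (Finset.range L) _ b fun l _ => (h (x l)).2

theorem abs_avg_le {L : ℕ} (hL : 0 < L) {ψ : ℝ → ℝ} {A : ℝ} (h : ∀ x, |ψ x| ≤ A) (x : ℕ → ℝ) :
    |avg L x ψ| ≤ A :=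
  abs_le.2 (avg_mem_Icc hL (fun y => abs_le.1 (h y)) x)

/-- The error of the smoothed Monte Carlo estimate, from the first `L` draws of `e`, of the ratio
of the `μ`-expectations of `q` and `p`; `ν` is the smoothing. -/
def ratioError (μ : Measure ℝ) (q p : ℝ → ℝ) (ν : ℝ) (L : ℕ) (e : ℕ → ℝ) : ℝ :=
  avg L e q / (avg L e p + ν) - (∫ x, q x ∂μ) / ∫ x, p x ∂μ

theorem abs_ratioError_le {μ : Measure ℝ} [IsProbabilityMeasure μ] {q p : ℝ → ℝ} {A ζ ν : ℝ}
    (hq : ∀ x, |q x| ≤ A) (hp : ∀ x, 0 ≤ p x) (hζ : 0 < ζ) (hα : ζ ≤ ∫ x, p x ∂μ) (hν : 0 < ν)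
    {L : ℕ} (hL : 0 < L) (e : ℕ → ℝ) : |ratioError μ q p ν L e| ≤ A / ν + A / ζ := by
  have A_nonneg : 0 ≤ A := (abs_nonneg _).trans (hq 0)
  have ν_le : ν ≤ avg L e p + ν := le_add_of_nonneg_left (avg_nonneg hp L e)
  refine (abs_sub _ _).trans ?_
  rw [abs_div, abs_div, abs_of_pos (hν.trans_le ν_le), abs_of_pos (hζ.trans_le hα)]
  gcongr
  · exact abs_avg_le hL hq e
  · exact abs_integral_le_of_abs_le hq

section Measurability

variable {α : Type*} {mα : MeasurableSpace α} {L : α → ℕ} {e : α → ℕ → ℝ}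

theorem measurable_avg (hL : Measurable L) (he : ∀ l, Measurable fun a => e a l)
    {ψ : α → ℝ → ℝ} (hψ : Measurable (Function.uncurry ψ)) :
    Measurable fun a => avg (L a) (e a) (ψ a) := by
  have measurable_uncurried : Measurable fun z : ℕ × α => avg z.1 (e z.2) (ψ z.2) := by
    refine measurable_from_prod_countable_right fun L => ?_
    have measurable_term : ∀ l, Measurable fun a => ψ a (e a l) := fun l =>
      hψ.comp (measurable_id.prodMk (he l))
    exact (Finset.measurable_fun_sum (Finset.range L) fun l _ => measurable_term l).const_mul
      (1 / (L : ℝ))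
  exact measurable_uncurried.comp (hL.prodMk measurable_id)

theorem measurable_ratioError {μ : Measure ℝ} [SFinite μ] (hL : Measurable L)
    (he : ∀ l, Measurable fun a => e a l) {q p : α → ℝ → ℝ} (hq : Measurable (Function.uncurry q))
    (hp : Measurable (Function.uncurry p)) (ν : ℝ) :
    Measurable fun a => ratioError μ (q a) (p a) ν (L a) (e a) :=
  ((measurable_avg hL he hq).div ((measurable_avg hL he hp).add_const ν)).sub
    (hq.stronglyMeasurable.integral_prod_right.measurable.div
      hp.stronglyMeasurable.integral_prod_right.measurable)

end Measurability

theorem sq_sub_sub_le (x y z : ℝ) : (x - y - z) ^ 2 ≤ 3 * (x ^ 2 + y ^ 2 + z ^ 2) := by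
  nlinarith [sq_nonneg (x + y), sq_nonneg (x + z), sq_nonneg (y - z)]

theorem sq_div_sub_div_le {a a' α α' ζ A γ : ℝ} (hζ : 0 < ζ) (hα : ζ ≤ α) (hγ : 0 ≤ γ)
    (ha : α / 2 ≤ a) (hα' : |α'| ≤ A) :
    (a' / (a + γ * ζ) - α' / α) ^ 2 ≤
      12 / ζ ^ 2 * (a' - α') ^ 2 + 12 * A ^ 2 / ζ ^ 4 * (a - α) ^ 2 +
        12 * A ^ 2 / ζ ^ 2 * γ ^ 2 := by
  have α_pos : 0 < α := hζ.trans_le hα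
  have denom_ge : ζ / 2 ≤ a + γ * ζ := by linarith [mul_nonneg hγ hζ.le]
  have denom_pos : 0 < a + γ * ζ := (half_pos hζ).trans_le denom_ge
  have ratio_sq_le : (α' / α) ^ 2 ≤ (A / ζ) ^ 2 := by
    rw [← sq_abs (α' / α), abs_div, abs_of_pos α_pos]
    have : 0 ≤ A := (abs_nonneg _).trans hα'
    gcongr
  have error_eq : a' / (a + γ * ζ) - α' / α =
      ((a' - α') - α' / α * (a - α) - α' / α * (γ * ζ)) / (a + γ * ζ) := by
    field_simp
    ring
  calc (a' / (a + γ * ζ) - α' / α) ^ 2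
      ≤ 3 * ((a' - α') ^ 2 + (α' / α * (a - α)) ^ 2 + (α' / α * (γ * ζ)) ^ 2) / (ζ / 2) ^ 2 := by
        rw [error_eq, div_pow]
        gcongr
        exact sq_sub_sub_le _ _ _
    _ ≤ 3 * ((a' - α') ^ 2 + (A / ζ) ^ 2 * (a - α) ^ 2 + (A / ζ) ^ 2 * (γ * ζ) ^ 2) /
          (ζ / 2) ^ 2 := by
        rw [mul_pow (α' / α), mul_pow (α' / α)]
        gcongr
    _ = _ := by
        field_simp
        ring

theorem exp_neg_le_two_div_sq {x : ℝ} (hx : 0 < x) : Real.exp (-x) ≤ 2 / x ^ 2 := by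
  rw [Real.exp_neg, le_div_iff₀ (by positivity), inv_mul_le_iff₀ (Real.exp_pos x)]
  linarith [Real.quadratic_le_exp_of_nonneg hx.le]

variable {Ω : Type*} [MeasurableSpace Ω] {P : Measure Ω} {μ : Measure ℝ} {e : ℕ → Ω → ℝ}
  {L : ℕ} {ψ p q : ℝ → ℝ} {a b A B D ζ γ : ℝ}

/-- Under `P`, the random variables `e 0, e 1, …` are independent with common law `μ`. -/
structure IsIIDSample (P : Measure Ω) (μ : Measure ℝ) (e : ℕ → Ω → ℝ) : Prop where
  measurable : ∀ l, Measurable (e l)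
  map_eq : ∀ l, P.map (e l) = μ
  iIndepFun : iIndepFun e P

namespace IsIIDSample

theorem integral_comp (he : IsIIDSample P μ e) (hψ : Measurable ψ) (l : ℕ) :
    ∫ ω, ψ (e l ω) ∂P = ∫ x, ψ x ∂μ := by
  rw [← he.map_eq l, integral_map (he.measurable l).aemeasurable hψ.aestronglyMeasurable]

theorem measurable_avg (he : IsIIDSample P μ e) (hψ : Measurable ψ) :
    Measurable fun ω => avg L (fun l => e l ω) ψ :=
  SmoothBMC.measurable_avg measurable_const he.measurable (hψ.comp measurable_snd)

variable [IsProbabilityMeasure P]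

theorem isProbabilityMeasure (he : IsIIDSample P μ e) : IsProbabilityMeasure μ :=
  he.map_eq 0 ▸ Measure.isProbabilityMeasure_map (he.measurable 0).aemeasurable

theorem memLp_comp (he : IsIIDSample P μ e) (hψ : Measurable ψ) (h : ∀ x, ψ x ∈ Set.Icc a b)
    (l : ℕ) : MemLp (fun ω => ψ (e l ω)) 2 P :=
  MemLp.of_bound (hψ.comp (he.measurable l)).aestronglyMeasurable (max |a| |b|)
    (ae_of_all _ fun _ => abs_le_max_abs_abs (h _).1 (h _).2)

theorem integrable_avg_sub_sq (he : IsIIDSample P μ e) (hL : 0 < L) (hψ : Measurable ψ)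
    (h : ∀ x, ψ x ∈ Set.Icc a b) (c : ℝ) :
    Integrable (fun ω => (avg L (fun l => e l ω) ψ - c) ^ 2) P := by
  have memLp_avg : MemLp (fun ω => avg L (fun l => e l ω) ψ) 2 P :=
    MemLp.of_bound (he.measurable_avg hψ).aestronglyMeasurable (max |a| |b|)
      (ae_of_all _ fun _ => abs_le_max_abs_abs (avg_mem_Icc hL h _).1 (avg_mem_Icc hL h _).2)
  exact (memLp_avg.sub (memLp_const c)).integrable_sq

theorem integral_avg (he : IsIIDSample P μ e) (hL : 0 < L) (hψ : Measurable ψ)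
    (h : ∀ x, ψ x ∈ Set.Icc a b) : ∫ ω, avg L (fun l => e l ω) ψ ∂P = ∫ x, ψ x ∂μ := by
  have : (L : ℝ) ≠ 0 := by exact_mod_cast hL.ne'
  unfold avg
  rw [integral_const_mul,
    integral_finsetSum _ fun l _ => (he.memLp_comp hψ h l).integrable one_le_two]
  simp_rw [he.integral_comp hψ]
  rw [Finset.sum_const, Finset.card_range, nsmul_eq_mul]
  field_simp

theorem integral_avg_sub_sq_le (he : IsIIDSample P μ e) (hL : 0 < L) (hψ : Measurable ψ)
    (h : ∀ x, ψ x ∈ Set.Icc a b) :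
    ∫ ω, (avg L (fun l => e l ω) ψ - ∫ x, ψ x ∂μ) ^ 2 ∂P ≤ (b - a) ^ 2 / (4 * L) := by
  have : (0 : ℝ) < L := by exact_mod_cast hL
  have avg_eq : (fun ω => avg L (fun l => e l ω) ψ) =
      fun ω => 1 / (L : ℝ) * (∑ l ∈ Finset.range L, fun ω => ψ (e l ω)) ω := by
    ext ω
    simp [avg]
  have pairwise_indep : Set.Pairwise (Finset.range L : Set ℕ)
      fun i j => IndepFun (fun ω => ψ (e i ω)) (fun ω => ψ (e j ω)) P := fun i _ j _ hij =>
    (he.iIndepFun.indepFun hij).comp hψ hψ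
  calc ∫ ω, (avg L (fun l => e l ω) ψ - ∫ x, ψ x ∂μ) ^ 2 ∂P
      = variance (fun ω => avg L (fun l => e l ω) ψ) P := by
        rw [variance_eq_integral (he.measurable_avg hψ).aemeasurable, he.integral_avg hL hψ h]
    _ = (1 / (L : ℝ)) ^ 2 * ∑ l ∈ Finset.range L, variance (fun ω => ψ (e l ω)) P := by
        rw [avg_eq, variance_const_mul,
          IndepFun.variance_sum (fun l _ => he.memLp_comp hψ h l) pairwise_indep]
    _ ≤ (1 / (L : ℝ)) ^ 2 * ∑ _l ∈ Finset.range L, ((b - a) / 2) ^ 2 := by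
        gcongr with l
        exact variance_le_sq_of_bounded (ae_of_all _ fun ω => h (e l ω))
          (hψ.comp (he.measurable l)).aemeasurable
    _ = (b - a) ^ 2 / (4 * L) := by
        rw [Finset.sum_const, Finset.card_range, nsmul_eq_mul]
        field_simp
        norm_num

theorem integral_avg_sub_sq_le_of_sq_le (he : IsIIDSample P μ e) (hL : 0 < L) (hψ : Measurable ψ)
    (h : ∀ x, ψ x ∈ Set.Icc a b) (hLD : (b - a) ^ 2 ≤ 2 * γ ^ 2 * D ^ 2 * L) :
    ∫ ω, (avg L (fun l => e l ω) ψ - ∫ x, ψ x ∂μ) ^ 2 ∂P ≤ D ^ 2 * γ ^ 2 := by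
  refine (he.integral_avg_sub_sq_le hL hψ h).trans ?_
  have : (0 : ℝ) < L := by exact_mod_cast hL
  rw [div_le_iff₀ (by positivity)]
  linarith [mul_nonneg (mul_nonneg (sq_nonneg γ) (sq_nonneg D)) this.le]

theorem measureReal_avg_le_half_le_exp (he : IsIIDSample P μ e) (hL : 0 < L) (hp : Measurable p)
    (h : ∀ x, p x ∈ Set.Icc 0 B) (hB : 0 < B) :
    P.real {ω | avg L (fun l => e l ω) p ≤ (∫ x, p x ∂μ) / 2} ≤
      Real.exp (-(L * (∫ x, p x ∂μ) ^ 2 / (2 * B ^ 2))) := by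
  have : IsProbabilityMeasure μ := he.isProbabilityMeasure
  set α := ∫ x, p x ∂μ with hα
  have cast_pos : (0 : ℝ) < L := by exact_mod_cast hL
  have α_nonneg : 0 ≤ α := integral_nonneg fun x => (h x).1
  have subgaussian : ∀ l < L,
      HasSubgaussianMGF (fun ω => -(p (e l ω) - α)) ((‖B - 0‖₊ / 2) ^ 2) P := fun l _ => by
    rw [hα, ← he.integral_comp hp l]
    exact (hasSubgaussianMGF_of_mem_Icc (hp.comp (he.measurable l)).aemeasurable
      (ae_of_all _ fun ω => h (e l ω))).neg
  have indep : ProbabilityTheory.iIndepFun (fun l ω => -(p (e l ω) - α)) P :=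
    he.iIndepFun.comp (fun _ x => -(p x - α)) fun _ => by fun_prop
  have event_eq : {ω | avg L (fun l => e l ω) p ≤ α / 2} =
      {ω | (L : ℝ) * α / 2 ≤ ∑ l ∈ Finset.range L, -(p (e l ω) - α)} := by
    ext ω
    simp only [Set.mem_ofPred_eq, avg]
    rw [Finset.sum_neg_distrib, Finset.sum_sub_distrib, Finset.sum_const, Finset.card_range,
      nsmul_eq_mul, div_mul_eq_mul_div, one_mul, div_le_iff₀ cast_pos]
    constructor <;> intro h <;> linarith
  rw [event_eq]
  refine (HasSubgaussianMGF.measure_sum_range_ge_le_of_iIndepFun indep subgaussian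
    (by positivity : 0 ≤ (L : ℝ) * α / 2)).trans_eq ?_
  congr 1
  simp only [sub_zero, NNReal.coe_pow, NNReal.coe_div, coe_nnnorm, Real.norm_eq_abs,
    NNReal.coe_ofNat, abs_of_pos hB]
  field_simp

theorem measureReal_avg_le_half_le (he : IsIIDSample P μ e) (hL : 0 < L) (hp : Measurable p)
    (h : ∀ x, p x ∈ Set.Icc 0 B) (hB : 0 < B) (hγ : 0 < γ)
    (hLp : B ^ 2 ≤ 2 * γ ^ 2 * (∫ x, p x ∂μ) ^ 2 * L) :
    P.real {ω | avg L (fun l => e l ω) p ≤ (∫ x, p x ∂μ) / 2} ≤ 32 * γ ^ 4 := by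
  have exponent_ge : 1 / (4 * γ ^ 2) ≤ L * (∫ x, p x ∂μ) ^ 2 / (2 * B ^ 2) := by
    rw [div_le_div_iff₀ (by positivity) (by positivity)]
    linarith
  calc P.real {ω | avg L (fun l => e l ω) p ≤ (∫ x, p x ∂μ) / 2}
      ≤ Real.exp (-(1 / (4 * γ ^ 2))) :=
        (he.measureReal_avg_le_half_le_exp hL hp h hB).trans
          (Real.exp_le_exp.2 (neg_le_neg exponent_ge))
    _ ≤ 2 / (1 / (4 * γ ^ 2)) ^ 2 := exp_neg_le_two_div_sq (by positivity)
    _ = 32 * γ ^ 4 := by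
        field_simp
        norm_num

theorem integrable_ratioError_sq (he : IsIIDSample P μ e) (hL : 0 < L) (hq : Measurable q)
    (hp : Measurable p) (hqA : ∀ x, |q x| ≤ A) (hp₀ : ∀ x, 0 ≤ p x) (hζ : 0 < ζ)
    (hα : ζ ≤ ∫ x, p x ∂μ) {ν : ℝ} (hν : 0 < ν) :
    Integrable (fun ω => ratioError μ q p ν L (fun l => e l ω) ^ 2) P :=
  have := he.isProbabilityMeasure
  (MemLp.of_bound (measurable_ratioError measurable_const he.measurable
    (q := fun _ => q) (p := fun _ => p) (hq.comp measurable_snd) (hp.comp measurable_snd)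
    ν).aestronglyMeasurable _ (ae_of_all _ fun _ =>
      abs_ratioError_le hqA hp₀ hζ hα hν hL _)).integrable_sq

end IsIIDSample

theorem ratioError_sq_le [IsProbabilityMeasure μ] (hL : 0 < L) (hqA : ∀ x, |q x| ≤ A)
    (hp₀ : ∀ x, 0 ≤ p x) (hζ : 0 < ζ) (hα : ζ ≤ ∫ x, p x ∂μ) (hγ : 0 < γ) (hγ1 : γ ≤ 1)
    (e : ℕ → ℝ) :
    ratioError μ q p (γ * ζ) L e ^ 2 ≤ 12 / ζ ^ 2 * (avg L e q - ∫ x, q x ∂μ) ^ 2 +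
      12 * A ^ 2 / ζ ^ 4 * (avg L e p - ∫ x, p x ∂μ) ^ 2 + 12 * A ^ 2 / ζ ^ 2 * γ ^ 2 +
      if avg L e p ≤ (∫ x, p x ∂μ) / 2 then 4 * A ^ 2 / (γ ^ 2 * ζ ^ 2) else 0 := by
  split_ifs with hsmall
  · have A_nonneg : 0 ≤ A := (abs_nonneg _).trans (hqA 0)
    have error_le : |ratioError μ q p (γ * ζ) L e| ≤ 2 * A / (γ * ζ) := by
      refine (abs_ratioError_le hqA hp₀ hζ hα (mul_pos hγ hζ) hL e).trans ?_
      have : A / ζ ≤ A / (γ * ζ) := by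
        gcongr
        exact mul_le_of_le_one_left hζ.le hγ1
      rw [mul_div_assoc]
      linarith
    calc ratioError μ q p (γ * ζ) L e ^ 2 ≤ (2 * A / (γ * ζ)) ^ 2 := by
          rw [← sq_abs]
          gcongr
      _ = 4 * A ^ 2 / (γ ^ 2 * ζ ^ 2) := by ring
      _ ≤ _ := le_add_of_nonneg_left (by positivity)
  · rw [add_zero]
    exact sq_div_sub_div_le hζ hα hγ.le (not_le.1 hsmall).le (abs_integral_le_of_abs_le hqA)

/-- The constant in the bound of the mean squared `ratioError` by the squared step size, where
`0 ≤ p ≤ B`, `|q| ≤ A`, the expectation of `p` is at least `ζ`, and the sample size makes the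
standard deviation of the average of `q` at most the step size times `D`. -/
def ratioErrorConst (A B D ζ : ℝ) : ℝ :=
  12 * D ^ 2 / ζ ^ 2 + 12 * A ^ 2 * B ^ 2 / ζ ^ 4 + 140 * A ^ 2 / ζ ^ 2

theorem ratioErrorConst_nonneg (A B D ζ : ℝ) : 0 ≤ ratioErrorConst A B D ζ := by
  unfold ratioErrorConst
  positivity

namespace IsIIDSample

variable [IsProbabilityMeasure P]

theorem integral_ratioError_sq_le_of_le_one (he : IsIIDSample P μ e) (hL : 0 < L)
    (hp : Measurable p) (hq : Measurable q) (hpB : ∀ x, p x ∈ Set.Icc 0 B)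
    (hqab : ∀ x, q x ∈ Set.Icc a b) (hqA : ∀ x, |q x| ≤ A) (hζ : 0 < ζ) (hα : ζ ≤ ∫ x, p x ∂μ)
    (hγ : 0 < γ) (hγ1 : γ ≤ 1) (hLp : B ^ 2 ≤ 2 * γ ^ 2 * (∫ x, p x ∂μ) ^ 2 * L)
    (hLq : (b - a) ^ 2 ≤ 2 * γ ^ 2 * D ^ 2 * L) :
    ∫ ω, ratioError μ q p (γ * ζ) L (fun l => e l ω) ^ 2 ∂P ≤
      ratioErrorConst A B D ζ * γ ^ 2 := by
  have : IsProbabilityMeasure μ := he.isProbabilityMeasure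
  have p_nonneg : ∀ x, 0 ≤ p x := fun x => (hpB x).1
  have mean_le : ∫ x, p x ∂μ ≤ B := integral_le_of_nonneg_of_le p_nonneg fun x => (hpB x).2
  have mean_pos : 0 < ∫ x, p x ∂μ := hζ.trans_le hα
  set S := {ω | avg L (fun l => e l ω) p ≤ (∫ x, p x ∂μ) / 2}
  have measurableSet_S : MeasurableSet S :=
    measurableSet_le (he.measurable_avg hp) measurable_const
  have integrable_q := (he.integrable_avg_sub_sq hL hq hqab (∫ x, q x ∂μ)).const_mul (12 / ζ ^ 2)
  have integrable_p := (he.integrable_avg_sub_sq hL hp hpB (∫ x, p x ∂μ)).const_mul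
    (12 * A ^ 2 / ζ ^ 4)
  have integrable_S : Integrable (S.indicator fun _ => 4 * A ^ 2 / (γ ^ 2 * ζ ^ 2)) P :=
    (integrable_const _).indicator measurableSet_S
  calc ∫ ω, ratioError μ q p (γ * ζ) L (fun l => e l ω) ^ 2 ∂P
      ≤ ∫ ω, (12 / ζ ^ 2 * (avg L (fun l => e l ω) q - ∫ x, q x ∂μ) ^ 2 +
          12 * A ^ 2 / ζ ^ 4 * (avg L (fun l => e l ω) p - ∫ x, p x ∂μ) ^ 2 +
          12 * A ^ 2 / ζ ^ 2 * γ ^ 2 +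
          S.indicator (fun _ => 4 * A ^ 2 / (γ ^ 2 * ζ ^ 2)) ω) ∂P :=
        integral_mono (he.integrable_ratioError_sq hL hq hp hqA p_nonneg hζ hα (mul_pos hγ hζ))
          (((integrable_q.add integrable_p).add (integrable_const _)).add integrable_S)
          fun ω => ratioError_sq_le hL hqA p_nonneg hζ hα hγ hγ1 _
    _ = 12 / ζ ^ 2 * ∫ ω, (avg L (fun l => e l ω) q - ∫ x, q x ∂μ) ^ 2 ∂P +
          12 * A ^ 2 / ζ ^ 4 * ∫ ω, (avg L (fun l => e l ω) p - ∫ x, p x ∂μ) ^ 2 ∂P +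
          12 * A ^ 2 / ζ ^ 2 * γ ^ 2 + P.real S * (4 * A ^ 2 / (γ ^ 2 * ζ ^ 2)) := by
        simp (disch := fun_prop) only [integral_add, integral_const_mul]
        rw [integral_indicator_const _ measurableSet_S, integral_const, probReal_univ, one_smul,
          smul_eq_mul]
    _ ≤ 12 / ζ ^ 2 * (D ^ 2 * γ ^ 2) + 12 * A ^ 2 / ζ ^ 4 * (B ^ 2 * γ ^ 2) +
          12 * A ^ 2 / ζ ^ 2 * γ ^ 2 + 32 * γ ^ 4 * (4 * A ^ 2 / (γ ^ 2 * ζ ^ 2)) := by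
        gcongr
        · exact he.integral_avg_sub_sq_le_of_sq_le hL hq hqab hLq
        · refine (he.integral_avg_sub_sq_le_of_sq_le hL hp hpB (by rwa [sub_zero])).trans ?_
          gcongr
        · exact he.measureReal_avg_le_half_le hL hp hpB (mean_pos.trans_le mean_le) hγ hLp
    _ = ratioErrorConst A B D ζ * γ ^ 2 := by
        unfold ratioErrorConst
        field_simp
        ring

theorem integral_ratioError_sq_le_of_one_le (he : IsIIDSample P μ e) (hL : 0 < L)
    (hqA : ∀ x, |q x| ≤ A) (hp₀ : ∀ x, 0 ≤ p x) (hζ : 0 < ζ) (hα : ζ ≤ ∫ x, p x ∂μ)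
    (hγ1 : 1 ≤ γ) :
    ∫ ω, ratioError μ q p (γ * ζ) L (fun l => e l ω) ^ 2 ∂P ≤
      ratioErrorConst A B D ζ * γ ^ 2 := by
  have : IsProbabilityMeasure μ := he.isProbabilityMeasure
  have A_nonneg : 0 ≤ A := (abs_nonneg _).trans (hqA 0)
  have error_le : ∀ e, ratioError μ q p (γ * ζ) L e ^ 2 ≤ (2 * A / ζ) ^ 2 := fun e => by
    rw [← sq_abs]
    gcongr
    refine (abs_ratioError_le hqA hp₀ hζ hα (by positivity) hL e).trans ?_
    have : A / (γ * ζ) ≤ A / ζ := by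
      gcongr
      exact le_mul_of_one_le_left hζ.le hγ1
    rw [mul_div_assoc]
    linarith
  calc ∫ ω, ratioError μ q p (γ * ζ) L (fun l => e l ω) ^ 2 ∂P ≤ (2 * A / ζ) ^ 2 :=
        integral_le_of_nonneg_of_le (fun _ => sq_nonneg _) fun _ => error_le _
    _ = 4 * A ^ 2 / ζ ^ 2 := by ring
    _ ≤ 140 * A ^ 2 / ζ ^ 2 := by gcongr; norm_num
    _ ≤ ratioErrorConst A B D ζ := le_add_of_nonneg_left (by positivity)
    _ ≤ ratioErrorConst A B D ζ * γ ^ 2 :=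
        le_mul_of_one_le_right (ratioErrorConst_nonneg _ _ _ _) (one_le_pow₀ hγ1)

theorem integral_ratioError_sq_le (he : IsIIDSample P μ e) (hL : 0 < L)
    (hp : Measurable p) (hq : Measurable q) (hpB : ∀ x, p x ∈ Set.Icc 0 B)
    (hqab : ∀ x, q x ∈ Set.Icc a b) (hqA : ∀ x, |q x| ≤ A) (hζ : 0 < ζ) (hα : ζ ≤ ∫ x, p x ∂μ)
    (hγ : 0 < γ) (hLp : γ ≤ 1 → B ^ 2 ≤ 2 * γ ^ 2 * (∫ x, p x ∂μ) ^ 2 * L)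
    (hLq : γ ≤ 1 → (b - a) ^ 2 ≤ 2 * γ ^ 2 * D ^ 2 * L) :
    ∫ ω, ratioError μ q p (γ * ζ) L (fun l => e l ω) ^ 2 ∂P ≤
      ratioErrorConst A B D ζ * γ ^ 2 := by
  rcases le_total γ 1 with hγ1 | hγ1
  · exact he.integral_ratioError_sq_le_of_le_one hL hp hq hpB hqab hqA hζ hα hγ hγ1
      (hLp hγ1) (hLq hγ1)
  · exact he.integral_ratioError_sq_le_of_one_le hL hqA (fun x => (hpB x).1) hζ hα hγ1

end IsIIDSample

end MonteCarlo

/-! ### Conditioning on the history -/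

section Conditioning

variable {Ω : Type*} {m mΩ : MeasurableSpace Ω} {P : Measure Ω}

theorem map_restrict_prodMk_of_indep [IsProbabilityMeasure P] {S T : Type*}
    [MeasurableSpace S] [mT : MeasurableSpace T] (hm : m ≤ mΩ) {X : Ω → S} {Y : Ω → T}
    (hX : Measurable[m] X) (hY : Measurable Y) (hind : Indep (mT.comap Y) m P)
    {A : Set Ω} (hA : MeasurableSet[m] A) :
    (P.restrict A).map (fun ω => (X ω, Y ω)) = ((P.restrict A).map X).prod (P.map Y) := by
  have hX' : Measurable X := hX.mono hm le_rfl
  have : IsProbabilityMeasure (P.map Y) := Measure.isProbabilityMeasure_map hY.aemeasurable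
  refine (Measure.prod_eq fun s t hs ht => ?_).symm
  rw [Measure.map_apply (hX'.prodMk hY) (hs.prod ht), Measure.map_apply hX' hs,
    Measure.map_apply hY ht, Measure.restrict_apply ((hX'.prodMk hY) (hs.prod ht)),
    Measure.restrict_apply (hX' hs), mul_comm,
    ← (Indep_iff _ _ P).1 hind _ _ ⟨t, ht, rfl⟩ ((hX hs).inter hA)]
  congr 1
  ext ω
  simp only [Set.mem_inter_iff, Set.mem_preimage, Set.mem_prod]
  tauto

theorem setIntegral_le_of_indep [IsProbabilityMeasure P] {S T : Type*} [MeasurableSpace S]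
    [mT : MeasurableSpace T] (hm : m ≤ mΩ) {X : Ω → S} {Y : Ω → T}
    (hX : Measurable[m] X) (hY : Measurable Y) (hind : Indep (mT.comap Y) m P)
    {Ψ : S × T → ℝ} (hΨ : Measurable Ψ)
    (hint : Integrable (fun ω => Ψ (X ω, Y ω)) P) {c : ℝ}
    (h : ∀ᵐ ω ∂P, ∫ ω', Ψ (X ω, Y ω') ∂P ≤ c) {A : Set Ω} (hA : MeasurableSet[m] A) :
    ∫ ω in A, Ψ (X ω, Y ω) ∂P ≤ c * P.real A := by
  have hX' : Measurable X := hX.mono hm le_rfl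
  have law := map_restrict_prodMk_of_indep hm hX hY hind hA
  have integrable_prod : Integrable Ψ (((P.restrict A).map X).prod (P.map Y)) := by
    rw [← law]
    exact (integrable_map_measure hΨ.aestronglyMeasurable (hX'.prodMk hY).aemeasurable).2
      hint.integrableOn
  have integral_fiber : ∀ x, ∫ y, Ψ (x, y) ∂P.map Y = ∫ ω', Ψ (x, Y ω') ∂P := fun x =>
    integral_map hY.aemeasurable (hΨ.comp measurable_prodMk_left).aestronglyMeasurable
  have integrable_fiber := integrable_prod.integral_prod_left
  simp only [integral_fiber] at integrable_fiber
  calc ∫ ω in A, Ψ (X ω, Y ω) ∂P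
      = ∫ z, Ψ z ∂(((P.restrict A).map X).prod (P.map Y)) := by
        rw [← law, integral_map (hX'.prodMk hY).aemeasurable hΨ.aestronglyMeasurable]
    _ = ∫ ω in A, ∫ ω', Ψ (X ω, Y ω') ∂P ∂P := by
        rw [integral_prod _ integrable_prod]
        simp only [integral_fiber]
        exact integral_map hX'.aemeasurable integrable_fiber.aestronglyMeasurable
    _ ≤ ∫ _ω in A, c ∂P :=
        setIntegral_mono_ae (integrable_fiber.comp_measurable hX') (integrable_const c) h
    _ = c * P.real A := by rw [setIntegral_const, smul_eq_mul, mul_comm]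

theorem condExp_le_of_setIntegral_le [IsFiniteMeasure P] (hm : m ≤ mΩ) {W : Ω → ℝ}
    (hW : Integrable W P) {c : ℝ}
    (h : ∀ A, MeasurableSet[m] A → ∫ ω in A, W ω ∂P ≤ c * P.real A) :
    ∀ᵐ ω ∂P, (P[W|m]) ω ≤ c := by
  have integrable_trim : Integrable (P[W|m]) (P.trim hm) :=
    integrable_condExp.trim hm stronglyMeasurable_condExp
  refine ae_le_of_ae_le_trim (hm := hm) (f₂ := fun _ => c)
    (ae_le_of_forall_setIntegral_le integrable_trim (integrable_const c) fun A hA _ => ?_)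
  rw [← setIntegral_trim hm stronglyMeasurable_condExp hA,
    ← setIntegral_trim hm stronglyMeasurable_const hA, setIntegral_condExp hm hW hA,
    setIntegral_const, smul_eq_mul, mul_comm]
  exact h A hA

/-- `W` is integrable and its conditional expectation given `m` is almost surely at most `c`. -/
structure HasCondExpLE (P : Measure Ω) (m : MeasurableSpace Ω) (W : Ω → ℝ) (c : ℝ) : Prop where
  integrable : Integrable W P
  condExp_le : ∀ᵐ ω ∂P, (P[W|m]) ω ≤ c

namespace HasCondExpLE

variable {W Z : Ω → ℝ} {c c' : ℝ}

theorem of_indep [IsProbabilityMeasure P] {S T : Type*} [MeasurableSpace S]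
    [mT : MeasurableSpace T] (hm : m ≤ mΩ) {X : Ω → S} {Y : Ω → T}
    (hX : Measurable[m] X) (hY : Measurable Y) (hind : Indep (mT.comap Y) m P)
    {Ψ : S × T → ℝ} (hΨ : Measurable Ψ)
    (hint : Integrable (fun ω => Ψ (X ω, Y ω)) P)
    (h : ∀ᵐ ω ∂P, ∫ ω', Ψ (X ω, Y ω') ∂P ≤ c) : HasCondExpLE P m (fun ω => Ψ (X ω, Y ω)) c :=
  ⟨hint, condExp_le_of_setIntegral_le hm hint fun _ hA =>
    setIntegral_le_of_indep hm hX hY hind hΨ hint h hA⟩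

theorem mono (hZ : HasCondExpLE P m Z c) (hW : AEStronglyMeasurable W P)
    (h₀ : ∀ᵐ ω ∂P, 0 ≤ W ω) (h : ∀ᵐ ω ∂P, W ω ≤ Z ω) : HasCondExpLE P m W c := by
  have integrable_W : Integrable W P := hZ.integrable.mono' hW (by
    filter_upwards [h₀, h] with ω hω₀ hω
    rwa [Real.norm_of_nonneg hω₀])
  refine ⟨integrable_W, ?_⟩
  filter_upwards [hZ.condExp_le, condExp_mono integrable_W hZ.integrable h] with ω hZω hω
  exact hω.trans hZω

theorem const_mul (hW : HasCondExpLE P m W c) {k : ℝ} (hk : 0 ≤ k) :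
    HasCondExpLE P m (fun ω => k * W ω) (k * c) := by
  refine ⟨hW.integrable.const_mul k, ?_⟩
  filter_upwards [hW.condExp_le, condExp_smul (μ := P) k W m] with ω hω heq
  exact heq.trans_le (mul_le_mul_of_nonneg_left hω hk)

theorem add (hW : HasCondExpLE P m W c) (hZ : HasCondExpLE P m Z c') :
    HasCondExpLE P m (fun ω => W ω + Z ω) (c + c') := by
  refine ⟨hW.integrable.add hZ.integrable, ?_⟩
  filter_upwards [hW.condExp_le, hZ.condExp_le, condExp_add hW.integrable hZ.integrable m]
    with ω hWω hZω heq
  exact heq.trans_le (add_le_add hWω hZω)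

theorem sum {ι : Type*} (s : Finset ι) {W : ι → Ω → ℝ} {c : ι → ℝ}
    (hW : ∀ i ∈ s, HasCondExpLE P m (W i) (c i)) :
    HasCondExpLE P m (fun ω => ∑ i ∈ s, W i ω) (∑ i ∈ s, c i) := by
  classical
  induction s using Finset.induction_on with
  | empty => exact ⟨by simp, by simp⟩
  | insert i s hi ih =>
    simp only [Finset.sum_insert hi]
    exact (hW i (Finset.mem_insert_self i s)).add
      (ih fun j hj => hW j (Finset.mem_insert_of_mem hj))

theorem integral_le [IsProbabilityMeasure P] (hm : m ≤ mΩ) (hW : HasCondExpLE P m W c) :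
    ∫ ω, W ω ∂P ≤ c := by
  rw [← integral_condExp hm]
  refine (integral_mono_ae integrable_condExp (integrable_const c) hW.condExp_le).trans_eq ?_
  simp

end HasCondExpLE

end Conditioning

/-! ### The iterates -/

theorem one_le_log_six_mul_div_pow_four {n : ℕ} {γ : ℝ} (hn : 0 < n) (hγ : 0 < γ) (hγ1 : γ ≤ 1) :
    1 ≤ Real.log (6 * n / γ ^ 4) := by
  have one_le_n : (1 : ℝ) ≤ n := by exact_mod_cast hn
  have pow_le_one : γ ^ 4 ≤ 1 := pow_le_one₀ hγ.le hγ1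
  rw [Real.le_log_iff_exp_le (by positivity), le_div_iff₀ (by positivity)]
  calc Real.exp 1 * γ ^ 4 ≤ 6 * 1 := by
        gcongr
        linarith [Real.exp_one_lt_d9]
    _ ≤ 6 * n := by gcongr

theorem sq_le_of_log_mul_lt {n L : ℕ} {γ y z c : ℝ} (hn : 0 < n) (hγ : 0 < γ) (hγ1 : γ ≤ 1)
    (hz : z ≠ 0) (hc : y ^ 2 / z ^ 2 ≤ c) (h : Real.log (6 * n / γ ^ 4) / (2 * γ ^ 2) * c < L) :
    y ^ 2 ≤ 2 * γ ^ 2 * z ^ 2 * L := by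
  have one_le_log := one_le_log_six_mul_div_pow_four hn hγ hγ1
  have : 0 ≤ Real.log (6 * n / γ ^ 4) := zero_le_one.trans one_le_log
  have ratio_le : 1 / (2 * γ ^ 2) * (y ^ 2 / z ^ 2) ≤ L := by
    refine le_trans ?_ h.le
    gcongr
  rw [div_mul_div_comm, one_mul, div_le_iff₀ (by positivity)] at ratio_le
  linarith

theorem ite_abs_mem_Ioc {y A : ℝ} (h : |y| ≤ A) :
    (if y ≠ 0 then |y| else 1) ∈ Set.Ioc 0 (A + 1) := by
  split_ifs with hy
  · exact ⟨abs_pos.2 hy, h.trans (le_add_of_nonneg_right zero_le_one)⟩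
  · exact ⟨one_pos, le_add_of_nonneg_left ((abs_nonneg y).trans h)⟩

namespace Model

variable {n d : ℕ} {M : Model n d}

section SampleSize

variable {B b' B' b'' B'' γ A : ℝ} {i : Fin n} {x : Param d} {L : ℕ}

theorem sq_le_of_sampleFactor_lt (hn : 0 < n) (hγ : 0 < γ) (hγ1 : γ ≤ 1) (hE : M.Eφ i x ≠ 0)
    (h : Real.log (6 * n / γ ^ 4) / (2 * γ ^ 2) * M.sampleFactor B b' B' b'' B'' i x < L) :
    B ^ 2 ≤ 2 * γ ^ 2 * M.Eφ i x ^ 2 * L := by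
  rw [← sq_abs (M.Eφ i x)]
  exact sq_le_of_log_mul_lt hn hγ hγ1 (abs_ne_zero.2 hE) (le_max_left _ _) h

theorem sub_sq_le_of_sampleFactor_lt (hn : 0 < n) (hγ : 0 < γ) (hγ1 : γ ≤ 1)
    (hA : |M.Eφ' i x| ≤ A)
    (h : Real.log (6 * n / γ ^ 4) / (2 * γ ^ 2) * M.sampleFactor B b' B' b'' B'' i x < L) :
    (B' - b') ^ 2 ≤ 2 * γ ^ 2 * (A + 1) ^ 2 * L := by
  have ⟨pos, le⟩ := ite_abs_mem_Ioc hA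
  refine (sq_le_of_log_mul_lt hn hγ hγ1 pos.ne'
    ((le_max_left _ _).trans (le_max_right _ _)) h).trans ?_
  gcongr

theorem sub_sq_le_of_sampleFactor_lt' (hn : 0 < n) (hγ : 0 < γ) (hγ1 : γ ≤ 1)
    (hA : |M.Eφ'' i x| ≤ A)
    (h : Real.log (6 * n / γ ^ 4) / (2 * γ ^ 2) * M.sampleFactor B b' B' b'' B'' i x < L) :
    (B'' - b'') ^ 2 ≤ 2 * γ ^ 2 * (A + 1) ^ 2 * L := by
  have ⟨pos, le⟩ := ite_abs_mem_Ioc hA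
  refine (sq_le_of_log_mul_lt hn hγ hγ1 pos.ne'
    ((le_max_right _ _).trans (le_max_right _ _)) h).trans ?_
  gcongr

end SampleSize

theorem measurable_g (i : Fin n) : Measurable (Function.uncurry (M.g i)) := by
  have := (M.continuous_latentMean i).measurable
  have := (M.continuous_latentVar i).measurable
  unfold Function.uncurry g
  fun_prop

theorem measurable_φ (hlik : ∀ i, Measurable (M.lik i)) (i : Fin n) :
    Measurable (Function.uncurry (M.φ i)) :=
  (hlik i).comp (measurable_g i)

theorem measurable_φ' (i : Fin n) : Measurable (Function.uncurry (M.φ' i)) :=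
  (measurable_deriv _).comp (measurable_g i)

theorem measurable_φ'' (i : Fin n) : Measurable (Function.uncurry (M.φ'' i)) :=
  (measurable_deriv _).comp (measurable_g i)

theorem measurable_direction {α : Type*} {mα : MeasurableSpace α} {L : α → ℕ}
    {e : α → Fin n → ℕ → ℝ} {x : α → Param d} (hlik : ∀ i, Measurable (M.lik i)) (ν : ℝ)
    (hL : Measurable L) (he : ∀ i l, Measurable fun a => e a i l) (hx : Measurable x) :
    Measurable fun a => M.direction ν (L a) (e a) (x a) := by
  have measurable_avg_comp : ∀ i {ψ : Param d → ℝ → ℝ}, Measurable (Function.uncurry ψ) →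
      Measurable fun a => avg (L a) (e a i) (ψ (x a)) := fun i ψ hψ =>
    measurable_avg hL (he i) (hψ.comp ((hx.comp measurable_fst).prodMk measurable_snd))
  unfold direction
  refine Measurable.sub ((measurable_const_smul _).comp (Finset.measurable_fun_sum _ fun i _ => ?_))
    ((measurable_gradient _).comp hx)
  have measurable_denom := (measurable_avg_comp i (measurable_φ hlik i)).add_const ν
  simp only [lossDirection, pack_smul_smul]
  exact (((measurable_avg_comp i (measurable_φ' i)).div measurable_denom).smul_const _).add
    (((measurable_avg_comp i (measurable_φ'' i)).div measurable_denom).smul_const _)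

theorem measurable_ratioError_comp {α : Type*} [MeasurableSpace α] {L : α → ℕ}
    {e : α → ℕ → ℝ} {x : α → Param d} (hlik : ∀ i, Measurable (M.lik i)) (i : Fin n)
    {ψ : Param d → ℝ → ℝ} (hψ : Measurable (Function.uncurry ψ)) (ν : ℝ) (hL : Measurable L)
    (he : ∀ l, Measurable fun a => e a l) (hx : Measurable x) :
    Measurable fun a => ratioError (gaussianReal 0 1) (ψ (x a)) (M.φ i (x a)) ν (L a) (e a) :=
  have measurable_comp : ∀ {ψ : Param d → ℝ → ℝ}, Measurable (Function.uncurry ψ) →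
      Measurable (Function.uncurry fun a => ψ (x a)) := fun hψ =>
    hψ.comp ((hx.comp measurable_fst).prodMk measurable_snd)
  measurable_ratioError hL he (measurable_comp hψ) (measurable_comp (measurable_φ hlik i)) ν

namespace IsSmoothBMC

variable {Ω : Type*} [MeasurableSpace Ω] {P : Measure Ω}
  {ℱ : Filtration ℕ ‹MeasurableSpace Ω›} {γ ν : ℕ → ℝ} {L : ℕ → Ω → ℕ}
  {ε : ℕ → Fin n → ℕ → Ω → ℝ} {r : ℕ → Ω → Param d}

theorem isIIDSample (hrun : M.IsSmoothBMC P ℱ γ ν L ε r) (t : ℕ) (i : Fin n) :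
    IsIIDSample P (gaussianReal 0 1) (ε t i) where
  measurable l := (hrun.draw_measurable t i l).mono (ℱ.le _) le_rfl
  map_eq := hrun.draw_law t i
  iIndepFun := hrun.draw_indep t i

theorem adapted (hrun : M.IsSmoothBMC P ℱ γ ν L ε r) (hlik : ∀ i, Measurable (M.lik i)) (t : ℕ) :
    Measurable[ℱ t] (r t) := by
  induction t with
  | zero => exact hrun.init_measurable
  | succ t ih =>
    have ℱ_le : ℱ t ≤ ℱ (t + 1) := ℱ.mono t.le_succ
    have measurable_r : Measurable[ℱ (t + 1)] (r t) := ih.mono ℱ_le le_rfl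
    rw [funext (hrun.update t)]
    exact measurable_r.add ((measurable_direction hlik (ν t)
      ((hrun.sampleSize_measurable t).mono ℱ_le le_rfl) (hrun.draw_measurable t)
      measurable_r).const_smul (γ t))

theorem measurable_iterate (hrun : M.IsSmoothBMC P ℱ γ ν L ε r) (hlik : ∀ i, Measurable (M.lik i))
    (t : ℕ) : Measurable (r t) :=
  (hrun.adapted hlik t).mono (ℱ.le t) le_rfl

theorem measurable_sampleSize (hrun : M.IsSmoothBMC P ℱ γ ν L ε r) (t : ℕ) : Measurable (L t) :=
  (hrun.sampleSize_measurable t).mono (ℱ.le t) le_rfl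

theorem hasCondExpLE_ratioError_sq [IsProbabilityMeasure P] {ζ B a b A D : ℝ}
    (hrun : M.IsSmoothBMC P ℱ γ ν L ε r) (hlik : ∀ i, Measurable (M.lik i)) {t : ℕ}
    (hγ : 0 < γ t) {i : Fin n} {ψ : Param d → ℝ → ℝ} (hψ : Measurable (Function.uncurry ψ))
    (hφB : ∀ x y, M.φ i x y ∈ Set.Icc 0 B) (hψab : ∀ x y, ψ x y ∈ Set.Icc a b)
    (hψA : ∀ x y, |ψ x y| ≤ A) (hζ : 0 < ζ) (hlower : ∀ᵐ ω ∂P, ζ ≤ M.Eφ i (r t ω))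
    (hLφ : ∀ᵐ ω ∂P, γ t ≤ 1 → B ^ 2 ≤ 2 * γ t ^ 2 * M.Eφ i (r t ω) ^ 2 * L t ω)
    (hLψ : ∀ᵐ ω ∂P, γ t ≤ 1 → (b - a) ^ 2 ≤ 2 * γ t ^ 2 * D ^ 2 * L t ω) :
    HasCondExpLE P (ℱ t) (fun ω => ratioError (gaussianReal 0 1) (ψ (r t ω)) (M.φ i (r t ω))
      (γ t * ζ) (L t ω) (fun l => ε t i l ω) ^ 2) (ratioErrorConst A B D ζ * γ t ^ 2) := by
  have iid := hrun.isIIDSample t i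
  refine HasCondExpLE.of_indep (ℱ.le t) (X := fun ω => (L t ω, r t ω))
    (Y := fun ω l => ε t i l ω) (Ψ := fun z => ratioError (gaussianReal 0 1) (ψ z.1.2)
      (M.φ i z.1.2) (γ t * ζ) z.1.1 z.2 ^ 2)
    ((hrun.sampleSize_measurable t).prodMk (hrun.adapted hlik t))
    (measurable_pi_lambda _ iid.measurable) (hrun.draw_indep_history t i)
    ((measurable_ratioError_comp hlik i hψ _ (by fun_prop) (fun l => by fun_prop)
      (by fun_prop)).pow_const 2) ?_ ?_
  · have error_bound : ∀ᵐ ω ∂P, ‖ratioError (gaussianReal 0 1) (ψ (r t ω)) (M.φ i (r t ω))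
        (γ t * ζ) (L t ω) (fun l => ε t i l ω)‖ ≤ A / (γ t * ζ) + A / ζ := by
      filter_upwards [hlower] with ω hω
      exact abs_ratioError_le (hψA _) (fun y => (hφB _ y).1) hζ hω (mul_pos hγ hζ)
        (hrun.sampleSize_pos t ω) _
    exact (MemLp.of_bound (measurable_ratioError_comp hlik i hψ _ (hrun.measurable_sampleSize t)
      iid.measurable (hrun.measurable_iterate hlik t)).aestronglyMeasurable _
      error_bound).integrable_sq
  · filter_upwards [hlower, hLφ, hLψ] with ω hω hωφ hωψ
    exact iid.integral_ratioError_sq_le (hrun.sampleSize_pos t ω)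
      (measurable_φ hlik i).of_uncurry_left hψ.of_uncurry_left
      (hφB _) (hψab _) (hψA _) hζ hω hγ hωφ hωψ

end IsSmoothBMC

end Model

/-! ### The error of the step direction -/

theorem norm_mean_sq_le {E : Type*} [SeminormedAddCommGroup E] [NormedSpace ℝ E] {n : ℕ}
    (x : Fin n → E) : ‖(1 / (n : ℝ)) • ∑ i, x i‖ ^ 2 ≤ 1 / (n : ℝ) * ∑ i, ‖x i‖ ^ 2 := by
  rcases n.eq_zero_or_pos with rfl | hn
  · simp
  have cauchy_schwarz : (∑ i, ‖x i‖) ^ 2 ≤ n * ∑ i, ‖x i‖ ^ 2 := by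
    simpa using sq_sum_le_card_mul_sum_sq (s := Finset.univ) (f := fun i => ‖x i‖)
  rw [norm_smul, mul_pow, Real.norm_eq_abs, sq_abs]
  calc (1 / (n : ℝ)) ^ 2 * ‖∑ i, x i‖ ^ 2 ≤ (1 / (n : ℝ)) ^ 2 * (n * ∑ i, ‖x i‖ ^ 2) := by
        gcongr
        exact (pow_le_pow_left₀ (norm_nonneg _) (norm_sum_le _ _) 2).trans cauchy_schwarz
    _ = 1 / (n : ℝ) * ∑ i, ‖x i‖ ^ 2 := by field_simp

theorem norm_pack_smul_smul_sq_le {d : ℕ} (y z : ℝ) (u : Fin d → ℝ)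
    (W : Matrix (Fin d) (Fin d) ℝ) :
    ‖pack (y • u) (z • W)‖ ^ 2 ≤ 2 * ‖pack u 0‖ ^ 2 * y ^ 2 + 2 * ‖pack 0 W‖ ^ 2 * z ^ 2 := by
  rw [pack_smul_smul]
  calc ‖y • pack u 0 + z • pack 0 W‖ ^ 2
      ≤ (‖y • pack u 0‖ + ‖z • pack 0 W‖) ^ 2 := by gcongr; exact norm_add_le _ _
    _ ≤ 2 * (‖y • pack u 0‖ ^ 2 + ‖z • pack 0 W‖ ^ 2) := add_sq_le
    _ = 2 * ‖pack u 0‖ ^ 2 * y ^ 2 + 2 * ‖pack 0 W‖ ^ 2 * z ^ 2 := by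
        simp only [norm_smul, mul_pow, Real.norm_eq_abs, sq_abs]
        ring

namespace Model

variable {n d : ℕ} {M : Model n d}

theorem direction_add_objectiveGradient (ν : ℝ) (l : ℕ) (e : Fin n → ℕ → ℝ) (x : Param d) :
    M.direction ν l e x + M.objectiveGradient x = (1 / (n : ℝ)) • ∑ i,
      pack (ratioError (gaussianReal 0 1) (M.φ' i x) (M.φ i x) ν l (e i) • M.a₁ i)
        (ratioError (gaussianReal 0 1) (M.φ'' i x) (M.φ i x) ν l (e i) •
          ((1 / 2 : ℝ) • Matrix.vecMulVec (M.a₂ i) (M.a₂ i))) := by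
  rw [direction, objectiveGradient, sub_add_sub_cancel, ← smul_sub, ← Finset.sum_sub_distrib]
  congr 1
  refine Finset.sum_congr rfl fun i _ => ?_
  rw [lossDirection, ← pack_sub, ← sub_smul, ← sub_smul]
  rfl

theorem norm_direction_add_objectiveGradient_sq_le (ν : ℝ) (l : ℕ) (e : Fin n → ℕ → ℝ)
    (x : Param d) :
    ‖M.direction ν l e x + M.objectiveGradient x‖ ^ 2 ≤ 1 / (n : ℝ) * ∑ i,
      (2 * ‖pack (M.a₁ i) 0‖ ^ 2 *
          ratioError (gaussianReal 0 1) (M.φ' i x) (M.φ i x) ν l (e i) ^ 2 +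
        2 * ‖pack 0 ((1 / 2 : ℝ) • Matrix.vecMulVec (M.a₂ i) (M.a₂ i))‖ ^ 2 *
          ratioError (gaussianReal 0 1) (M.φ'' i x) (M.φ i x) ν l (e i) ^ 2) := by
  rw [direction_add_objectiveGradient]
  refine (norm_mean_sq_le _).trans ?_
  gcongr
  exact norm_pack_smul_smul_sq_le _ _ _ _

namespace IsSmoothBMC

variable {Ω : Type*} [MeasurableSpace Ω] {P : Measure Ω}
  {ℱ : Filtration ℕ ‹MeasurableSpace Ω›} {γ : ℕ → ℝ} {L : ℕ → Ω → ℕ}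
  {ε : ℕ → Fin n → ℕ → Ω → ℝ} {r : ℕ → Ω → Param d} {B b' B' b'' B'' ζ : ℝ}

theorem measurable_direction_add_gradient_objective
    (hrun : M.IsSmoothBMC P ℱ γ (fun t => γ t * ζ) L ε r) (hlik : ∀ i, Measurable (M.lik i))
    (t : ℕ) :
    Measurable fun ω => M.direction (γ t * ζ) (L t ω) (fun i l => ε t i l ω) (r t ω) +
      gradient M.objective (r t ω) :=
  (measurable_direction hlik _ (hrun.measurable_sampleSize t)
    (fun i => (hrun.isIIDSample t i).measurable) (hrun.measurable_iterate hlik t)).add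
    ((measurable_gradient M.objective).comp (hrun.measurable_iterate hlik t))

variable [IsProbabilityMeasure P]

theorem hasCondExpLE_ratioError_φ'_sq (hrun : M.IsSmoothBMC P ℱ γ (fun t => γ t * ζ) L ε r)
    (hn : 0 < n) (hlik : ∀ i, Measurable (M.lik i)) (hb : M.DerivBounds B b' B' b'' B'')
    (hζ : 0 < ζ) (hγ : ∀ t, 0 < γ t) (hlower : ∀ᵐ ω ∂P, ∀ t i, ζ ≤ M.Eφ i (r t ω))
    (hL : ∀ᵐ ω ∂P, ∀ t i, Real.log (6 * n / γ t ^ 4) / (2 * γ t ^ 2) *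
      M.sampleFactor B b' B' b'' B'' i (r t ω) < L t ω) (t : ℕ) (i : Fin n) :
    HasCondExpLE P (ℱ t) (fun ω => ratioError (gaussianReal 0 1) (M.φ' i (r t ω))
      (M.φ i (r t ω)) (γ t * ζ) (L t ω) (fun l => ε t i l ω) ^ 2)
      (ratioErrorConst (max |b'| |B'|) B (max |b'| |B'| + 1) ζ * γ t ^ 2) := by
  have abs_le : ∀ x y, |M.φ' i x y| ≤ max |b'| |B'| := fun x y =>
    abs_le_max_abs_abs (hb i x y).2.1.1 (hb i x y).2.1.2
  refine hrun.hasCondExpLE_ratioError_sq hlik (hγ t) (measurable_φ' i) (fun x y => (hb i x y).1)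
    (fun x y => (hb i x y).2.1) abs_le hζ (hlower.mono fun ω h => h t i) ?_ ?_
  · filter_upwards [hlower, hL] with ω hω hLω hγ1
    exact sq_le_of_sampleFactor_lt hn (hγ t) hγ1 (hζ.trans_le (hω t i)).ne' (hLω t i)
  · filter_upwards [hL] with ω hLω hγ1
    exact sub_sq_le_of_sampleFactor_lt hn (hγ t) hγ1 (abs_integral_le_of_abs_le (abs_le _))
      (hLω t i)

theorem hasCondExpLE_ratioError_φ''_sq (hrun : M.IsSmoothBMC P ℱ γ (fun t => γ t * ζ) L ε r)
    (hn : 0 < n) (hlik : ∀ i, Measurable (M.lik i)) (hb : M.DerivBounds B b' B' b'' B'')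
    (hζ : 0 < ζ) (hγ : ∀ t, 0 < γ t) (hlower : ∀ᵐ ω ∂P, ∀ t i, ζ ≤ M.Eφ i (r t ω))
    (hL : ∀ᵐ ω ∂P, ∀ t i, Real.log (6 * n / γ t ^ 4) / (2 * γ t ^ 2) *
      M.sampleFactor B b' B' b'' B'' i (r t ω) < L t ω) (t : ℕ) (i : Fin n) :
    HasCondExpLE P (ℱ t) (fun ω => ratioError (gaussianReal 0 1) (M.φ'' i (r t ω))
      (M.φ i (r t ω)) (γ t * ζ) (L t ω) (fun l => ε t i l ω) ^ 2)
      (ratioErrorConst (max |b''| |B''|) B (max |b''| |B''| + 1) ζ * γ t ^ 2) := by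
  have abs_le : ∀ x y, |M.φ'' i x y| ≤ max |b''| |B''| := fun x y =>
    abs_le_max_abs_abs (hb i x y).2.2.1 (hb i x y).2.2.2
  refine hrun.hasCondExpLE_ratioError_sq hlik (hγ t) (measurable_φ'' i) (fun x y => (hb i x y).1)
    (fun x y => (hb i x y).2.2) abs_le hζ (hlower.mono fun ω h => h t i) ?_ ?_
  · filter_upwards [hlower, hL] with ω hω hLω hγ1
    exact sq_le_of_sampleFactor_lt hn (hγ t) hγ1 (hζ.trans_le (hω t i)).ne' (hLω t i)
  · filter_upwards [hL] with ω hLω hγ1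
    exact sub_sq_le_of_sampleFactor_lt' hn (hγ t) hγ1 (abs_integral_le_of_abs_le (abs_le _))
      (hLω t i)

theorem exists_hasCondExpLE_norm_error_sq (hrun : M.IsSmoothBMC P ℱ γ (fun t => γ t * ζ) L ε r)
    (hn : 0 < n) (hlik : ∀ i, Measurable (M.lik i)) (hb : M.DerivBounds B b' B' b'' B'')
    (hζ : 0 < ζ) (hγ : ∀ t, 0 < γ t) (hlower : ∀ᵐ ω ∂P, ∀ t i, ζ ≤ M.Eφ i (r t ω))
    (hL : ∀ᵐ ω ∂P, ∀ t i, Real.log (6 * n / γ t ^ 4) / (2 * γ t ^ 2) *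
      M.sampleFactor B b' B' b'' B'' i (r t ω) < L t ω)
    (hgradient : ∀ᵐ ω ∂P, ∀ t, gradient M.objective (r t ω) = M.objectiveGradient (r t ω)) :
    ∃ K : ℝ, ∀ t, HasCondExpLE P (ℱ t) (fun ω => ‖M.direction (γ t * ζ) (L t ω)
      (fun i l => ε t i l ω) (r t ω) + gradient M.objective (r t ω)‖ ^ 2) (K * γ t ^ 2) := by
  refine ⟨1 / (n : ℝ) * ∑ i, (2 * ‖pack (M.a₁ i) 0‖ ^ 2 *
      ratioErrorConst (max |b'| |B'|) B (max |b'| |B'| + 1) ζ +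
    2 * ‖pack 0 ((1 / 2 : ℝ) • Matrix.vecMulVec (M.a₂ i) (M.a₂ i))‖ ^ 2 *
      ratioErrorConst (max |b''| |B''|) B (max |b''| |B''| + 1) ζ), fun t => ?_⟩
  simp only [mul_assoc _ _ (γ t ^ 2), Finset.sum_mul, add_mul]
  refine ((HasCondExpLE.sum Finset.univ fun i _ =>
    ((hrun.hasCondExpLE_ratioError_φ'_sq hn hlik hb hζ hγ hlower hL t i).const_mul
      (by positivity)).add
    ((hrun.hasCondExpLE_ratioError_φ''_sq hn hlik hb hζ hγ hlower hL t i).const_mul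
      (by positivity))).const_mul (by positivity)).mono
    ((hrun.measurable_direction_add_gradient_objective hlik t).norm.pow_const
      2).aestronglyMeasurable (ae_of_all _ fun _ => sq_nonneg _) ?_
  filter_upwards [hgradient] with ω hω
  rw [hω t]
  exact norm_direction_add_objectiveGradient_sq_le _ _ _ _

end IsSmoothBMC

end Model

/-! ### Noisy gradient descent -/

theorem ae_summable_of_integral_le {Ω : Type*} [MeasurableSpace Ω] {P : Measure Ω}
    {X : ℕ → Ω → ℝ} {c : ℕ → ℝ} (hX : ∀ t, Integrable (X t) P) (hX₀ : ∀ t ω, 0 ≤ X t ω)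
    (hc : Summable c) (h : ∀ t, ∫ ω, X t ω ∂P ≤ c t) :
    ∀ᵐ ω ∂P, Summable fun t => X t ω := by
  have aemeasurable_ofReal : ∀ t, AEMeasurable (fun ω => ENNReal.ofReal (X t ω)) P := fun t =>
    (hX t).aemeasurable.ennreal_ofReal
  have lintegral_tsum_ne_top : ∫⁻ ω, ∑' t, ENNReal.ofReal (X t ω) ∂P ≠ ⊤ := by
    rw [lintegral_tsum aemeasurable_ofReal]
    refine ne_top_of_le_ne_top hc.tsum_ofReal_ne_top (ENNReal.tsum_le_tsum fun t => ?_)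
    rw [← ofReal_integral_eq_lintegral_ofReal (hX t) (ae_of_all _ (hX₀ t))]
    exact ENNReal.ofReal_le_ofReal (h t)
  filter_upwards [ae_lt_top' (AEMeasurable.tsum aemeasurable_ofReal) lintegral_tsum_ne_top]
    with ω hω
  exact (ENNReal.summable_toReal hω.ne).congr fun t => ENNReal.toReal_ofReal (hX₀ t ω)

theorem memLp_lipschitz_comp {Ω E F : Type*} [MeasurableSpace Ω] {P : Measure Ω}
    [IsFiniteMeasure P] [NormedAddCommGroup E] [NormedAddCommGroup F] {G : E → F}
    (hG : ∃ K : ℝ≥0, LipschitzWith K G) {X : Ω → E} {p : ENNReal} (hX : MemLp X p P) :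
    MemLp (fun ω => G (X ω)) p P := by
  obtain ⟨K, hK⟩ := hG
  have memLp_sub := (hK.sub (LipschitzWith.const (G 0))).comp_memLp (sub_self _) hX
  exact (memLp_sub.add (memLp_const (G 0))).congr_norm
    (hK.continuous.comp_aestronglyMeasurable hX.1) (ae_of_all _ fun ω => by simp)

theorem eq_of_mapClusterPt_of_tendsto_comp {ι X Y : Type*} [TopologicalSpace X]
    [TopologicalSpace Y] [T2Space Y] {l : Filter ι} {u : ι → X} {F : X → Y} {x : X} {y : Y}
    (hF : ContinuousAt F x) (hx : MapClusterPt x l u)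
    (hy : Tendsto (fun t => F (u t)) l (𝓝 y)) : F x = y :=
  have : ClusterPt (F x) (𝓝 y) := ClusterPt.mono (hx.continuousAt_comp hF) hy
  eq_of_nhds_neBot this

/-- The iteration `r (t + 1) = r t + γ t • (s t + w t)` with the drift `s t = -F (r t)` and a noise
`w t` whose conditional mean square is at most `K * γ t ^ 2`. The drift is a process of its own, and
equals `-F (r t)` almost surely only, because `F` will extend a gradient beyond the set that
contains the iterates almost surely. -/
structure IsNoisyGradientDescent {Ω E : Type*} [MeasurableSpace Ω] [NormedAddCommGroup E]
    [NormedSpace ℝ E] [MeasurableSpace E] (P : Measure Ω) (ℱ : Filtration ℕ ‹MeasurableSpace Ω›)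
    (γ : ℕ → ℝ) (F : E → E) (r s w : ℕ → Ω → E) (K : ℝ) : Prop where
  init_memLp : MemLp (r 0) 2 P
  adapted : ∀ t, Measurable[ℱ t] (r t)
  drift_adapted : ∀ t, StronglyMeasurable[ℱ t] (s t)
  drift_eq : ∀ᵐ ω ∂P, ∀ t, s t ω = -F (r t ω)
  noise_aestronglyMeasurable : ∀ t, AEStronglyMeasurable (w t) P
  noise_hasCondExpLE : ∀ t, HasCondExpLE P (ℱ t) (fun ω => ‖w t ω‖ ^ 2) (K * γ t ^ 2)
  update : ∀ t ω, r (t + 1) ω = r t ω + γ t • (s t ω + w t ω)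

namespace IsNoisyGradientDescent

variable {Ω E : Type*} [MeasurableSpace Ω] {P : Measure Ω}
  {ℱ : Filtration ℕ ‹MeasurableSpace Ω›} [NormedAddCommGroup E] [InnerProductSpace ℝ E]
  [MeasurableSpace E] {γ : ℕ → ℝ} {F : E → E} {r s w : ℕ → Ω → E} {K : ℝ}

theorem memLp_noise (h : IsNoisyGradientDescent P ℱ γ F r s w K) (t : ℕ) : MemLp (w t) 2 P :=
  (memLp_two_iff_integrable_sq_norm (h.noise_aestronglyMeasurable t)).2
    (h.noise_hasCondExpLE t).integrable

theorem memLp_drift_of_memLp [IsFiniteMeasure P] (h : IsNoisyGradientDescent P ℱ γ F r s w K)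
    (hF : ∃ K : ℝ≥0, LipschitzWith K F) {t : ℕ} (hr : MemLp (r t) 2 P) : MemLp (s t) 2 P :=
  (memLp_lipschitz_comp hF hr).neg.ae_eq (h.drift_eq.mono fun _ hω => (hω t).symm)

theorem memLp [IsFiniteMeasure P] (h : IsNoisyGradientDescent P ℱ γ F r s w K)
    (hF : ∃ K : ℝ≥0, LipschitzWith K F) (t : ℕ) : MemLp (r t) 2 P := by
  induction t with
  | zero => exact h.init_memLp
  | succ t ih =>
    rw [funext (h.update t)]
    exact ih.add (((h.memLp_drift_of_memLp hF ih).add (h.memLp_noise t)).const_smul (γ t))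

variable [CompleteSpace E]

theorem stochasticGradientConditions [IsFiniteMeasure P]
    (h : IsNoisyGradientDescent P ℱ γ F r s w K) {f : E → ℝ} (hf : HasLipschitzGradient f F)
    (hf₀ : ∀ x, 0 ≤ f x) (hγ : ∀ t, 0 ≤ γ t)
    (hγsum : Tendsto (fun T => ∑ t ∈ Finset.range T, γ t) atTop atTop)
    (hγsq : Summable fun t => γ t ^ 2) : StochasticGradientConditions P ℱ γ f r s w := by
  have memLp_s : ∀ t, MemLp (s t) 2 P := fun t =>
    h.memLp_drift_of_memLp hf.lipschitz (h.memLp hf.lipschitz t)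
  refine ⟨h.adapted, memLp_s, h.memLp_noise, h.update, hγ, hγsum, hγsq, hf₀, hf.contDiff,
    hf.gradient_eq ▸ hf.lipschitz, ⟨1, 1, one_pos, one_pos, fun t => ⟨?_, ?_⟩⟩,
    ⟨1, |K| + 1, one_pos, by positivity, fun t => ?_⟩⟩
  · rw [condExp_of_stronglyMeasurable (ℱ.le t) (h.drift_adapted t)
      ((memLp_s t).integrable one_le_two), hf.gradient_eq]
    filter_upwards [h.drift_eq] with ω hω
    rw [hω t, inner_neg_right, neg_neg, real_inner_self_eq_norm_sq, one_mul]
  · rw [condExp_of_stronglyMeasurable (f := fun ω => ‖s t ω‖ ^ 2) (ℱ.le t)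
      ((h.drift_adapted t).norm.pow 2) (memLp_s t).norm.integrable_sq, hf.gradient_eq]
    filter_upwards [h.drift_eq] with ω hω
    rw [hω t, norm_neg, one_mul]
  · filter_upwards [(h.noise_hasCondExpLE t).condExp_le] with ω hω
    calc _ ≤ K * γ t ^ 2 := hω
      _ ≤ (|K| + 1) ^ 2 * γ t ^ 2 := by
        gcongr
        nlinarith [le_abs_self K, abs_nonneg K]
      _ ≤ (γ t * (|K| + 1 + 1 * ‖gradient f (r t ω)‖)) ^ 2 := by
        rw [← mul_pow, mul_comm (|K| + 1)]
        have := hγ t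
        gcongr ?_ ^ 2
        exact mul_le_mul_of_nonneg_left (le_add_of_nonneg_right (by positivity)) this

theorem ae_tendsto [IsProbabilityMeasure P] (h : IsNoisyGradientDescent P ℱ γ F r s w K)
    {f : E → ℝ} (hf : HasLipschitzGradient f F) (hf₀ : ∀ x, 0 ≤ f x) (hγ : ∀ t, 0 ≤ γ t)
    (hγsum : Tendsto (fun T => ∑ t ∈ Finset.range T, γ t) atTop atTop)
    (hγsq : Summable fun t => γ t ^ 2) :
    ∀ᵐ ω ∂P, (∃ l, Tendsto (fun t => f (r t ω)) atTop (𝓝 l)) ∧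
      Tendsto (fun t => F (r t ω)) atTop (𝓝 0) := by
  have summable_noise : ∀ᵐ ω ∂P, Summable fun t => ‖w t ω‖ ^ 2 :=
    ae_summable_of_integral_le (fun t => (h.noise_hasCondExpLE t).integrable)
      (fun _ _ => sq_nonneg _) (hγsq.mul_left K)
      fun t => (h.noise_hasCondExpLE t).integral_le (ℱ.le t)
  filter_upwards [h.drift_eq, summable_noise] with ω hdrift hnoise
  refine tendsto_of_gradient_descent hf hf₀ hγ
    ((not_summable_iff_tendsto_nat_atTop_of_nonneg hγ).2 hγsum) hγsq hnoise fun t => ?_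
  rw [h.update, hdrift]

end IsNoisyGradientDescent

theorem Model.IsSmoothBMC.exists_isNoisyGradientDescent {n d : ℕ} {M : Model n d} {Ω : Type*}
    [MeasurableSpace Ω] {P : Measure Ω} [IsProbabilityMeasure P]
    {ℱ : Filtration ℕ ‹MeasurableSpace Ω›} {γ : ℕ → ℝ} {L : ℕ → Ω → ℕ}
    {ε : ℕ → Fin n → ℕ → Ω → ℝ} {r : ℕ → Ω → Param d} {B b' B' b'' B'' ζ : ℝ}
    (hrun : M.IsSmoothBMC P ℱ γ (fun t => γ t * ζ) L ε r) (hn : 0 < n)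
    (hlik : ∀ i, Measurable (M.lik i)) (hb : M.DerivBounds B b' B' b'' B'')
    (hζ : 0 < ζ) (hγ : ∀ t, 0 < γ t) (hlower : ∀ᵐ ω ∂P, ∀ t i, ζ ≤ M.Eφ i (r t ω))
    (hL : ∀ᵐ ω ∂P, ∀ t i, Real.log (6 * n / γ t ^ 4) / (2 * γ t ^ 2) *
      M.sampleFactor B b' B' b'' B'' i (r t ω) < L t ω) {F : Param d → Param d}
    (hF : ∀ᵐ ω ∂P, ∀ t, gradient M.objective (r t ω) = F (r t ω))
    (hF' : ∀ᵐ ω ∂P, ∀ t, F (r t ω) = M.objectiveGradient (r t ω)) :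
    ∃ K, IsNoisyGradientDescent P ℱ γ F r (fun t ω => -gradient M.objective (r t ω))
      (fun t ω => M.direction (γ t * ζ) (L t ω) (fun i l => ε t i l ω) (r t ω) +
        gradient M.objective (r t ω)) K := by
  obtain ⟨K, hK⟩ := hrun.exists_hasCondExpLE_norm_error_sq hn hlik hb hζ hγ hlower hL
    (hF.mp (hF'.mono fun ω h' h t => (h t).trans (h' t)))
  exact ⟨K, {
    init_memLp := hrun.init_memLp
    adapted := hrun.adapted hlik
    drift_adapted := fun t =>
      ((measurable_gradient M.objective).comp (hrun.adapted hlik t)).neg.stronglyMeasurable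
    drift_eq := hF.mono fun ω h t => congrArg Neg.neg (h t)
    noise_aestronglyMeasurable := fun t =>
      (hrun.measurable_direction_add_gradient_objective hlik t).aestronglyMeasurable
    noise_hasCondExpLE := hK
    update := fun t ω => by rw [hrun.update, neg_add_cancel_comm_assoc] }⟩

end SmoothBMC

end

theorem mainTheorem2 {n d : ℕ} (hn : 0 < n) (M : SmoothBMC.Model n d)
    (hβ : 0 ≤ M.β) (hS₀ : M.S₀.PosDef) (hb₂ : ∀ i, 0 ≤ M.b₂ i)
    (hlik : ∀ i, Differentiable ℝ (M.lik i)) (hlik' : ∀ i, Differentiable ℝ (deriv (M.lik i)))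
    {B b' B' b'' B'' : ℝ} (hbounds : M.DerivBounds B b' B' b'' B'')
    {Ω : Type*} [MeasurableSpace Ω] (P : Measure Ω) [IsProbabilityMeasure P]
    (ℱ : Filtration ℕ ‹MeasurableSpace Ω›)
    (γ : ℕ → ℝ) (hγ : ∀ t, 0 < γ t)
    (hγsum : Tendsto (fun T => ∑ t ∈ Finset.range T, γ t) atTop atTop)
    (hγsq : Summable fun t => γ t ^ 2)
    (ζ v : ℝ) (hζ : 0 < ζ) (hv : 0 < v)
    (L : ℕ → Ω → ℕ) (ε : ℕ → Fin n → ℕ → Ω → ℝ) (r : ℕ → Ω → SmoothBMC.Param d)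
    (hrun : M.IsSmoothBMC P ℱ γ (fun t => γ t * ζ) L ε r)
    (hlower : ∀ᵐ ω ∂P, ∀ t i, ζ ≤ M.Eφ i (r t ω))
    (hcov : ∀ᵐ ω ∂P, ∀ t,
      (SmoothBMC.cov (r t ω) - v • (1 : Matrix (Fin d) (Fin d) ℝ)).PosSemidef)
    (hL : ∀ᵐ ω ∂P, ∀ t i, Real.log (6 * n / γ t ^ 4) / (2 * γ t ^ 2) *
      M.sampleFactor B b' B' b'' B'' i (r t ω) < L t ω) :
    (∃ (f : SmoothBMC.Param d → ℝ) (C : ℝ),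
      (∀ x ∈ M.domain ζ v, f x = M.objective x + C ∧
        HasGradientAt M.objective (gradient f x) x) ∧
      SmoothBMC.StochasticGradientConditions P ℱ γ f r
        (fun t ω => -gradient M.objective (r t ω))
        (fun t ω => M.direction (γ t * ζ) (L t ω) (fun i l => ε t i l ω) (r t ω)
          + gradient M.objective (r t ω))) ∧
    ∀ᵐ ω ∂P,
      (∃ c : ℝ, Tendsto (fun t => M.objective (r t ω)) atTop (𝓝 c)) ∧
      Tendsto (fun t => gradient M.objective (r t ω)) atTop (𝓝 0) ∧
      ∀ x, MapClusterPt x atTop (fun t => r t ω) → HasGradientAt M.objective 0 x := by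
  obtain ⟨Φ, F, c, hΦ, hc, hF⟩ :=
    M.exists_extension_objective hβ hS₀ hb₂ hlik hlik' hbounds hζ hv
  have gradient_eqOn : Set.EqOn (gradient M.objective) F (M.domain ζ v) := fun x hx =>
    (hΦ.hasGradientAt x hx).gradient
  have hmem : ∀ᵐ ω ∂P, ∀ t, r t ω ∈ M.domain ζ v := by
    filter_upwards [hlower, hcov] with ω hlowerω hcovω t
    exact ⟨hcovω t, hlowerω t⟩
  obtain ⟨K, hK⟩ := hrun.exists_isNoisyGradientDescent hn (fun i => (hlik i).continuous.measurable)
    hbounds hζ hγ hlower hL (hmem.mono fun ω h t => gradient_eqOn (h t))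
    (hmem.mono fun ω h t => hF (h t))
  have hf := hΦ.hasLipschitzGradient.sub_const c
  have hf₀ : ∀ x, 0 ≤ Φ x - c := fun x => sub_nonneg.2 (hc x)
  refine ⟨⟨fun x => Φ x - c, -c, fun x hx =>
    ⟨by simp only [hΦ.eqOn hx, sub_eq_add_neg], hf.gradient_eq ▸ hΦ.hasGradientAt x hx⟩,
    hK.stochasticGradientConditions hf hf₀ (fun t => (hγ t).le) hγsum hγsq⟩, ?_⟩
  filter_upwards [hmem, hK.ae_tendsto hf hf₀ (fun t => (hγ t).le) hγsum hγsq]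
    with ω hω ⟨⟨l, hl⟩, hlim⟩
  refine ⟨⟨l + c, (hl.add_const c).congr fun t => ?_⟩,
    hlim.congr fun t => (gradient_eqOn (hω t)).symm, fun x hx => ?_⟩
  · rw [sub_add_cancel, hΦ.eqOn (hω t)]
  have hx_mem := (M.isClosed_domain hbounds (fun i => (hlik i).continuous) ζ v).mem_of_mapClusterPt
    hx (Eventually.of_forall hω)
  exact SmoothBMC.eq_of_mapClusterPt_of_tendsto_comp hf.continuous_gradient.continuousAt hx hlim ▸
    hΦ.hasGradientAt x hx_mem
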